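/- **Setting.** Consider layered episodic MDPs with finite action space $\mathcal A$, horizon $H\ge 1$, finite state space $\mathcal S=\mathcal S_1\sqcup\dots\sqcup\mathcal S_H$, a fixed initial state $s_1\in\mathcal S_1$ and transition probabilities $P(s'\mid s,a)$ from $\mathcal S_h$ to $\mathcal S_{h+1}$. The policy set $\Pi$ is given by nonempty sets $\Pi(\cdot\mid s)\subseteq\Delta(\mathcal A)$, and $\pi\in\Pi$ iff $\pi(\cdot\mid s)\in\Pi(\cdot\mid s)$ for all $s\in\mathcal S$. In episode $t$ a loss function $\ell_t:\mathcal S\times\mathcal A\to[0,1]$ is produced, either by an adversary that knows the past of the interaction (adversarial setting) or by a draw from a fixed distribution, independent of the past (stochastic setting); the learner plays a policy $\pi_t$ and observes $o_t=(s_h,a_h,\ell_t(s_h,a_h))_{h\le H}$. A learner may be randomized; it draws fresh independent randomness in each episode. Let $\ell_t(\pi)=\mathbb E[\sum_{h\le H}\ell_t(s_h,a_h)\mid P,\pi]$, $\mathbb R(T)=\sum_{t\le T}\ell_t(\pi_t)-\inf_{\pi\in\Pi}\sum_{t\le T}\ell_t(\pi)$, let $q^{P,\pi}(s)$ be the probability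 that an episode under $\pi$ visits $s$, and let $\mathcal S^{\Pi,\epsilon}=\{s\in\mathcal S:\exists \pi\in\Pi,\ q^{P,\pi}(s)>\epsilon\}$, $\mathcal S^\Pi=\mathcal S^{\Pi,0}$. **Assumption on the black box.** $\mathrm{ALG}$ takes a state space, a policy set and a confidence level and is a learner that plays policies of the given policy set. In the setting considered (adversarial or stochastic), for the policy set $\Pi^\bot$ described below, every MDP $(\mathcal S',\mathcal A,H,P')$ and every $\delta'\in(0,1)$, with probability at least $1-\delta'$, for all $K>0$, $$\mathbb R^{\mathrm{ALG}}(K)\le reg\big(|\mathcal S'|,|\mathcal A|,H,\log(H|\mathcal S'||\mathcal A|K/\delta')\big)\sqrt K ,$$ where $reg(\cdot,\cdot,\cdot,L)\ge0$ is non-decreasing in all its arguments and grows polynomially in the logarithmic factor $L$: for some $d\in\mathbb N$, $reg(\cdot,\cdot,\cdot,cL)\le c^d\,reg(\cdot,\cdot,\cdot,L)$ for all $c\ge1$, $L\ge 0$. **SF-RL** (input: $\mathcal A$, $H$, $\Pi$, $\mathrm{ALG}$, confidence $\delta_0$, level $\epsilon\ge0$; no knowledge of $\mathcal S$ or $P$).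 It fixes an action $a^\bot$ and a default $\pi^\bot(\cdot\mid s)\in\Pi(\cdot\mid s)$ for every possible state $s$. It maintains a pruned space $\mathcal S^\bot$, initially consisting of $H$ auxiliary states $s^\bot_1,\dots,s^\bot_H$ only, and runs $\mathrm{ALG}$ on $\mathcal S^\bot$ with confidence $\delta_0/(2|\mathcal S^\bot|^2)$ and the policy set $\Pi^\bot$ that equals $\Pi(\cdot\mid s)$ at the states $s\in\mathcal S^\bot$ that are not auxiliary and allows only $a^\bot$ at the auxiliary states. In episode $t=1,2,\dots$ it plays the policy of $\mathrm{ALG}$ on the states of $\mathcal S^\bot$ and $\pi^\bot$ elsewhere. With $N_t(s)$ the number of visits to $s$ in the first $t$ episodes, say that $s$ passes the test at $t$ if $\tfrac12N_t(s)-\tfrac12\log(2H^2t^2/\delta_0)-\tfrac12>\epsilon t$. If episode $t$ visits a state outside $\mathcal S^\bot$ that passes the test, all visited states that pass it are added to $\mathcal S^\bot$ and $\mathrm{ALG}$ is restarted afresh on the new $\mathcal S^\bot$; otherwise $\mathrm{ALG}$ receives the pruned trajectory, in which from the first step $h$ with $s_h\notin\mathcal S^\bot$ on, states are replaced by $s^\bot_h$,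 actions by $a^\bot$ and losses by $0$. **Theorem.** For every $d$ there is a constant $C>0$, depending on $d$ only, such that under the assumption above, in either setting, for all $\delta\in(0,1)$, $\epsilon\ge0$, $T\ge1$ and every MDP, SF-RL run with confidence $\delta_0=\delta/3$ satisfies, with probability at least $1-\delta$, $$\mathbb R(T)\le C\Big(reg\big(|\mathcal S^{\Pi,\epsilon}|+H,|\mathcal A|,H,\log(H|\mathcal S^{\Pi,\epsilon}||\mathcal A|T/\delta)\big)\sqrt{|\mathcal S^{\Pi,\epsilon}|T}+\epsilon H|\mathcal S^\Pi|T+H^2|\mathcal S^\Pi|\log(2H^2T^2/\delta)\Big)$$ (if $\mathcal S^{\Pi,\epsilon}=\emptyset$, the first term is $0$). Consequently, as soon as $T$ is so large that the last, lower-order term is at most the sum of the first two, with probability at least $1-\delta$, $$\mathbb R(T)\le C\Big(reg\big(|\mathcal S^{\Pi,\epsilon}|+H,|\mathcal A|,H,\log(H|\mathcal S^{\Pi,\epsilon}||\mathcal A|T/\delta)\big)\sqrt{|\mathcal S^{\Pi,\epsilon}|T}+\epsilon H|\mathcal S^\Pi|T\Big).$$ -/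

import Mathlib

open MeasureTheory ProbabilityTheory

noncomputable section

namespace StateFreeRL

/-! ### Layered episodic MDPs

A state is a pair `(h, x)` of a layer `h : Fin H` and a label `x : X`; layer `h` holds the states that
can be occupied at step `h` (steps are numbered from `0`).  Each layer of an MDP is a finite set of
labels. -/

/-- A layered finite-horizon MDP with state labels in `X`, action space `A` and horizon `H`.
`trans h x a y` is the probability of moving from `(h, x)` to `(h + 1, y)` under action `a`.
The loss functions are not part of the MDP. -/
structure LayeredMDP (X A : Type) (H : ℕ) [NeZero H] where
  states : Fin H → Finset X
  init : X
  init_mem : init ∈ states 0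
  trans : Fin H → X → A → X → ℝ
  trans_nonneg : ∀ h x a y, 0 ≤ trans h x a y
  trans_sum : ∀ h h' : Fin H, (h' : ℕ) = h + 1 → ∀ x ∈ states h, ∀ a,
    ∑ y ∈ states h', trans h x a y = 1
  trans_eq_zero : ∀ h h' : Fin H, (h' : ℕ) = h + 1 → ∀ x ∈ states h, ∀ a,
    ∀ y ∉ states h', trans h x a y = 0

/-- A stochastic policy: a distribution over the actions for every state. -/
abbrev Policy (X A : Type) [Fintype A] (H : ℕ) : Type := Fin H → X → stdSimplex ℝ A

/-- A policy set, given by the set `Pol(· | s)` of admissible action distributions at each state `s`. -/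
abbrev PolicySet (X A : Type) [Fintype A] (H : ℕ) : Type := Fin H → X → Set (stdSimplex ℝ A)

/-- The state-action part of a trajectory. -/
abbrev Path (X A : Type) (H : ℕ) : Type := Fin H → X × A

/-- A loss function on state-action pairs. -/
abbrev LossFn (X A : Type) (H : ℕ) : Type := Fin H → X → A → ℝ

/-- The number of states of a layered state space. -/
def stateCount {X : Type} {H : ℕ} (S : Fin H → Finset X) : ℕ := ∑ h, (S h).card

/-- The policies that respect the policy set `Pol` on the state space `S`. -/
def PolicySet.policies {X A : Type} [Fintype A] {H : ℕ} (Pol : PolicySet X A H)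
    (S : Fin H → Finset X) : Set (Policy X A H) :=
  {π | ∀ h, ∀ x ∈ S h, π h x ∈ Pol h x}

namespace LayeredMDP

variable {X A : Type} [Fintype A] {H : ℕ} [NeZero H]

/-- All paths that stay in the state space. -/
def paths (M : LayeredMDP X A H) : Finset (Path X A H) :=
  Fintype.piFinset fun h => M.states h ×ˢ (Finset.univ : Finset A)

open Classical in
/-- The probability of a path when policy `π` is executed. -/
def pathProb (M : LayeredMDP X A H) (π : Policy X A H) (p : Path X A H) : ℝ :=
  (if (p 0).1 = M.init then 1 else 0) *
    (∏ h, (π h (p h).1 : A → ℝ) (p h).2) *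
    ∏ h : Fin H, if hh : (h : ℕ) + 1 < H then M.trans h (p h).1 (p h).2 (p ⟨h + 1, hh⟩).1 else 1

/-- `ℓ(π)`: the expected total loss of one episode under policy `π`. -/
def value (M : LayeredMDP X A H) (π : Policy X A H) (ℓ : LossFn X A H) : ℝ :=
  ∑ p ∈ M.paths, M.pathProb π p * ∑ h, ℓ h (p h).1 (p h).2

open Classical in
/-- The occupancy measure `q(s)` of the state `s = (h, x)`: the probability that it is visited. -/
def occupancy (M : LayeredMDP X A H) (π : Policy X A H) (h : Fin H) (x : X) : ℝ :=
  ∑ p ∈ M.paths with (p h).1 = x, M.pathProb π p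

open Classical in
/-- The states that some policy of the policy set visits with probability more than `ε`. -/
def reachable (M : LayeredMDP X A H) (Pol : PolicySet X A H) (ε : ℝ) : Finset (Σ _ : Fin H, X) :=
  (Finset.univ.sigma M.states).filter fun s => ∃ π ∈ Pol.policies M.states, ε < M.occupancy π s.1 s.2

end LayeredMDP

/-! ### Learners and their interaction with an MDP -/

/-- The internal randomness of a learner in one episode. -/
abbrev Seed : Type := unitInterval

/-- The bandit feedback of one episode: the visited states, the actions taken, the losses incurred. -/
abbrev Feedback (X A : Type) (H : ℕ) : Type := Path X A H × (Fin H → ℝ)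

/-- A (possibly randomized) learner: it maps the past seeds and feedbacks, oldest first, and the
seed of the current episode to a policy. -/
abbrev Learner (X A : Type) [Fintype A] (H : ℕ) : Type :=
  List (Seed × Feedback X A H) → Seed → Policy X A H

/-- The policy is a measurable function of the seeds and the observed losses. -/
def Learner.IsMeasurable {X A : Type} [Fintype A] {H : ℕ} (Λ : Learner X A H) : Prop :=
  ∀ (n : ℕ) (p : Fin n → Path X A H) (h : Fin H) (x : X) (a : A),
    Measurable fun z : (Fin n → Seed × (Fin H → ℝ)) × Seed =>
      (Λ (List.ofFn fun i => ((z.1 i).1, (p i, (z.1 i).2))) z.2 h x : A → ℝ) a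

/-- How the loss functions are produced. -/
inductive Setting : Type
  | adversarial
  | stochastic

/-- An interaction of the learner `Λ` with the MDP `M`, on the probability space `(Ω, μ)`.

`𝓕 t` is the information available before episode `t` (episodes are numbered from `0`): it contains
the whole past of the interaction, and possibly private information of the adversary.  In the
adversarial setting the loss function of episode `t` is any function of that information; in the
stochastic setting it is independent of it and has a distribution that does not depend on `t`.
The seed of the episode is uniform and independent of the past and of the loss function, and the path
is generated by executing the learner's policy in `M`. -/
structure Run {X A : Type} [Fintype A] {H : ℕ} [NeZero H] (σ : Setting) (M : LayeredMDP X A H)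
    (Λ : Learner X A H) {Ω : Type} [mΩ : MeasurableSpace Ω] (μ : Measure Ω) where
  𝓕 : Filtration ℕ mΩ
  loss : ℕ → Ω → LossFn X A H
  seed : ℕ → Ω → Seed
  path : ℕ → Ω → Path X A H
  loss_mem : ∀ t ω h x a, loss t ω h x a ∈ Set.Icc (0 : ℝ) 1
  measurable_loss : ∀ t, Measurable[𝓕 (t + 1)] (loss t)
  measurable_seed : ∀ t, Measurable[𝓕 (t + 1)] (seed t)
  measurable_path : ∀ t p, MeasurableSet[𝓕 (t + 1)] {ω | path t ω = p}
  loss_adversarial : σ = Setting.adversarial → ∀ t, Measurable[𝓕 t] (loss t)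
  loss_stochastic : σ = Setting.stochastic → ∀ t,
    μ.map (loss t) = μ.map (loss 0) ∧
      Indep (MeasurableSpace.comap (loss t) inferInstance) (𝓕 t) μ
  seed_uniform : ∀ t, μ.map (seed t) = volume
  seed_indep : ∀ t, Indep (MeasurableSpace.comap (seed t) inferInstance)
    (𝓕 t ⊔ MeasurableSpace.comap (loss t) inferInstance) μ
  path_law : ∀ t p,
    μ[Set.indicator {ω | path t ω = p} (fun _ => (1 : ℝ)) |
        𝓕 t ⊔ MeasurableSpace.comap (loss t) inferInstance ⊔
          MeasurableSpace.comap (seed t) inferInstance]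
      =ᵐ[μ] fun ω => M.pathProb
        (Λ (List.ofFn fun i : Fin t =>
            (seed i ω, (path i ω, fun h => loss i ω h (path i ω h).1 (path i ω h).2)))
          (seed t ω)) p

namespace Run

variable {X A : Type} [Fintype A] {H : ℕ} [NeZero H] {σ : Setting} {M : LayeredMDP X A H}
  {Λ : Learner X A H} {Ω : Type} [mΩ : MeasurableSpace Ω] {μ : Measure Ω}

/-- The bandit feedback of episode `t`. -/
def feedback (R : Run σ M Λ μ) (t : ℕ) (ω : Ω) : Feedback X A H :=
  (R.path t ω, fun h => R.loss t ω h (R.path t ω h).1 (R.path t ω h).2)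

/-- The policy that the learner plays in episode `t`. -/
def policy (R : Run σ M Λ μ) (t : ℕ) (ω : Ω) : Policy X A H :=
  Λ (List.ofFn fun i : Fin t => (R.seed i ω, R.feedback i ω)) (R.seed t ω)

/-- The regret of the first `T` episodes against the best policy of the policy set in hindsight. -/
def regret (R : Run σ M Λ μ) (Pol : PolicySet X A H) (T : ℕ) (ω : Ω) : ℝ :=
  ∑ t ∈ Finset.range T, M.value (R.policy t ω) (R.loss t ω) -
    ⨅ π : Pol.policies M.states, ∑ t ∈ Finset.range T, M.value π.1 (R.loss t ω)

end Run

/-! ### Black-box algorithms and their regret guarantee -/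

/-- A black-box algorithm: given a state space, a policy set and a confidence level, a learner. -/
abbrev BlackBox (X A : Type) [Fintype A] (H : ℕ) : Type :=
  (Fin H → Finset X) → PolicySet X A H → ℝ → Learner X A H

/-- A regret coefficient `reg(|S|, |A|, H, L)`, where `L` is the logarithmic factor: it is
non-decreasing in all arguments, and its growth in `L` is polynomial of degree at most `d`.
(Every sum of monomials with nonnegative coefficients and nonnegative real exponents, the one of `L`
being at most `d`, is of this kind.) -/
structure IsRegretCoefficient (d : ℕ) (reg : ℕ → ℕ → ℕ → ℝ → ℝ) : Prop where
  nonneg : ∀ s a h L, 0 ≤ L → 0 ≤ reg s a h L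
  mono : ∀ s s' a a' h h' L L', s ≤ s' → a ≤ a' → h ≤ h' → 0 ≤ L → L ≤ L' →
    reg s a h L ≤ reg s' a' h' L'
  poly : ∀ s a h L c, 0 ≤ L → 1 ≤ c → reg s a h (c * L) ≤ c ^ d * reg s a h L

/-- `ALG` plays policies of the policy set `Pol`, and for every MDP and every confidence level `δ`, with
probability at least `1 - δ` its regret after `K` episodes is, for all `K > 0`, at most
`reg(|S|, |A|, H, log (H |S| |A| K / δ)) √K`. -/
structure HasRegretGuarantee {X A : Type} [Fintype A] {H : ℕ} [NeZero H] (σ : Setting)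
    (ALG : BlackBox X A H) (Pol : PolicySet X A H) (reg : ℕ → ℕ → ℕ → ℝ → ℝ) : Prop where
  measurable : ∀ (S : Fin H → Finset X) (δ : ℝ), 0 < δ → δ < 1 → Learner.IsMeasurable (ALG S Pol δ)
  mem_policies : ∀ (S : Fin H → Finset X) (δ : ℝ), 0 < δ → δ < 1 → ∀ hist u,
    ALG S Pol δ hist u ∈ Pol.policies S
  regret_le : ∀ (M : LayeredMDP X A H) (δ : ℝ), 0 < δ → δ < 1 →
    ∀ (Ω : Type) [MeasurableSpace Ω] (μ : Measure Ω) [IsProbabilityMeasure μ]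
      (R : Run σ M (ALG M.states Pol δ) μ),
      μ {ω | ∃ K : ℕ, 0 < K ∧
          reg (stateCount M.states) (Fintype.card A) H
              (Real.log (H * stateCount M.states * Fintype.card A * K / δ)) * √(K : ℝ)
            < R.regret Pol K ω}
        ≤ ENNReal.ofReal δ

/-! ### The algorithm SF-RL

The environment's states have labels in `ℕ`.  The pruned state space has labels in `Option ℕ`, where
`(h, some n)` is the state `(h, n)` and `(h, none)` is the auxiliary state of layer `h`. -/

/-- The pruned state space: the identified states and one auxiliary state in every layer. -/
def prunedStates {H : ℕ} (core : Fin H → Finset ℕ) : Fin H → Finset (Option ℕ) :=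
  fun h => Finset.insertNone (core h)

open Classical in
/-- The policy set on the pruned space: the only action at the auxiliary states is `abot`. -/
def prunedPolicySet {A : Type} [Fintype A] {H : ℕ} (Pol : PolicySet ℕ A H) (abot : A) :
    PolicySet (Option ℕ) A H
  | h, some n => Pol h n
  | _, none => {π | (π : A → ℝ) = Pi.single abot 1}

/-- The pruned trajectory: the part from the first state that is not identified on is replaced by
the auxiliary states, the action `abot` and loss zero. -/
def pruneFeedback {A : Type} {H : ℕ} (abot : A) (core : Fin H → Finset ℕ) (o : Feedback ℕ A H) :
    Feedback (Option ℕ) A H :=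
  (fun h => if ∀ k ≤ h, (o.1 k).1 ∈ core k then (some (o.1 h).1, (o.1 h).2) else (none, abot),
    fun h => if ∀ k ≤ h, (o.1 k).1 ∈ core k then o.2 h else 0)

/-- The memory of SF-RL between two episodes. -/
structure Memory (A : Type) (H : ℕ) where
  /-- the number of episodes played -/
  time : ℕ
  /-- the number of visits to each state -/
  count : Fin H → ℕ →₀ ℕ
  /-- the identified states, i.e. the pruned space without the auxiliary states -/
  core : Fin H → Finset ℕ
  /-- what the current copy of the black-box algorithm has seen since it was (re)started -/
  hist : List (Seed × Feedback (Option ℕ) A H)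

/-- The test by which a state with `n` visits in the first `t` episodes is identified. -/
def Identified (H : ℕ) (δ ε : ℝ) (t n : ℕ) : Prop :=
  ε * t < (n : ℝ) / 2 - Real.log (2 * (H : ℝ) ^ 2 * (t : ℝ) ^ 2 / δ) / 2 - 1 / 2

open Classical in
/-- The update of the memory after an episode.  If the episode visits a state outside the pruned space
that passes the test, all states that pass the test are added and the black-box algorithm is
restarted; otherwise the pruned trajectory is sent to the black-box algorithm. -/
def Memory.step {A : Type} {H : ℕ} (abot : A) (δ ε : ℝ) (m : Memory A H)
    (e : Seed × Feedback ℕ A H) : Memory A H :=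
  let t := m.time + 1
  let count : Fin H → ℕ →₀ ℕ := fun h => m.count h + Finsupp.single (e.2.1 h).1 1
  if ∃ h, (e.2.1 h).1 ∉ m.core h ∧ Identified H δ ε t (count h (e.2.1 h).1) then
    { time := t
      count := count
      core := fun h => m.core h ∪ {n ∈ (count h).support | Identified H δ ε t (count h n)}
      hist := [] }
  else
    { time := t
      count := count
      core := m.core
      hist := m.hist ++ [(e.1, pruneFeedback abot m.core e.2)] }

/-- The memory before the first episode: no state is identified. -/
def Memory.start (A : Type) (H : ℕ) : Memory A H :=
  { time := 0, count := fun _ => 0, core := fun _ => ∅, hist := [] }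

/-- SF-RL with black-box algorithm `ALG`, confidence `δ` and pessimism level `ε`, for the policy set
`Pol`.  The copy of `ALG` on the pruned space runs with confidence `δ / (2 |S^⊥|²)`; at the states that
are not identified the fixed policy `dflt` is played.  Nothing here depends on the state space or on
the transitions of the environment. -/
def sfrl {A : Type} [Fintype A] {H : ℕ} (ALG : BlackBox (Option ℕ) A H) (Pol : PolicySet ℕ A H)
    (dflt : Policy ℕ A H) (abot : A) (δ ε : ℝ) : Learner ℕ A H :=
  fun past u =>
    let m := past.foldl (Memory.step abot δ ε) (Memory.start A H)
    let S := prunedStates m.core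
    let π := ALG S (prunedPolicySet Pol abot) (δ / (2 * (stateCount S : ℝ) ^ 2)) m.hist u
    fun h n => if n ∈ m.core h then π h (some n) else dflt h n

/-! ### The terms of the regret bound -/

/-- `reg(|S^{Π,ε}| + H, |A|, H, log (H |S^{Π,ε}| |A| T / δ)) √(|S^{Π,ε}| T)`. -/
def mainTerm {A : Type} [Fintype A] {H : ℕ} [NeZero H] (reg : ℕ → ℕ → ℕ → ℝ → ℝ)
    (M : LayeredMDP ℕ A H) (Pol : PolicySet ℕ A H) (δ ε : ℝ) (T : ℕ) : ℝ :=
  reg ((M.reachable Pol ε).card + H) (Fintype.card A) H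
      (Real.log (H * (M.reachable Pol ε).card * Fintype.card A * T / δ)) *
    √((M.reachable Pol ε).card * T)

/-- `ε H |S^Π| T`. -/
def epsTerm {A : Type} [Fintype A] {H : ℕ} [NeZero H]
    (M : LayeredMDP ℕ A H) (Pol : PolicySet ℕ A H) (ε : ℝ) (T : ℕ) : ℝ :=
  ε * H * (M.reachable Pol 0).card * T

/-- The lower-order term `H² |S^Π| log (2 H² T² / δ)`. -/
def burnIn {A : Type} [Fintype A] {H : ℕ} [NeZero H]
    (M : LayeredMDP ℕ A H) (Pol : PolicySet ℕ A H) (δ : ℝ) (T : ℕ) : ℝ :=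
  (H : ℝ) ^ 2 * (M.reachable Pol 0).card * Real.log (2 * (H : ℝ) ^ 2 * (T : ℝ) ^ 2 / δ)

end StateFreeRL

end

open MeasureTheory ProbabilityTheory

noncomputable section

namespace StateFreeRL

set_option linter.unusedSectionVars false

/-! ### Sums over paths -/

/-! Fix the identified states `S` (the core). Collapsing the rest of every layer to one absorbing
auxiliary state of loss zero turns the environment into an MDP on the pruned space, and the pruned
trajectory has exactly the law of a trajectory of that MDP (`sum_pathProb_fiber_prunePath`). Hence,
on an epoch (a maximal stretch of episodes with constant core), the regret is that of a copy of the
black box plus `H` times the sum of the probabilities of leaving the core: pruning can only lower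
the loss of the comparator, and the learner pays at most `H` per exit (`value_sub_value_le`).

The black-box guarantee concerns an unending run, whereas an epoch ends at a time that depends on
the data. The copy is therefore continued fictitiously after the epoch, with paths sampled from
auxiliary seeds. Conditionally on the start of the epoch, which is an event of the past, the result
is a genuine run in the pruned MDP (`extRun`). Since the guarantee holds for all `K` at once, it
applies to the random length of the epoch (`measure_epochRegret_gt_le`). The union over start times
and cores is cheap: the cores of a run increase, so at most one pair of start time and core occurs
for each size of the core, and the confidences `δ / (2 |S^⊥|²)` are summable over the sizes
(`measure_exists_epochRegret_gt_le`).

Three estimates control the cores. (i) With high probability no state of occupancy at most `ε` is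
identified. After a visit to such a state, exp(visits − 2εn) is a supermartingale, so by Ville's
inequality a false identification has at most a small multiple of the probability of that visit. The
probabilities of visiting the various states of a layer add up to one, so the union bound does not
involve the number of states (`measure_visits_ge_le`, `measure_core_not_subset_le`). (ii) A state
outside the core failed the test at its last visit, so it has been visited O(εT + log) times. Every
exit visits such a state, and almost surely only states of `S^Π` are visited; this bounds the number
of exits (`ae_sum_leaves_le`). (iii) The sum of the conditional exit probabilities is at most twice
the number of exits plus a logarithm (`measure_lt_sum_condProb_le`).

The failures in the epochs and in (i) and (iii) have probability at most `δ / 3` each. Outside them,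
all cores lie in `S^{Π,ε}`, so at most |S^{Π,ε}| nonempty cores occur, and the Cauchy–Schwarz
inequality for the lengths of their epochs gives the main term (`sum_epochBound_le`). The factor `10
^ d` comes from comparing the logarithmic factors (`log_epoch_le`). -/

theorem sum_stdSimplex {A : Type} [Fintype A] (π : stdSimplex ℝ A) : ∑ a, (π : A → ℝ) a = 1 := π.2.2

/-- Summing a product of step weights over all completions of a prefix leaves the weights of the
prefix, if every step weight depends on the past only and sums to one over the current coordinate. -/
theorem sum_prod_cylinder {Y : Type} [DecidableEq Y] {H : ℕ} (S : Fin H → Finset Y)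
    (W : Fin H → (Fin H → Y) → ℝ)
    (hdep : ∀ h p p', (∀ k ≤ h, p k = p' k) → W h p = W h p')
    (hone : ∀ h, ∀ p ∈ Fintype.piFinset S, ∑ y ∈ S h, W h (Function.update p h y) = 1)
    (k : ℕ) (hk : k ≤ H) : ∀ p ∈ Fintype.piFinset S,
    ∑ q ∈ Fintype.piFinset S with ∀ i : Fin H, (i : ℕ) < k → q i = p i, ∏ h, W h q =
      ∏ h ∈ Finset.univ.filter fun h : Fin H => (h : ℕ) < k, W h p := by
  -- Downward from `k = H`, where the prefix is the whole path. Each step back splits the sum by the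
  -- value of one coordinate, whose weights add up to one.
  induction hk using Nat.decreasingInduction with
  | self =>
    intro p hp
    have : (Fintype.piFinset S).filter (fun q => ∀ i : Fin H, (i : ℕ) < H → q i = p i) = {p} := by
      ext q
      simp only [Finset.mem_filter, Finset.mem_singleton]
      constructor
      · rintro ⟨_, h⟩
        exact funext fun i => h i i.2
      · rintro rfl
        exact ⟨hp, fun _ _ => rfl⟩
    rw [this, Finset.sum_singleton]
    simp
  | of_succ k hk ih =>
    intro p hp
    set κ : Fin H := ⟨k, hk⟩
    have hmaps : ∀ q ∈ (Fintype.piFinset S).filter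
        (fun q => ∀ i : Fin H, (i : ℕ) < k → q i = p i), q κ ∈ S κ := fun q hq =>
      Fintype.mem_piFinset.1 (Finset.mem_filter.1 hq).1 κ
    rw [← Finset.sum_fiberwise_of_maps_to hmaps]
    have hupd : ∀ y ∈ S κ, Function.update p κ y ∈ Fintype.piFinset S := by
      intro y hy
      rw [Fintype.mem_piFinset] at hp ⊢
      intro i
      by_cases h : i = κ
      · subst h; simpa using hy
      · simpa [h] using hp i
    have hstep : ∀ y ∈ S κ, ∑ q ∈ ((Fintype.piFinset S).filter
          (fun q => ∀ i : Fin H, (i : ℕ) < k → q i = p i)).filter (fun q => q κ = y), ∏ h, W h q =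
        (∏ h ∈ Finset.univ.filter fun h : Fin H => (h : ℕ) < k, W h p) * W κ (Function.update p κ y) := by
      intro y hy
      have hset : ((Fintype.piFinset S).filter
          (fun q => ∀ i : Fin H, (i : ℕ) < k → q i = p i)).filter (fun q => q κ = y) =
          (Fintype.piFinset S).filter
            (fun q => ∀ i : Fin H, (i : ℕ) < k + 1 → q i = Function.update p κ y i) := by
        ext q
        simp only [Finset.mem_filter, and_assoc, and_congr_right_iff]
        intro _
        constructor
        · rintro ⟨h1, h2⟩ i hi
          by_cases h : i = κ
          · subst h; simpa using h2
          · have : (i : ℕ) < k := by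
              have : (i : ℕ) ≠ k := fun h' => h (Fin.ext h')
              omega
            simpa [h] using h1 i this
        · intro h1
          refine ⟨fun i hi => ?_, by simpa using h1 κ (Nat.lt_succ_self k)⟩
          have h : i ≠ κ := fun h' => by simp [h', κ] at hi
          simpa [h] using h1 i (by omega)
      rw [hset, ih _ (hupd y hy)]
      have hfil : (Finset.univ.filter fun h : Fin H => (h : ℕ) < k + 1) =
          insert κ (Finset.univ.filter fun h : Fin H => (h : ℕ) < k) := by
        ext i
        simp only [Finset.mem_filter, Finset.mem_univ, true_and, Finset.mem_insert, Fin.ext_iff, κ]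
        omega
      rw [hfil, Finset.prod_insert (by simp [κ]), mul_comm]
      congr 1
      refine Finset.prod_congr rfl fun i hi => hdep _ _ _ fun j hj => ?_
      have : j ≠ κ := by
        rintro rfl
        simp only [Finset.mem_filter, Finset.mem_univ, true_and] at hi
        exact absurd (lt_of_le_of_lt (Fin.le_def.1 hj) hi) (lt_irrefl _)
      simp [this]
    rw [Finset.sum_congr rfl hstep, ← Finset.mul_sum, hone κ p hp, mul_one]

namespace LayeredMDP

variable {X A : Type} [Fintype A] {H : ℕ} [NeZero H]

open Classical in
/-- The probability that step `h` is spent in the state `x`, given the path before step `h`. -/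
def entryProb (M : LayeredMDP X A H) (h : Fin H) (p : Path X A H) (x : X) : ℝ :=
  if (h : ℕ) = 0 then (if x = M.init then 1 else 0)
  else M.trans ⟨h - 1, by omega⟩ (p ⟨h - 1, by omega⟩).1 (p ⟨h - 1, by omega⟩).2 x

/-- Charging each transition to the step that it enters, instead of the one that it leaves, gives
step weights that depend only on the path up to that step. This is the form that `sum_prod_cylinder`
needs. -/
theorem pathProb_eq_prod (M : LayeredMDP X A H) (π : Policy X A H) (p : Path X A H) :
    M.pathProb π p = ∏ h, M.entryProb h p (p h).1 * (π h (p h).1 : A → ℝ) (p h).2 := by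
  rw [Finset.prod_mul_distrib, pathProb, mul_right_comm]
  congr 1
  obtain ⟨n, rfl⟩ := Nat.exists_eq_succ_of_ne_zero (NeZero.ne H)
  rw [Fin.prod_univ_castSucc, Fin.prod_univ_succ]
  simp only [Nat.succ_eq_add_one, Fin.val_castSucc, Fin.val_last, lt_irrefl, dite_false, mul_one,
    entryProb, Fin.val_zero, if_true, Fin.val_succ, Nat.add_one_ne_zero, if_false,
    Nat.add_sub_cancel]
  congr 1
  refine Finset.prod_congr rfl fun i _ => ?_
  rw [dif_pos (by omega)]
  rfl

theorem mem_paths {M : LayeredMDP X A H} {p : Path X A H} :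
    p ∈ M.paths ↔ ∀ h, (p h).1 ∈ M.states h := by
  simp [paths, Fintype.mem_piFinset]

theorem entryProb_nonneg (M : LayeredMDP X A H) (h : Fin H) (p : Path X A H) (x : X) :
    0 ≤ M.entryProb h p x := by
  unfold entryProb
  split_ifs
  · exact zero_le_one
  · exact le_rfl
  · exact M.trans_nonneg _ _ _ _

theorem pathProb_nonneg (M : LayeredMDP X A H) (π : Policy X A H) (p : Path X A H) :
    0 ≤ M.pathProb π p := by
  rw [pathProb_eq_prod]
  exact Finset.prod_nonneg fun h _ => mul_nonneg (M.entryProb_nonneg _ _ _) ((π h (p h).1).2.1 _)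

theorem entryProb_congr (M : LayeredMDP X A H) {h : Fin H} {p p' : Path X A H}
    (hp : ∀ k < h, p k = p' k) (x : X) : M.entryProb h p x = M.entryProb h p' x := by
  unfold entryProb
  split_ifs with h0
  · rfl
  · rfl
  · rw [hp _ (Fin.lt_def.2 (Nat.sub_lt (Nat.pos_of_ne_zero h0) one_pos))]

theorem sum_entryProb (M : LayeredMDP X A H) (h : Fin H) {p : Path X A H}
    (hp : ∀ k < h, (p k).1 ∈ M.states k) : ∑ x ∈ M.states h, M.entryProb h p x = 1 := by
  unfold entryProb
  split_ifs with h0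
  · have : h = 0 := Fin.ext (by simpa using h0)
    subst this
    rw [Finset.sum_eq_single_of_mem M.init M.init_mem fun x _ hx => if_neg hx, if_pos rfl]
  · exact M.trans_sum _ h (by simp; omega) _ (hp _ (Fin.lt_def.2 (Nat.sub_lt (Nat.pos_of_ne_zero h0) one_pos))) _

theorem entryProb_eq_zero (M : LayeredMDP X A H) (h : Fin H) {p : Path X A H}
    (hp : ∀ k < h, (p k).1 ∈ M.states k) {x : X} (hx : x ∉ M.states h) :
    M.entryProb h p x = 0 := by
  unfold entryProb
  split_ifs with h0 h1
  · have : h = 0 := Fin.ext (by simpa using h0)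
    subst this
    exact absurd (h1 ▸ M.init_mem) hx
  · rfl
  · exact M.trans_eq_zero _ h (by simp; omega) _ (hp _ (Fin.lt_def.2 (Nat.sub_lt (Nat.pos_of_ne_zero h0) one_pos))) _ _ hx

theorem pathProb_eq_zero (M : LayeredMDP X A H) (π : Policy X A H) {p : Path X A H}
    (hp : p ∉ M.paths) : M.pathProb π p = 0 := by
  rw [mem_paths, not_forall] at hp
  -- At the first step outside the state space all earlier states are legal, so the entry
  -- probability of this step is zero.
  obtain ⟨h, hh, hmin⟩ := WellFounded.has_min (wellFounded_lt (α := Fin H))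
    {h | (p h).1 ∉ M.states h} hp
  rw [pathProb_eq_prod]
  refine Finset.prod_eq_zero (Finset.mem_univ h) ?_
  rw [M.entryProb_eq_zero h (fun k hk => by_contra fun hk' => hmin k hk' hk) hh, zero_mul]

/-- The probability of a prefix of a path. -/
theorem sum_pathProb_cylinder (M : LayeredMDP X A H) (π : Policy X A H) {k : ℕ} (hk : k ≤ H)
    {p : Path X A H} (hp : p ∈ M.paths) {D : Finset (Path X A H)}
    (hD : ∀ q, q ∈ D ↔ q ∈ M.paths ∧ ∀ i : Fin H, (i : ℕ) < k → q i = p i) :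
    ∑ q ∈ D, M.pathProb π q =
      ∏ h ∈ Finset.univ.filter fun h : Fin H => (h : ℕ) < k, M.entryProb h p (p h).1 * (π h (p h).1 : A → ℝ) (p h).2 := by
  classical
  have hD' : D = M.paths.filter fun q => ∀ i : Fin H, (i : ℕ) < k → q i = p i := by
    ext q
    rw [hD, Finset.mem_filter]
  rw [hD']
  simp_rw [pathProb_eq_prod]
  refine sum_prod_cylinder _ (fun h p => M.entryProb h p (p h).1 * (π h (p h).1 : A → ℝ) (p h).2)
    ?_ ?_ k hk p hp
  · intro h p p' hpp
    rw [M.entryProb_congr (fun k hk => hpp k hk.le), hpp h le_rfl]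
  · intro h p hp
    have hp := mem_paths.1 hp
    rw [Finset.sum_product, ← M.sum_entryProb h fun k _ => hp k]
    refine Finset.sum_congr rfl fun x _ => ?_
    simp only [Function.update_self]
    rw [← mul_one (M.entryProb h p x), ← sum_stdSimplex (π h x), Finset.mul_sum]
    refine Finset.sum_congr rfl fun a _ => ?_
    congr 1
    exact M.entryProb_congr (fun k hk => by simp [hk.ne]) x

/-- Layers are not assumed nonempty; it follows from entry probabilities that sum to one. -/
theorem exists_mem_paths (M : LayeredMDP X A H) [Nonempty A] :
    ∃ p, p ∈ M.paths := by
  have key : ∀ k : ℕ, ∃ p : Path X A H, ∀ h : Fin H, (h : ℕ) < k → (p h).1 ∈ M.states h := by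
    intro k
    induction k with
    | zero => exact ⟨fun _ => (M.init, Classical.arbitrary A), by simp⟩
    | succ k ih =>
      obtain ⟨p, hp⟩ := ih
      by_cases hk : k < H
      · have hs := M.sum_entryProb ⟨k, hk⟩ (p := p) (fun i hi => hp i hi)
        obtain ⟨x, hx, -⟩ : ∃ x ∈ M.states ⟨k, hk⟩, M.entryProb ⟨k, hk⟩ p x ≠ 0 :=
          Finset.exists_ne_zero_of_sum_ne_zero (by rw [hs]; exact one_ne_zero)
        refine ⟨Function.update p ⟨k, hk⟩ (x, Classical.arbitrary A), fun h hh => ?_⟩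
        by_cases he : h = ⟨k, hk⟩
        · subst he; simpa using hx
        · have : (h : ℕ) < k := by
            have : (h : ℕ) ≠ k := fun h' => he (Fin.ext h')
            omega
          simpa [he] using hp h this
      · exact ⟨p, fun h _ => hp h (by omega)⟩
  obtain ⟨p, hp⟩ := key H
  exact ⟨p, mem_paths.2 fun h => hp h h.2⟩

theorem sum_pathProb (M : LayeredMDP X A H) [Nonempty A] (π : Policy X A H) :
    ∑ q ∈ M.paths, M.pathProb π q = 1 := by
  obtain ⟨p, hp⟩ := M.exists_mem_paths
  simpa using M.sum_pathProb_cylinder π (Nat.zero_le H) hp (D := M.paths) (by simp)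

end LayeredMDP

/-! ### The pruned MDP -/

section Pruned

variable {A : Type} [Fintype A] {H : ℕ} [NeZero H]

/-- Transitions of the pruned MDP: everything outside `core` is collapsed to the auxiliary state of
its layer, which is absorbing. -/
def prunedTrans (M : LayeredMDP ℕ A H) (core : Fin H → Finset ℕ) (h : Fin H) (a : A)
    (hh : (h : ℕ) + 1 < H) : Option ℕ → Option ℕ → ℝ
  | some n, some m => if m ∈ core ⟨h + 1, hh⟩ then M.trans h n a m else 0
  | some n, none => ∑ m ∈ M.states ⟨h + 1, hh⟩ \ core ⟨h + 1, hh⟩, M.trans h n a m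
  | none, some _ => 0
  | none, none => 1

/-- The MDP that the black-box algorithm faces while the identified states are `core`. -/
def prunedMDP (M : LayeredMDP ℕ A H) (core : Fin H → Finset ℕ)
    (hcore : ∀ h, core h ⊆ M.states h) : LayeredMDP (Option ℕ) A H where
  states := prunedStates core
  init := if M.init ∈ core 0 then some M.init else none
  init_mem := by
    unfold prunedStates
    split_ifs with h
    · simpa using h
    · simp
  trans h x a y := if hh : (h : ℕ) + 1 < H then prunedTrans M core h a hh x y else 0
  trans_nonneg h x a y := by
    split_ifs with hh
    · cases x <;> cases y <;> simp only [prunedTrans]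
      · exact zero_le_one
      · exact le_rfl
      · exact Finset.sum_nonneg fun m _ => M.trans_nonneg _ _ _ _
      · split_ifs
        · exact M.trans_nonneg _ _ _ _
        · exact le_rfl
    · exact le_rfl
  trans_sum h h' hh x hx a := by
    have hlt : (h : ℕ) + 1 < H := hh ▸ h'.2
    have hh' : h' = ⟨h + 1, hlt⟩ := Fin.ext hh
    subst hh'
    simp only [hlt, dite_true, prunedStates]
    rw [Finset.sum_insertNone]
    cases x with
    | none => simp [prunedTrans]
    | some n =>
      have hn : n ∈ M.states h := hcore h (by simpa [prunedStates] using hx)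
      simp only [prunedTrans]
      rw [Finset.sum_congr rfl (fun m hm => if_pos hm), Finset.sum_sdiff (hcore _)]
      exact M.trans_sum h _ rfl n hn a
  trans_eq_zero h h' hh x hx a y hy := by
    have hlt : (h : ℕ) + 1 < H := hh ▸ h'.2
    have hh' : h' = ⟨h + 1, hlt⟩ := Fin.ext hh
    subst hh'
    simp only [hlt, dite_true]
    cases y with
    | none => simp [prunedStates] at hy
    | some m =>
      have hm : m ∉ core ⟨h + 1, hlt⟩ := by simpa [prunedStates] using hy
      cases x <;> simp [prunedTrans, hm]

/-- The path of the pruned trajectory. -/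
def prunePath (abot : A) (core : Fin H → Finset ℕ) (p : Path ℕ A H) : Path (Option ℕ) A H :=
  fun h => if ∀ k ≤ h, (p k).1 ∈ core k then (some (p h).1, (p h).2) else (none, abot)

/-- The loss function on the pruned space. -/
def pruneLoss (ℓ : LossFn ℕ A H) : LossFn (Option ℕ) A H
  | h, some n, a => ℓ h n a
  | _, none, _ => 0

theorem pruneFeedback_eq (abot : A) (core : Fin H → Finset ℕ) (p : Path ℕ A H) (ℓ : LossFn ℕ A H) :
    pruneFeedback abot core (p, fun h => ℓ h (p h).1 (p h).2) =
      (prunePath abot core p, fun h =>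
        pruneLoss ℓ h (prunePath abot core p h).1 (prunePath abot core p h).2) := by
  unfold pruneFeedback
  refine Prod.ext rfl (funext fun h => ?_)
  simp only [prunePath]
  split_ifs <;> rfl

/-- The policy on the pruned space that corresponds to a policy of the environment. -/
def prunePolicy (abot : A) (π : Policy ℕ A H) : Policy (Option ℕ) A H
  | h, some n => π h n
  | _, none => ⟨fun a => by classical exact (Pi.single abot 1 : A → ℝ) a, by
      classical
      exact single_mem_stdSimplex ℝ abot⟩

/-- `π'` is a policy on the pruned space that agrees with `π` on the identified states. -/
def PrunesTo (abot : A) (core : Fin H → Finset ℕ) (π : Policy ℕ A H)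
    (π' : Policy (Option ℕ) A H) : Prop :=
  (∀ h, ∀ n ∈ core h, π' h (some n) = π h n) ∧ ∀ h, (π' h none : A → ℝ) abot = 1

variable {M : LayeredMDP ℕ A H} {core : Fin H → Finset ℕ} (hcore : ∀ h, core h ⊆ M.states h)
  (abot : A)

theorem prunePath_of_pos {h : Fin H} {q : Path ℕ A H} (hq : ∀ k ≤ h, (q k).1 ∈ core k) :
    prunePath abot core q h = (some (q h).1, (q h).2) := if_pos hq

theorem prunePath_of_not_mem {h k : Fin H} {q : Path ℕ A H} (hk : k ≤ h) (hq : (q k).1 ∉ core k) :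
    prunePath abot core q h = (none, abot) := if_neg fun h' => hq (h' k hk)

theorem prunePath_mem_paths (q : Path ℕ A H) :
    prunePath abot core q ∈ (prunedMDP M core hcore).paths := by
  rw [LayeredMDP.mem_paths]
  intro h
  change _ ∈ prunedStates core h
  unfold prunePath prunedStates
  split_ifs with hq
  · simpa using hq h le_rfl
  · simp

theorem entryProb_pruned_some {h : Fin H} {q : Path ℕ A H} (hq : ∀ k < h, (q k).1 ∈ core k)
    {x : ℕ} (hx : x ∈ core h) :
    (prunedMDP M core hcore).entryProb h (prunePath abot core q) (some x) = M.entryProb h q x := by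
  unfold LayeredMDP.entryProb
  split_ifs with h0 h1 h2 h2
  · rfl
  · refine absurd ?_ h2
    simp only [prunedMDP] at h1
    split_ifs at h1
    exact Option.some.inj h1
  · have : h = 0 := Fin.ext (by simpa using h0)
    subst this
    subst h2
    simp [prunedMDP, hx] at h1
  · rfl
  · have hlt : (⟨h - 1, by omega⟩ : Fin H) < h :=
      Fin.lt_def.2 (Nat.sub_lt (Nat.pos_of_ne_zero h0) one_pos)
    rw [prunePath_of_pos abot fun k hk => hq k (lt_of_le_of_lt hk hlt)]
    have hs : ((⟨h - 1, by omega⟩ : Fin H) : ℕ) + 1 < H := by simp only; omega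
    have he : (⟨((⟨h - 1, by omega⟩ : Fin H) : ℕ) + 1, hs⟩ : Fin H) = h :=
      Fin.ext (by simp only; omega)
    simp only [prunedMDP]
    rw [dif_pos hs]
    simp only [prunedTrans]
    rw [if_pos (by rw [he]; exact hx)]

theorem entryProb_pruned_none {h : Fin H} {q : Path ℕ A H} (hq : ∀ k < h, (q k).1 ∈ core k) :
    (prunedMDP M core hcore).entryProb h (prunePath abot core q) none =
      ∑ x ∈ M.states h \ core h, M.entryProb h q x := by
  unfold LayeredMDP.entryProb
  by_cases h0 : (h : ℕ) = 0
  · have : h = 0 := Fin.ext (by simpa using h0)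
    subst this
    simp only [h0, if_true, prunedMDP]
    by_cases hi : M.init ∈ core 0
    · rw [Finset.sum_eq_zero]
      · simp [hi]
      · intro x hx
        rw [if_neg]
        rintro rfl
        exact (Finset.mem_sdiff.1 hx).2 hi
    · refine Eq.trans ?_ (Finset.sum_eq_single_of_mem M.init (Finset.mem_sdiff.2 ⟨M.init_mem, hi⟩)
        fun x _ hx => if_neg hx).symm
      simp [hi]
  · simp only [h0, if_false]
    have hlt : (⟨h - 1, by omega⟩ : Fin H) < h :=
      Fin.lt_def.2 (Nat.sub_lt (Nat.pos_of_ne_zero h0) one_pos)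
    rw [prunePath_of_pos abot fun k hk => hq k (lt_of_le_of_lt hk hlt)]
    have hs : ((⟨h - 1, by omega⟩ : Fin H) : ℕ) + 1 < H := by simp only; omega
    have he : (⟨((⟨h - 1, by omega⟩ : Fin H) : ℕ) + 1, hs⟩ : Fin H) = h :=
      Fin.ext (by simp only; omega)
    simp only [prunedMDP]
    rw [dif_pos hs]
    simp only [prunedTrans]
    rw [he]

theorem entryProb_pruned_absorbed {h k : Fin H} {q : Path ℕ A H} (hk : k < h)
    (hq : (q k).1 ∉ core k) :
    (prunedMDP M core hcore).entryProb h (prunePath abot core q) none = 1 := by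
  have hk' := Fin.lt_def.1 hk
  have h0 : (h : ℕ) ≠ 0 := by omega
  unfold LayeredMDP.entryProb
  simp only [h0, if_false]
  rw [prunePath_of_not_mem abot (h := ⟨h - 1, by omega⟩) (Fin.le_def.2 (by simp only; omega)) hq]
  have hs : ((⟨h - 1, by omega⟩ : Fin H) : ℕ) + 1 < H := by simp only; omega
  simp only [prunedMDP]
  rw [dif_pos hs]
  simp only [prunedTrans]

open Classical in
-- If `q₀` stays in the core, it is alone in its fiber. Otherwise let `κ` be its first step outside:
-- the fiber consists of the paths that agree with `q₀` before `κ` and are outside the core at `κ`.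
-- Summing out the later steps leaves the prefix times the probability of entering the complement of
-- the core, which is how the pruned MDP enters the auxiliary state.
theorem sum_pathProb_fiber_prunePath_of_mem {π : Policy ℕ A H} {π' : Policy (Option ℕ) A H}
    (hπ : PrunesTo abot core π π') {q₀ : Path ℕ A H} (hq₀ : q₀ ∈ M.paths) :
    ∑ q ∈ M.paths with prunePath abot core q = prunePath abot core q₀, M.pathProb π q =
      (prunedMDP M core hcore).pathProb π' (prunePath abot core q₀) := by
  have hsome : ∀ h : Fin H, (∀ k ≤ h, (q₀ k).1 ∈ core k) →
      (prunedMDP M core hcore).entryProb h (prunePath abot core q₀) (prunePath abot core q₀ h).1 *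
        (π' h (prunePath abot core q₀ h).1 : A → ℝ) (prunePath abot core q₀ h).2 =
      M.entryProb h q₀ (q₀ h).1 * (π h (q₀ h).1 : A → ℝ) (q₀ h).2 := by
    intro h hh
    rw [prunePath_of_pos abot hh, entryProb_pruned_some hcore abot (fun k hk => hh k hk.le)
      (hh h le_rfl), hπ.1 h _ (hh h le_rfl)]
  have hprefix : ∀ (q : Path ℕ A H) (i : Fin H), prunePath abot core q = prunePath abot core q₀ →
      (∀ k ≤ i, (q₀ k).1 ∈ core k) → q i = q₀ i := by
    intro q i hq hi
    have h1 := congrFun hq i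
    rw [prunePath_of_pos abot hi] at h1
    unfold prunePath at h1
    split_ifs at h1 with h2
    · simp only [Prod.mk.injEq, Option.some.injEq] at h1
      exact Prod.ext h1.1 h1.2
    · simp at h1
  rw [LayeredMDP.pathProb_eq_prod]
  by_cases hall : ∀ h, (q₀ h).1 ∈ core h
  · have hset : M.paths.filter (fun q => prunePath abot core q = prunePath abot core q₀) = {q₀} := by
      ext q
      simp only [Finset.mem_filter, Finset.mem_singleton]
      constructor
      · rintro ⟨_, hq⟩
        exact funext fun i => hprefix q i hq fun k _ => hall k
      · rintro rfl
        exact ⟨hq₀, rfl⟩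
    rw [hset, Finset.sum_singleton, LayeredMDP.pathProb_eq_prod]
    exact Finset.prod_congr rfl fun h _ => (hsome h fun k _ => hall k).symm
  · rw [not_forall] at hall
    obtain ⟨κ, hκ, hmin⟩ := WellFounded.has_min (wellFounded_lt (α := Fin H))
      {h | (q₀ h).1 ∉ core h} hall
    have hlt : ∀ k < κ, (q₀ k).1 ∈ core k := fun k hk => by_contra fun hk' => hmin k hk' hk
    have hset : M.paths.filter (fun q => prunePath abot core q = prunePath abot core q₀) =
        M.paths.filter (fun q => (∀ i : Fin H, (i : ℕ) < κ → q i = q₀ i) ∧ (q κ).1 ∉ core κ) := by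
      ext q
      simp only [Finset.mem_filter, and_congr_right_iff]
      intro _
      constructor
      · intro hq
        have hpre : ∀ i : Fin H, (i : ℕ) < κ → q i = q₀ i := fun i hi =>
          hprefix q i hq fun k hk => hlt k (lt_of_le_of_lt hk hi)
        refine ⟨hpre, fun hc => ?_⟩
        have h1 := congrFun hq κ
        rw [prunePath_of_not_mem abot le_rfl hκ, prunePath_of_pos abot] at h1
        · simp at h1
        · intro k hk
          rcases hk.lt_or_eq with h | h
          · rw [hpre k h]; exact hlt k h
          · rw [h]; exact hc
      · rintro ⟨hpre, hc⟩
        funext i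
        rcases lt_or_ge i κ with h | h
        · rw [prunePath_of_pos abot (q := q₀) fun k hk => hlt k (lt_of_le_of_lt hk h),
            prunePath_of_pos abot (q := q) fun k hk => by
              rw [hpre k (lt_of_le_of_lt hk h)]; exact hlt k (lt_of_le_of_lt hk h), hpre i h]
        · rw [prunePath_of_not_mem abot h hκ, prunePath_of_not_mem abot h hc]
    have hmaps : ∀ q ∈ M.paths.filter
        (fun q => (∀ i : Fin H, (i : ℕ) < κ → q i = q₀ i) ∧ (q κ).1 ∉ core κ),
        q κ ∈ (M.states κ \ core κ) ×ˢ (Finset.univ : Finset A) := by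
      intro q hq
      rw [Finset.mem_filter] at hq
      simp only [Finset.mem_product, Finset.mem_sdiff, Finset.mem_univ, and_true]
      exact ⟨LayeredMDP.mem_paths.1 hq.1 κ, hq.2.2⟩
    rw [hset, ← Finset.sum_fiberwise_of_maps_to hmaps]
    have hinner : ∀ y ∈ (M.states κ \ core κ) ×ˢ (Finset.univ : Finset A),
        ∑ q ∈ (M.paths.filter
          (fun q => (∀ i : Fin H, (i : ℕ) < κ → q i = q₀ i) ∧ (q κ).1 ∉ core κ)).filter
            (fun q => q κ = y), M.pathProb π q =
        (∏ h ∈ Finset.univ.filter fun h : Fin H => (h : ℕ) < κ,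
          M.entryProb h q₀ (q₀ h).1 * (π h (q₀ h).1 : A → ℝ) (q₀ h).2) *
            (M.entryProb κ q₀ y.1 * (π κ y.1 : A → ℝ) y.2) := by
      intro y hy
      simp only [Finset.mem_product, Finset.mem_sdiff, Finset.mem_univ, and_true] at hy
      have hupd : Function.update q₀ κ y ∈ M.paths := by
        rw [LayeredMDP.mem_paths] at hq₀ ⊢
        intro i
        by_cases h : i = κ
        · subst h; simpa using hy.1
        · simpa [h] using hq₀ i
      have hs : (M.paths.filter
          (fun q => (∀ i : Fin H, (i : ℕ) < κ → q i = q₀ i) ∧ (q κ).1 ∉ core κ)).filter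
            (fun q => q κ = y) =
          M.paths.filter fun q => ∀ i : Fin H, (i : ℕ) < κ + 1 → q i = Function.update q₀ κ y i := by
        ext q
        simp only [Finset.mem_filter, and_assoc, and_congr_right_iff]
        intro _
        constructor
        · rintro ⟨h1, -, h2⟩ i hi
          by_cases h : i = κ
          · subst h; simpa using h2
          · have : (i : ℕ) < κ := by
              have : (i : ℕ) ≠ κ := fun h' => h (Fin.ext h')
              omega
            simpa [h] using h1 i this
        · intro h1
          have h2 : q κ = y := by simpa using h1 κ (Nat.lt_succ_self κ)
          refine ⟨fun i hi => ?_, by rw [h2]; exact hy.2, h2⟩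
          have h : i ≠ κ := fun h' => by simp [h'] at hi
          simpa [h] using h1 i (by omega)
      rw [hs, LayeredMDP.sum_pathProb_cylinder M π (k := κ + 1) (Nat.succ_le_of_lt κ.2) hupd
        (fun q => Finset.mem_filter)]
      have hfil : (Finset.univ.filter fun h : Fin H => (h : ℕ) < κ + 1) =
          insert κ (Finset.univ.filter fun h : Fin H => (h : ℕ) < κ) := by
        ext i
        simp only [Finset.mem_filter, Finset.mem_univ, true_and, Finset.mem_insert, Fin.ext_iff]
        omega
      rw [hfil, Finset.prod_insert (by simp), mul_comm]
      congr 1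
      · refine Finset.prod_congr rfl fun i hi => ?_
        have hi' : (i : ℕ) < κ := by simpa using hi
        have hne : i ≠ κ := fun h => by simp [h] at hi'
        rw [M.entryProb_congr (p' := q₀) fun j hj => ?_]
        · simp [hne]
        · have : j ≠ κ := fun h => by
            rw [h] at hj
            exact absurd (Fin.lt_def.1 hj) (by omega)
          simp [this]
      · rw [M.entryProb_congr (p' := q₀) fun j hj => by simp [hj.ne]]
        simp
    rw [Finset.sum_congr rfl hinner, ← Finset.mul_sum]
    -- From the exit on, only the factor of step `κ` can differ from one: auxiliary states are
    -- absorbing, and `abot` is played there surely.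
    have hrest : ∏ h ∈ Finset.univ.filter (fun h : Fin H => ¬ (h : ℕ) < κ),
        (prunedMDP M core hcore).entryProb h (prunePath abot core q₀) (prunePath abot core q₀ h).1 *
        (π' h (prunePath abot core q₀ h).1 : A → ℝ) (prunePath abot core q₀ h).2 =
        ∑ y ∈ (M.states κ \ core κ) ×ˢ (Finset.univ : Finset A),
          M.entryProb κ q₀ y.1 * (π κ y.1 : A → ℝ) y.2 := by
      rw [Finset.prod_eq_single_of_mem κ (by simp)]
      · rw [prunePath_of_not_mem abot le_rfl hκ, hπ.2, mul_one,
          entryProb_pruned_none hcore abot hlt, Finset.sum_product]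
        refine Finset.sum_congr rfl fun x _ => ?_
        simp only
        rw [← Finset.mul_sum, sum_stdSimplex, mul_one]
      · intro h hh hne
        have : κ < h := lt_of_le_of_ne (not_lt.1 (Finset.mem_filter.1 hh).2) hne.symm
        rw [prunePath_of_not_mem abot this.le hκ, hπ.2, mul_one,
          entryProb_pruned_absorbed hcore abot this hκ]
    rw [← Finset.prod_filter_mul_prod_filter_not Finset.univ (fun h : Fin H => (h : ℕ) < κ), hrest]
    congr 1
    refine Finset.prod_congr rfl fun h hh => (hsome h fun k hk => hlt k ?_).symm
    exact lt_of_le_of_lt hk (by simpa using hh)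

open Classical in
/-- The law of the pruned path is the law of the path in the pruned MDP. -/
theorem sum_pathProb_fiber_prunePath {π : Policy ℕ A H} {π' : Policy (Option ℕ) A H}
    (hπ : PrunesTo abot core π π') (p : Path (Option ℕ) A H) :
    ∑ q ∈ M.paths with prunePath abot core q = p, M.pathProb π q =
      (prunedMDP M core hcore).pathProb π' p := by
  have : Nonempty A := ⟨abot⟩
  set M' := prunedMDP M core hcore with hM'
  set f : Path (Option ℕ) A H → ℝ := fun p => ∑ q ∈ M.paths with prunePath abot core q = p,
    M.pathProb π q with hf
  -- For pruned paths that arise from no path only the inequality is evident. Both sides sum to one,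
  -- so it is an equality everywhere.
  have hle : ∀ p ∈ M'.paths, f p ≤ M'.pathProb π' p := by
    intro p _
    by_cases hp : ∃ q₀ ∈ M.paths, prunePath abot core q₀ = p
    · obtain ⟨q₀, hq₀, rfl⟩ := hp
      exact (sum_pathProb_fiber_prunePath_of_mem hcore abot hπ hq₀).le
    · have : f p = 0 := by
        rw [hf]
        refine Finset.sum_eq_zero fun q hq => ?_
        rw [Finset.mem_filter] at hq
        exact absurd ⟨q, hq.1, hq.2⟩ hp
      rw [this]
      exact M'.pathProb_nonneg _ _
  have hsum : ∑ p ∈ M'.paths, f p = ∑ p ∈ M'.paths, M'.pathProb π' p := by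
    rw [M'.sum_pathProb, hf, Finset.sum_fiberwise_of_maps_to
      (fun q _ => prunePath_mem_paths hcore abot q), M.sum_pathProb]
  by_cases hp : p ∈ M'.paths
  · exact (Finset.sum_eq_sum_iff_of_le hle).1 hsum p hp
  · rw [M'.pathProb_eq_zero π' hp]
    refine Finset.sum_eq_zero fun q hq => ?_
    rw [Finset.mem_filter] at hq
    exact absurd (hq.2 ▸ prunePath_mem_paths hcore abot q) hp

open Classical in
/-- The probability that an episode leaves the identified states. -/
def leaveProb (M : LayeredMDP ℕ A H) (core : Fin H → Finset ℕ) (π : Policy ℕ A H) : ℝ :=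
  ∑ p ∈ M.paths with ∃ h, (p h).1 ∉ core h, M.pathProb π p

theorem value_pruned_eq {π : Policy ℕ A H} {π' : Policy (Option ℕ) A H}
    (hπ : PrunesTo abot core π π') (ℓ : LossFn ℕ A H) :
    (prunedMDP M core hcore).value π' (pruneLoss ℓ) =
      ∑ q ∈ M.paths, M.pathProb π q * ∑ h, pruneLoss ℓ h (prunePath abot core q h).1
        (prunePath abot core q h).2 := by
  classical
  unfold LayeredMDP.value
  rw [← Finset.sum_fiberwise_of_maps_to (fun q _ => prunePath_mem_paths hcore abot q)]
  refine Finset.sum_congr rfl fun p _ => ?_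
  rw [← sum_pathProb_fiber_prunePath hcore abot hπ, Finset.sum_mul]
  refine Finset.sum_congr rfl fun q hq => ?_
  rw [(Finset.mem_filter.1 hq).2]

/-- Pruning replaces the losses from the exit on by zero and keeps the others. -/
theorem value_pruned_le {π : Policy ℕ A H} {π' : Policy (Option ℕ) A H}
    (hπ : PrunesTo abot core π π') {ℓ : LossFn ℕ A H}
    (hℓ : ∀ h x a, ℓ h x a ∈ Set.Icc (0 : ℝ) 1) :
    (prunedMDP M core hcore).value π' (pruneLoss ℓ) ≤ M.value π ℓ := by
  rw [value_pruned_eq hcore abot hπ, LayeredMDP.value]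
  refine Finset.sum_le_sum fun q _ => mul_le_mul_of_nonneg_left (Finset.sum_le_sum fun h _ => ?_)
    (M.pathProb_nonneg _ _)
  unfold prunePath
  split_ifs
  · exact le_rfl
  · exact (hℓ _ _ _).1

/-- A path that stays in the core loses nothing by pruning, and any other path loses at most `H`. -/
theorem value_le_value_pruned_add {π : Policy ℕ A H} {π' : Policy (Option ℕ) A H}
    (hπ : PrunesTo abot core π π') {ℓ : LossFn ℕ A H}
    (hℓ : ∀ h x a, ℓ h x a ∈ Set.Icc (0 : ℝ) 1) :
    M.value π ℓ ≤ (prunedMDP M core hcore).value π' (pruneLoss ℓ) + H * leaveProb M core π := by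
  classical
  rw [value_pruned_eq hcore abot hπ, LayeredMDP.value, leaveProb, Finset.sum_filter,
    Finset.mul_sum, ← Finset.sum_add_distrib]
  refine Finset.sum_le_sum fun q _ => ?_
  have hnn := M.pathProb_nonneg π q
  split_ifs with hq
  · have h1 : ∑ h, ℓ h (q h).1 (q h).2 ≤ H := by
      calc ∑ h, ℓ h (q h).1 (q h).2 ≤ ∑ _h : Fin H, (1 : ℝ) :=
            Finset.sum_le_sum fun h _ => (hℓ _ _ _).2
        _ = H := by simp
    have h2 : 0 ≤ ∑ h, pruneLoss ℓ h (prunePath abot core q h).1 (prunePath abot core q h).2 := by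
      refine Finset.sum_nonneg fun h _ => ?_
      unfold prunePath
      split_ifs
      · exact (hℓ _ _ _).1
      · exact le_rfl
    nlinarith
  · push Not at hq
    rw [mul_zero, add_zero]
    refine le_of_eq ?_
    congr 1
    refine Finset.sum_congr rfl fun h _ => ?_
    rw [prunePath_of_pos abot fun k _ => hq k]
    rfl

theorem prunesTo_prunePolicy (π : Policy ℕ A H) : PrunesTo abot core π (prunePolicy abot π) := by
  classical
  exact ⟨fun _ _ _ => rfl, fun _ => by simp [prunePolicy]⟩

theorem prunePolicy_mem {Pol : PolicySet ℕ A H} {π : Policy ℕ A H} (hcore : ∀ h, core h ⊆ M.states h)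
    (hπ : π ∈ Pol.policies M.states) :
    prunePolicy abot π ∈ (prunedPolicySet Pol abot).policies (prunedStates core) := by
  intro h x hx
  cases x with
  | none =>
    simp only [prunedPolicySet, prunePolicy, Set.mem_ofPred_eq]
    funext a
    congr
  | some n => exact hπ h n (hcore h (by simpa [prunedStates] using hx))

theorem value_nonneg {X : Type} (M : LayeredMDP X A H) (π : Policy X A H) {ℓ : LossFn X A H}
    (hℓ : ∀ h x a, 0 ≤ ℓ h x a) : 0 ≤ M.value π ℓ :=
  Finset.sum_nonneg fun _ _ => mul_nonneg (M.pathProb_nonneg _ _)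
    (Finset.sum_nonneg fun _ _ => hℓ _ _ _)

theorem pruneLoss_mem {ℓ : LossFn ℕ A H} (hℓ : ∀ h x a, ℓ h x a ∈ Set.Icc (0 : ℝ) 1) (h : Fin H)
    (x : Option ℕ) (a : A) : pruneLoss ℓ h x a ∈ Set.Icc (0 : ℝ) 1 := by
  cases x with
  | none => exact ⟨le_rfl, zero_le_one⟩
  | some n => exact hℓ h n a

end Pruned

/-! ### The memory of SF-RL along a sequence of episodes -/

section MemorySequence

variable {A : Type} {H : ℕ} (abot : A) (δ ε : ℝ) (e : ℕ → Seed × Feedback ℕ A H)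

/-- The memory of SF-RL before episode `t`, if episode `i` has seed and feedback `e i`. -/
def memSeq : ℕ → Memory A H
  | 0 => Memory.start A H
  | t + 1 => (memSeq t).step abot δ ε (e t)

theorem foldl_ofFn_step (t : ℕ) :
    (List.ofFn fun i : Fin t => e i).foldl (Memory.step abot δ ε) (Memory.start A H) =
      memSeq abot δ ε e t := by
  induction t with
  | zero => rfl
  | succ t ih =>
    rw [List.ofFn_succ', List.concat_eq_append, List.foldl_append]
    simp only [Fin.val_castSucc, ih, List.foldl_cons, List.foldl_nil, Fin.val_last, memSeq]

theorem memSeq_time (t : ℕ) : (memSeq abot δ ε e t).time = t := by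
  induction t with
  | zero => rfl
  | succ t ih =>
    simp only [memSeq, Memory.step]
    split_ifs <;> simp [ih]

theorem memSeq_count_succ (t : ℕ) (h : Fin H) : (memSeq abot δ ε e (t + 1)).count h =
    (memSeq abot δ ε e t).count h + Finsupp.single ((e t).2.1 h).1 1 := by
  simp only [memSeq, Memory.step]
  split_ifs <;> rfl

theorem memSeq_count (t : ℕ) (h : Fin H) (n : ℕ) : (memSeq abot δ ε e t).count h n =
    ((Finset.range t).filter fun i => ((e i).2.1 h).1 = n).card := by
  induction t with
  | zero => rfl
  | succ t ih =>
    rw [memSeq_count_succ, Finsupp.add_apply, ih, Finset.range_add_one, Finset.filter_insert]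
    split_ifs with hn
    · rw [Finset.card_insert_of_notMem (by simp), hn, Finsupp.single_eq_same]
    · rw [Finsupp.single_apply, if_neg hn, add_zero]

theorem step_core_congr {m m' : Memory A H} {e e' : Seed × Feedback ℕ A H}
    (ht : m.time = m'.time) (hn : m.count = m'.count) (hc : m.core = m'.core)
    (he : e.2.1 = e'.2.1) : (m.step abot δ ε e).core = (m'.step abot δ ε e').core := by
  obtain ⟨t, n, c, l⟩ := m
  obtain ⟨t', n', c', l'⟩ := m'
  obtain ⟨u, p, f⟩ := e
  obtain ⟨u', p', f'⟩ := e'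
  simp only at ht hn hc he
  subst ht hn hc he
  simp only [Memory.step]
  split_ifs <;> rfl

/-- The test only counts visits, so seeds and losses do not influence the core. The core is thus
known before an episode as soon as the earlier paths are. -/
theorem memSeq_core_congr {e e' : ℕ → Seed × Feedback ℕ A H} {t : ℕ}
    (he : ∀ i < t, (e i).2.1 = (e' i).2.1) :
    (memSeq abot δ ε e t).core = (memSeq abot δ ε e' t).core := by
  induction t with
  | zero => rfl
  | succ t ih =>
    have ih := ih fun i hi => he i (by omega)
    have hc : (memSeq abot δ ε e t).count = (memSeq abot δ ε e' t).count := by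
      funext h
      ext n
      rw [memSeq_count, memSeq_count]
      congr 1
      refine Finset.filter_congr fun i hi => ?_
      rw [he i (by have := Finset.mem_range.1 hi; omega)]
    exact step_core_congr abot δ ε (by rw [memSeq_time, memSeq_time]) hc ih
      (he t (Nat.lt_succ_self t))

theorem memSeq_core_mono : Monotone fun t => (memSeq abot δ ε e t).core := by
  refine monotone_nat_of_le_succ fun t => ?_
  simp only [memSeq, Memory.step]
  split_ifs
  · exact fun h => Finset.subset_union_left
  · exact le_rfl

theorem identified_of_mem_core {t : ℕ} {h : Fin H} {n : ℕ}
    (h0 : n ∉ (memSeq abot δ ε e t).core h) (h1 : n ∈ (memSeq abot δ ε e (t + 1)).core h) :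
    0 < (memSeq abot δ ε e (t + 1)).count h n ∧
      Identified H δ ε (t + 1) ((memSeq abot δ ε e (t + 1)).count h n) := by
  simp only [memSeq, Memory.step] at h1 ⊢
  split_ifs at h1 ⊢ with hc
  · simp only [Finset.mem_union, h0, false_or, Finset.mem_filter, Finsupp.mem_support_iff,
      memSeq_time] at h1
    exact ⟨Nat.pos_of_ne_zero h1.1, h1.2⟩
  · exact absurd h1 h0

theorem not_identified_of_not_mem_core {t : ℕ} {h : Fin H}
    (h1 : ((e t).2.1 h).1 ∉ (memSeq abot δ ε e (t + 1)).core h) :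
    ¬ Identified H δ ε (t + 1) ((memSeq abot δ ε e (t + 1)).count h ((e t).2.1 h).1) := by
  intro hid
  have h0 : ((e t).2.1 h).1 ∉ (memSeq abot δ ε e t).core h := fun h0 =>
    h1 (memSeq_core_mono abot δ ε e (Nat.le_succ t) h h0)
  rw [memSeq_count_succ] at hid
  have hex : ∃ h, ((e t).2.1 h).1 ∉ (memSeq abot δ ε e t).core h ∧
      Identified H δ ε ((memSeq abot δ ε e t).time + 1) (((memSeq abot δ ε e t).count h +
        Finsupp.single ((e t).2.1 h).1 1 : ℕ →₀ ℕ) ((e t).2.1 h).1) :=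
    ⟨h, h0, by rwa [memSeq_time]⟩
  apply h1
  simp only [memSeq, Memory.step]
  rw [if_pos hex]
  simp only [Finset.mem_union, Finset.mem_filter, Finsupp.mem_support_iff]
  refine Or.inr ⟨by simp, by rwa [memSeq_time]⟩

theorem memSeq_hist_of_core_ne {t : ℕ}
    (hne : (memSeq abot δ ε e (t + 1)).core ≠ (memSeq abot δ ε e t).core) :
    (memSeq abot δ ε e (t + 1)).hist = [] := by
  simp only [memSeq, Memory.step] at hne ⊢
  split_ifs at hne ⊢
  · rfl
  · exact absurd rfl hne

/-- A restart always adds the state that triggered it, so an unchanged core means that the pruned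
feedback was recorded. -/
theorem memSeq_hist_of_core_eq {t : ℕ}
    (heq : (memSeq abot δ ε e (t + 1)).core = (memSeq abot δ ε e t).core) :
    (memSeq abot δ ε e (t + 1)).hist = (memSeq abot δ ε e t).hist ++
      [((e t).1, pruneFeedback abot (memSeq abot δ ε e t).core (e t).2)] := by
  simp only [memSeq, Memory.step] at heq ⊢
  split_ifs at heq ⊢ with hc
  · exfalso
    obtain ⟨h, hn, hid⟩ := hc
    apply hn
    rw [← heq]
    simp only [Finset.mem_union, Finset.mem_filter, Finsupp.mem_support_iff]
    exact Or.inr ⟨by simp, hid⟩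
  · rfl

/-- The identified states are `S` for the first time before episode `t₀`. -/
def EpochStart (t₀ : ℕ) (S : Fin H → Finset ℕ) : Prop :=
  (memSeq abot δ ε e t₀).core = S ∧ ∀ t < t₀, (memSeq abot δ ε e t).core ≠ S

variable {abot δ ε e} {t₀ : ℕ} {S : Fin H → Finset ℕ}

theorem EpochStart.core_eq (h : EpochStart abot δ ε e t₀ S) {k k' : ℕ} (hk : k' ≤ k)
    (hS : (memSeq abot δ ε e (t₀ + k)).core = S) : (memSeq abot δ ε e (t₀ + k')).core = S :=
  le_antisymm
    (hS ▸ memSeq_core_mono abot δ ε e (by omega : t₀ + k' ≤ t₀ + k))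
    (h.1 ▸ memSeq_core_mono abot δ ε e (Nat.le_add_right t₀ k'))

theorem EpochStart.hist_eq (h : EpochStart abot δ ε e t₀ S) (k : ℕ)
    (hS : (memSeq abot δ ε e (t₀ + k)).core = S) :
    (memSeq abot δ ε e (t₀ + k)).hist =
      List.ofFn fun i : Fin k => ((e (t₀ + i)).1, pruneFeedback abot S (e (t₀ + i)).2) := by
  induction k with
  | zero =>
    rw [List.ofFn_zero]
    cases t₀ with
    | zero => rfl
    | succ t =>
      refine memSeq_hist_of_core_ne abot δ ε e fun heq => ?_
      exact h.2 t (Nat.lt_succ_self t) (heq ▸ h.1)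
  | succ k ih =>
    have hk := h.core_eq (Nat.le_succ k) hS
    rw [← add_assoc] at hS ⊢
    rw [memSeq_hist_of_core_eq abot δ ε e (hS.trans hk.symm), ih hk, hk, List.ofFn_succ',
      List.concat_eq_append]
    simp only [Fin.val_castSucc, Fin.val_last]

/-- Before a state is identified it is visited rarely. -/
theorem card_visits_not_mem_core_le (hH : 1 ≤ H) (hδ : 0 < δ) (hε : 0 ≤ ε) {T : ℕ} {B : ℝ}
    (hB : 2 * ε * T + Real.log (2 * (H : ℝ) ^ 2 * (T : ℝ) ^ 2 / δ) + 1 ≤ B) (hB0 : 0 ≤ B)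
    (h : Fin H) (n : ℕ) :
    (((Finset.range T).filter fun t => ((e t).2.1 h).1 = n ∧
      n ∉ (memSeq abot δ ε e t).core h).card : ℝ) ≤ B + 1 := by
  -- While the state is outside the core, the failed test at its last visit bounds the count by `B`.
  -- The visit that leads to its identification still starts outside the core, whence `B + 1`.
  have key : ∀ t ≤ T,
      ((((Finset.range t).filter fun t => ((e t).2.1 h).1 = n ∧
        n ∉ (memSeq abot δ ε e t).core h).card : ℝ) ≤ B + 1) ∧
      (n ∉ (memSeq abot δ ε e t).core h →
        (((Finset.range t).filter fun t => ((e t).2.1 h).1 = n ∧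
        n ∉ (memSeq abot δ ε e t).core h).card : ℝ) ≤ B) := by
    intro t
    induction t with
    | zero => intro _; simp only [Finset.range_zero, Finset.filter_empty, Finset.card_empty,
        Nat.cast_zero]; exact ⟨by linarith, fun _ => hB0⟩
    | succ t ih =>
      intro ht
      obtain ⟨ih1, ih2⟩ := ih (by omega)
      have hstep : (((Finset.range (t + 1)).filter fun t => ((e t).2.1 h).1 = n ∧
          n ∉ (memSeq abot δ ε e t).core h)) =
          if ((e t).2.1 h).1 = n ∧ n ∉ (memSeq abot δ ε e t).core h then
            insert t ((Finset.range t).filter fun t => ((e t).2.1 h).1 = n ∧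
              n ∉ (memSeq abot δ ε e t).core h)
          else ((Finset.range t).filter fun t => ((e t).2.1 h).1 = n ∧
            n ∉ (memSeq abot δ ε e t).core h) := by
        rw [Finset.range_add_one, Finset.filter_insert]
      constructor
      · rw [hstep]
        split_ifs with hc
        · rw [Finset.card_insert_of_notMem (by simp)]
          push_cast
          linarith [ih2 hc.2]
        · exact ih1
      · intro hn
        have hn0 : n ∉ (memSeq abot δ ε e t).core h := fun h0 =>
          hn (memSeq_core_mono abot δ ε e (Nat.le_succ t) h h0)
        by_cases hv : ((e t).2.1 h).1 = n
        · have hni := not_identified_of_not_mem_core abot δ ε e (hv ▸ hn)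
          rw [hv, Identified, not_lt, memSeq_count] at hni
          have hcard : (((Finset.range (t + 1)).filter fun t => ((e t).2.1 h).1 = n ∧
              n ∉ (memSeq abot δ ε e t).core h).card : ℝ) ≤
              (((Finset.range (t + 1)).filter fun t => ((e t).2.1 h).1 = n).card : ℝ) := by
            refine Nat.cast_le.2 (Finset.card_le_card fun i hi => ?_)
            rw [Finset.mem_filter] at hi ⊢
            exact ⟨hi.1, hi.2.1⟩
          have hT : ((t + 1 : ℕ) : ℝ) ≤ T := by exact_mod_cast ht
          have hH' : (1 : ℝ) ≤ H := by exact_mod_cast hH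
          have hlog : Real.log (2 * (H : ℝ) ^ 2 * ((t + 1 : ℕ) : ℝ) ^ 2 / δ) ≤
              Real.log (2 * (H : ℝ) ^ 2 * (T : ℝ) ^ 2 / δ) := by
            refine Real.log_le_log (by positivity) ?_
            gcongr
          have : ε * ((t + 1 : ℕ) : ℝ) ≤ ε * T := mul_le_mul_of_nonneg_left hT hε
          linarith
        · rw [hstep, if_neg fun hc => hv hc.1]
          exact ih2 hn0
  exact (key T le_rfl).1

end MemorySequence

/-! ### The policy of SF-RL -/

section SFRLPolicy

variable {A : Type} [Fintype A] {H : ℕ} [NeZero H] {ALG : BlackBox (Option ℕ) A H}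
  {Pol : PolicySet ℕ A H} {dflt : Policy ℕ A H} {abot : A} {δ ε : ℝ}

/-- The confidence level of the black-box algorithm on the pruned space with identified states `S`. -/
def innerConf (δ : ℝ) (S : Fin H → Finset ℕ) : ℝ := δ / (2 * (stateCount (prunedStates S) : ℝ) ^ 2)

theorem stateCount_pruned (S : Fin H → Finset ℕ) :
    stateCount (prunedStates S) = stateCount S + H := by
  simp [stateCount, prunedStates, Finset.sum_add_distrib]

theorem one_le_stateCount_pruned (S : Fin H → Finset ℕ) :
    (1 : ℝ) ≤ stateCount (prunedStates S) := by
  rw [stateCount_pruned]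
  have := NeZero.one_le (n := H)
  exact_mod_cast (by omega : 1 ≤ stateCount S + H)

theorem innerConf_pos (hδ : 0 < δ) (S : Fin H → Finset ℕ) : 0 < innerConf δ S := by
  have := one_le_stateCount_pruned S
  unfold innerConf
  positivity

theorem innerConf_lt_one (hδ1 : δ < 1) (S : Fin H → Finset ℕ) : innerConf δ S < 1 := by
  have := one_le_stateCount_pruned S
  unfold innerConf
  rw [div_lt_one (by positivity)]
  nlinarith

/-- The policy of SF-RL with memory `m` and its counterpart on the pruned space. -/
theorem sfrl_eq (past : List (Seed × Feedback ℕ A H)) (u : Seed) {m : Memory A H}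
    (hm : past.foldl (Memory.step abot δ ε) (Memory.start A H) = m) :
    sfrl ALG Pol dflt abot δ ε past u = fun h n => if n ∈ m.core h then
      ALG (prunedStates m.core) (prunedPolicySet Pol abot) (innerConf δ m.core) m.hist u h (some n)
      else dflt h n := by
  subst hm
  rfl

variable {σ : Setting} {reg : ℕ → ℕ → ℕ → ℝ → ℝ}

theorem prunesTo_sfrl (hALG : HasRegretGuarantee σ ALG (prunedPolicySet Pol abot) reg)
    (hδ : 0 < δ) (hδ1 : δ < 1) (past : List (Seed × Feedback ℕ A H)) (u : Seed) {m : Memory A H}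
    (hm : past.foldl (Memory.step abot δ ε) (Memory.start A H) = m) :
    PrunesTo abot m.core (sfrl ALG Pol dflt abot δ ε past u)
      (ALG (prunedStates m.core) (prunedPolicySet Pol abot) (innerConf δ m.core) m.hist u) := by
  refine ⟨fun h n hn => ?_, fun h => ?_⟩
  · rw [sfrl_eq past u hm]
    exact (if_pos hn).symm
  · have := hALG.mem_policies (prunedStates m.core) (innerConf δ m.core) (innerConf_pos hδ _)
      (innerConf_lt_one hδ1 _) m.hist u h none (by simp [prunedStates])
    simp only [prunedPolicySet, Set.mem_ofPred_eq] at this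
    rw [this]
    simp

theorem sfrl_mem_policies (hALG : HasRegretGuarantee σ ALG (prunedPolicySet Pol abot) reg)
    (hdflt : ∀ h n, dflt h n ∈ Pol h n)
    (hδ : 0 < δ) (hδ1 : δ < 1) (past : List (Seed × Feedback ℕ A H)) (u : Seed)
    (S : Fin H → Finset ℕ) : sfrl ALG Pol dflt abot δ ε past u ∈ Pol.policies S := by
  intro h n _
  rw [sfrl_eq past u rfl]
  simp only
  split_ifs with hn
  · exact hALG.mem_policies _ _ (innerConf_pos hδ _) (innerConf_lt_one hδ1 _) _ u h (some n)
      (by simpa [prunedStates] using hn)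
  · exact hdflt h n

end SFRLPolicy

/-! ### Conditional probabilities and concentration -/

section Concentration

open scoped ENNReal

variable {Ω : Type} [mΩ : MeasurableSpace Ω] {μ : Measure Ω}

/-- Here `g` need not be `m`-measurable; it is only a version of the conditional probability up to a
null set, which suffices for the path law of a run. -/
theorem measure_inter_eq_lintegral_of_condExp [IsFiniteMeasure μ] {m : MeasurableSpace Ω}
    (hm : m ≤ mΩ) {V : Set Ω} (hV : MeasurableSet[mΩ] V) {g : Ω → ℝ} (hg0 : ∀ ω, 0 ≤ g ω)
    (hg : μ[V.indicator (fun _ => (1 : ℝ)) | m] =ᵐ[μ] g) {B : Set Ω} (hB : MeasurableSet[m] B) :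
    μ (B ∩ V) = ∫⁻ ω in B, ENNReal.ofReal (g ω) ∂μ := by
  have hint : Integrable (V.indicator (fun _ => (1 : ℝ))) μ :=
    (integrable_const 1).indicator hV
  have hgi : Integrable g μ := (integrable_congr hg).1 integrable_condExp
  rw [← ofReal_integral_eq_lintegral_ofReal hgi.integrableOn (Filter.Eventually.of_forall hg0),
    ← integral_congr_ae (ae_restrict_of_ae hg), setIntegral_condExp hm hint hB,
    setIntegral_indicator hV]
  simp [Measure.real]

/-- On `m` the restriction of `μ` to `V` is dominated by `c • μ`, and integrals of `m`-measurable
functions only see the trimmed measures. -/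
theorem setLIntegral_inter_le {m : MeasurableSpace Ω} (hm : m ≤ mΩ) {V : Set Ω}
    {c : ℝ≥0∞} (h : ∀ B, MeasurableSet[m] B → μ (B ∩ V) ≤ c * μ B)
    {f : Ω → ℝ≥0∞} (hf : Measurable[m] f) {B : Set Ω} (hB : MeasurableSet[m] B) :
    ∫⁻ ω in B ∩ V, f ω ∂μ ≤ c * ∫⁻ ω in B, f ω ∂μ := by
  have hle : (μ.restrict V).trim hm ≤ (c • μ).trim hm := by
    refine Measure.le_iff.2 fun s hs => ?_
    rw [trim_measurableSet_eq hm hs, trim_measurableSet_eq hm hs, Measure.restrict_apply (hm s hs)]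
    exact h s hs
  have hfB : Measurable[m] (B.indicator f) := hf.indicator hB
  calc ∫⁻ ω in B ∩ V, f ω ∂μ = ∫⁻ ω, B.indicator f ω ∂(μ.restrict V) := by
        rw [lintegral_indicator (hm B hB), Measure.restrict_restrict (hm B hB)]
    _ = ∫⁻ ω, B.indicator f ω ∂((μ.restrict V).trim hm) := (lintegral_trim hm hfB).symm
    _ ≤ ∫⁻ ω, B.indicator f ω ∂((c • μ).trim hm) := lintegral_mono' hle le_rfl
    _ = ∫⁻ ω, B.indicator f ω ∂(c • μ) := lintegral_trim hm hfB
    _ = c * ∫⁻ ω in B, f ω ∂μ := by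
        rw [lintegral_smul_measure, lintegral_indicator (hm B hB), smul_eq_mul]

/-- Ville's maximal inequality for nonnegative supermartingales. -/
theorem maximal_ineq_of_supermartingale {m : ℕ → MeasurableSpace Ω} (hm : ∀ n, m n ≤ mΩ)
    (hmono : Monotone m) {X : ℕ → Ω → ℝ≥0∞} (hX : ∀ n, Measurable[m n] (X n))
    (hsup : ∀ n B, MeasurableSet[m n] B → ∫⁻ ω in B, X (n + 1) ω ∂μ ≤ ∫⁻ ω in B, X n ω ∂μ)
    (c : ℝ≥0∞) (N : ℕ) : c * μ {ω | ∃ n ≤ N, c ≤ X n ω} ≤ ∫⁻ ω, X 0 ω ∂μ := by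
  have hmeas : ∀ n, MeasurableSet[m n] {ω | ∃ k ≤ n, c ≤ X k ω} := by
    intro n
    have : {ω | ∃ k ≤ n, c ≤ X k ω} = ⋃ k ∈ Set.Iic n, {ω | c ≤ X k ω} := by
      ext ω; simp
    rw [this]
    refine MeasurableSet.biUnion (Set.to_countable _) fun k hk => ?_
    exact hmono hk _ (hX k measurableSet_Ici)
  -- The induction needs the mass of `X N` where the level has not yet been reached: in each step
  -- part of it pays for the newly crossing points, and the rest decreases by the supermartingale
  -- property.
  have key : ∀ N, c * μ {ω | ∃ n ≤ N, c ≤ X n ω} +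
      ∫⁻ ω in {ω | ∃ n ≤ N, c ≤ X n ω}ᶜ, X N ω ∂μ ≤ ∫⁻ ω, X 0 ω ∂μ := by
    intro N
    induction N with
    | zero =>
      have hs : MeasurableSet {ω | ∃ n ≤ 0, c ≤ X n ω} := hm 0 _ (hmeas 0)
      refine le_trans ?_ (lintegral_add_compl (X 0) hs).le
      rw [← setLIntegral_const]
      refine add_le_add ?_ le_rfl
      refine setLIntegral_mono' hs fun ω hω => ?_
      obtain ⟨n, hn, h⟩ := hω
      obtain rfl : n = 0 := by omega
      exact h
    | succ N ih =>
      set D := {ω | ∃ n ≤ N, c ≤ X n ω} with hD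
      set D' := {ω | ∃ n ≤ N + 1, c ≤ X n ω} with hD'
      have hDm : MeasurableSet D := hm N _ (hmeas N)
      have hDm' : MeasurableSet D' := hm (N + 1) _ (hmeas (N + 1))
      have hsub : D ⊆ D' := fun ω ⟨n, hn, h⟩ => ⟨n, by omega, h⟩
      refine le_trans ?_ ih
      have h1 : μ D' = μ D + μ (Dᶜ ∩ D') := by
        rw [← measure_inter_add_sdiff D' hDm, Set.inter_eq_self_of_subset_right hsub, Set.sdiff_eq,
          Set.inter_comm]
      have h2 : ∫⁻ ω in Dᶜ, X (N + 1) ω ∂μ =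
          ∫⁻ ω in Dᶜ ∩ D', X (N + 1) ω ∂μ + ∫⁻ ω in D'ᶜ, X (N + 1) ω ∂μ := by
        rw [← lintegral_inter_add_sdiff (X (N + 1)) Dᶜ hDm']
        congr 2
        rw [Set.sdiff_eq, Set.inter_eq_self_of_subset_right (Set.compl_subset_compl.2 hsub)]
      have h3 : c * μ (Dᶜ ∩ D') ≤ ∫⁻ ω in Dᶜ ∩ D', X (N + 1) ω ∂μ := by
        rw [← setLIntegral_const]
        refine setLIntegral_mono' (hDm.compl.inter hDm') fun ω hω => ?_
        obtain ⟨hω1, n, hn, h⟩ := hω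
        rcases Nat.lt_or_ge N n with h' | h'
        · obtain rfl : n = N + 1 := by omega
          exact h
        · exact absurd ⟨n, h', h⟩ hω1
      calc c * μ D' + ∫⁻ ω in D'ᶜ, X (N + 1) ω ∂μ
          = c * μ D + (c * μ (Dᶜ ∩ D') + ∫⁻ ω in D'ᶜ, X (N + 1) ω ∂μ) := by
            rw [h1, mul_add, add_assoc]
        _ ≤ c * μ D + ∫⁻ ω in Dᶜ, X (N + 1) ω ∂μ := by rw [h2]; gcongr
        _ ≤ c * μ D + ∫⁻ ω in Dᶜ, X N ω ∂μ := add_le_add le_rfl (hsup N _ (hmeas N).compl)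
  exact le_trans le_self_add (key N)

/-- The rate 1/2 is admissible because 1 − 1/e ≥ 1/2. This is where the factor two between
conditional probabilities and occurrences comes from. -/
theorem exp_half_mul_le_one {p : ℝ} (hp : 0 ≤ p) :
    Real.exp (p / 2) * (1 - (1 - Real.exp (-1)) * p) ≤ 1 := by
  have h1 : 1 - (1 - Real.exp (-1)) * p ≤ Real.exp (-((1 - Real.exp (-1)) * p)) := by
    linarith [Real.add_one_le_exp (-((1 - Real.exp (-1)) * p))]
  have h2 : Real.exp (-1) ≤ 1 / 2 := by
    rw [Real.exp_neg, one_div]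
    exact inv_anti₀ two_pos (by linarith [Real.add_one_le_exp (1 : ℝ)])
  calc Real.exp (p / 2) * (1 - (1 - Real.exp (-1)) * p)
      ≤ Real.exp (p / 2) * Real.exp (-((1 - Real.exp (-1)) * p)) := by gcongr
    _ = Real.exp (p / 2 - (1 - Real.exp (-1)) * p) := by rw [← Real.exp_add]; ring_nf
    _ ≤ 1 := Real.exp_le_one_iff.2 (by nlinarith)

/-- The sum of the conditional probabilities of a sequence of events is at most twice the number of
the events that occur, up to a logarithmic term. -/
theorem measure_lt_sum_condProb_le [IsProbabilityMeasure μ] (𝓕 : Filtration ℕ mΩ)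
    {𝒢 : ℕ → MeasurableSpace Ω} (h𝒢 : ∀ i, 𝓕 i ≤ 𝒢 i) (h𝒢' : ∀ i, 𝒢 i ≤ 𝓕 (i + 1))
    {V : ℕ → Set Ω} (hV : ∀ i, MeasurableSet[𝓕 (i + 1)] (V i)) {P : ℕ → Ω → ℝ}
    (hPm : ∀ i, StronglyMeasurable[𝒢 i] (P i)) (hP : ∀ i ω, P i ω ∈ Set.Icc (0 : ℝ) 1)
    (hPV : ∀ i, μ[(V i).indicator (fun _ => (1 : ℝ)) | 𝒢 i] =ᵐ[μ] P i)
    {δ : ℝ} (hδ : 0 < δ) (T : ℕ) :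
    μ {ω | 2 * ∑ i ∈ Finset.range T, (V i).indicator (fun _ => (1 : ℝ)) ω + 2 * Real.log (1 / δ) <
      ∑ i ∈ Finset.range T, P i ω} ≤ ENNReal.ofReal δ := by
  -- An exponential process of mean at most one; Markov's inequality at the level `1 / δ` gives the
  -- claim.
  set X : ℕ → Ω → ℝ := fun n ω => Real.exp (∑ i ∈ Finset.range n,
    (P i ω / 2 - (V i).indicator (fun _ => (1 : ℝ)) ω)) with hXdef
  have hXm : ∀ n, StronglyMeasurable[𝓕 n] (X n) := by
    intro n
    refine Real.continuous_exp.comp_stronglyMeasurable ?_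
    refine Finset.stronglyMeasurable_fun_sum _ fun i hi => ?_
    have hin : i + 1 ≤ n := Finset.mem_range.1 hi
    refine StronglyMeasurable.sub ?_ ?_
    · exact (continuous_id.div_const (2 : ℝ)).comp_stronglyMeasurable
        ((hPm i).mono ((h𝒢' i).trans (𝓕.mono hin)))
    · exact (stronglyMeasurable_const.indicator (hV i)).mono (𝓕.mono hin)
  have hXb : ∀ n ω, ‖X n ω‖ ≤ Real.exp n := by
    intro n ω
    rw [Real.norm_eq_abs, abs_of_pos (Real.exp_pos _)]
    refine Real.exp_le_exp.2 ?_
    calc ∑ i ∈ Finset.range n, (P i ω / 2 - (V i).indicator (fun _ => (1 : ℝ)) ω)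
        ≤ ∑ i ∈ Finset.range n, (1 : ℝ) := by
          refine Finset.sum_le_sum fun i _ => ?_
          have h1 := (hP i ω).2
          have h2 : 0 ≤ (V i).indicator (fun _ => (1 : ℝ)) ω :=
            Set.indicator_nonneg (fun _ _ => zero_le_one) ω
          linarith
      _ = n := by simp
  have hXi : ∀ n, Integrable (X n) μ := fun n =>
    Integrable.of_bound ((hXm n).mono (𝓕.le n)).aestronglyMeasurable (Real.exp n)
      (Filter.Eventually.of_forall (hXb n))
  have hE : ∀ n, ∫ ω, X n ω ∂μ ≤ 1 := by
    intro n
    induction n with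
    | zero => simp [hXdef]
    | succ n ih =>
      refine le_trans ?_ ih
      set Y : Ω → ℝ := fun ω => X n ω * Real.exp (P n ω / 2) with hY
      set I : Ω → ℝ := (V n).indicator (fun _ => (1 : ℝ)) with hI
      have hYm : StronglyMeasurable[𝒢 n] Y :=
        ((hXm n).mono (h𝒢 n)).mul
          ((Real.continuous_exp.comp (continuous_id.div_const (2 : ℝ))).comp_stronglyMeasurable (hPm n))
      have h𝒢Ω : 𝒢 n ≤ mΩ := (h𝒢' n).trans (𝓕.le _)
      have hYb : ∀ ω, ‖Y ω‖ ≤ Real.exp n * Real.exp 1 := by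
        intro ω
        rw [hY, norm_mul]
        refine mul_le_mul (hXb n ω) ?_ (norm_nonneg _) (Real.exp_pos _).le
        rw [Real.norm_eq_abs, abs_of_pos (Real.exp_pos _)]
        exact Real.exp_le_exp.2 (by linarith [(hP n ω).2])
      have hYi : Integrable Y μ := Integrable.of_bound (hYm.mono h𝒢Ω).aestronglyMeasurable _
        (Filter.Eventually.of_forall hYb)
      have hVm : MeasurableSet (V n) := 𝓕.le _ _ (hV n)
      have hIi : Integrable I μ := (integrable_const 1).indicator hVm
      have hYIi : Integrable (fun ω => Y ω * I ω) μ :=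
        hIi.bdd_mul (hYm.mono h𝒢Ω).aestronglyMeasurable (Filter.Eventually.of_forall hYb)
      have hYPi : Integrable (fun ω => Y ω * P n ω) μ := by
        refine Integrable.bdd_mul (c := Real.exp n * Real.exp 1) ?_
          (hYm.mono h𝒢Ω).aestronglyMeasurable (Filter.Eventually.of_forall hYb)
        exact Integrable.of_bound ((hPm n).mono h𝒢Ω).aestronglyMeasurable 1
          (Filter.Eventually.of_forall fun ω => by
            rw [Real.norm_eq_abs, abs_of_nonneg (hP n ω).1]; exact (hP n ω).2)
      have hswap : ∫ ω, Y ω * I ω ∂μ = ∫ ω, Y ω * P n ω ∂μ := by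
        have h1 := condExp_mul_of_stronglyMeasurable_left hYm hYIi hIi
        calc ∫ ω, Y ω * I ω ∂μ = ∫ ω, (μ[Y * I | 𝒢 n]) ω ∂μ := (integral_condExp h𝒢Ω).symm
          _ = ∫ ω, Y ω * P n ω ∂μ := by
            refine integral_congr_ae ?_
            filter_upwards [h1, hPV n] with ω h1 h2
            rw [h1, Pi.mul_apply, h2]
      -- The factor exp(−1) on `V n` and 1 elsewhere is affine in the indicator, so the indicator
      -- can be replaced by its conditional expectation `P n`.
      have hX1 : ∀ ω, X (n + 1) ω = Y ω - (1 - Real.exp (-1)) * (Y ω * I ω) := by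
        intro ω
        simp only [hXdef, hY, hI]
        rw [Finset.sum_range_succ, Real.exp_add, sub_eq_add_neg (P n ω / 2), Real.exp_add]
        by_cases hω : ω ∈ V n
        · simp only [Set.indicator_of_mem hω]; ring
        · simp only [Set.indicator_of_notMem hω]; simp
      calc ∫ ω, X (n + 1) ω ∂μ = ∫ ω, (Y ω - (1 - Real.exp (-1)) * (Y ω * I ω)) ∂μ := by
            simp_rw [hX1]
        _ = ∫ ω, (Y ω - (1 - Real.exp (-1)) * (Y ω * P n ω)) ∂μ := by
            rw [integral_sub hYi (hYIi.const_mul _), integral_sub hYi (hYPi.const_mul _),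
              integral_const_mul, integral_const_mul, hswap]
        _ ≤ ∫ ω, X n ω ∂μ := by
            refine integral_mono (hYi.sub (hYPi.const_mul _)) (hXi n) fun ω => ?_
            have h1 := exp_half_mul_le_one (hP n ω).1
            have h2 : 0 < X n ω := Real.exp_pos _
            simp only [hY]
            nlinarith
  have hsub : {ω | 2 * ∑ i ∈ Finset.range T, (V i).indicator (fun _ => (1 : ℝ)) ω +
      2 * Real.log (1 / δ) < ∑ i ∈ Finset.range T, P i ω} ⊆ {ω | 1 / δ ≤ X T ω} := by
    intro ω hω
    simp only [Set.mem_ofPred_eq] at hω ⊢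
    simp only [hXdef]
    rw [← Real.log_le_iff_le_exp (by positivity), Finset.sum_sub_distrib, ← Finset.sum_div]
    linarith
  refine (measure_mono hsub).trans ?_
  have hM := mul_meas_ge_le_integral_of_nonneg
    (Filter.Eventually.of_forall fun ω => (Real.exp_pos _).le : 0 ≤ᵐ[μ] X T) (hXi T) (1 / δ)
  rw [← ofReal_measureReal]
  refine ENNReal.ofReal_le_ofReal ?_
  have := hM.trans (hE T)
  rwa [one_div_mul_eq_div, div_le_one hδ] at this

end Concentration

/-! ### The path process of a run -/

namespace Run

open scoped ENNReal

variable {X A : Type} [Countable X] [Fintype A] {H : ℕ} [NeZero H] {σ : Setting}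
  {M : LayeredMDP X A H} {Λ : Learner X A H} {Ω : Type} [mΩ : MeasurableSpace Ω] {μ : Measure Ω}

/-- The information on which the path of episode `t` is conditioned. -/
abbrev info (R : Run σ M Λ μ) (t : ℕ) : MeasurableSpace Ω :=
  R.𝓕 t ⊔ MeasurableSpace.comap (R.loss t) inferInstance ⊔
    MeasurableSpace.comap (R.seed t) inferInstance

theorem filtration_le_info (R : Run σ M Λ μ) (t : ℕ) : R.𝓕 t ≤ R.info t :=
  le_sup_left.trans le_sup_left

theorem info_le_filtration (R : Run σ M Λ μ) (t : ℕ) : R.info t ≤ R.𝓕 (t + 1) :=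
  sup_le (sup_le (R.𝓕.mono (Nat.le_succ t)) (R.measurable_loss t).comap_le)
    (R.measurable_seed t).comap_le

theorem info_le (R : Run σ M Λ μ) (t : ℕ) : R.info t ≤ mΩ :=
  (R.info_le_filtration t).trans (R.𝓕.le _)

/-- A random variable that is determined by the first `t` paths is known before episode `t`. -/
theorem measurable_of_paths (R : Run σ M Λ μ) {β : Type} [MeasurableSpace β] {t : ℕ} {f : Ω → β}
    (hf : ∀ ω ω', (∀ i < t, R.path i ω = R.path i ω') → f ω = f ω') : Measurable[R.𝓕 t] f := by
  intro s _
  -- There are only countably many sequences of `t` paths, so the preimage is a countable union of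
  -- cylinders.
  have : f ⁻¹' s = ⋃ q ∈ (fun ω (i : Fin t) => R.path i ω) '' (f ⁻¹' s),
      ⋂ i : Fin t, {ω | R.path i ω = q i} := by
    ext ω
    simp only [Set.mem_preimage, Set.mem_iUnion, Set.mem_iInter, Set.mem_ofPred_eq,
      Set.mem_image, exists_prop]
    constructor
    · intro h
      exact ⟨fun i => R.path i ω, ⟨ω, h, rfl⟩, fun i => rfl⟩
    · rintro ⟨q, ⟨ω', h', rfl⟩, h⟩
      rwa [hf ω ω' fun i hi => h ⟨i, hi⟩]
  rw [this]
  refine MeasurableSet.biUnion (Set.to_countable _) fun q _ => MeasurableSet.iInter fun i => ?_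
  exact R.𝓕.mono (Nat.succ_le_of_lt i.2) _ (R.measurable_path i (q i))

theorem measurableSet_of_paths (R : Run σ M Λ μ) {t : ℕ} {p : Ω → Prop}
    (hp : ∀ ω ω', (∀ i < t, R.path i ω = R.path i ω') → (p ω ↔ p ω')) :
    MeasurableSet[R.𝓕 t] {ω | p ω} := by
  have h := R.measurable_of_paths (t := t) (f := p) fun ω ω' h => propext (hp ω ω' h)
  exact @measurableSet_setOfPred _ (R.𝓕 t) p |>.2 h

variable [IsProbabilityMeasure μ] [Nonempty A]

theorem condExp_path_eq (R : Run σ M Λ μ) (t : ℕ) (p : Path X A H) :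
    μ[Set.indicator {ω | R.path t ω = p} (fun _ => (1 : ℝ)) | R.info t] =ᵐ[μ]
      fun ω => M.pathProb (R.policy t ω) p := R.path_law t p

theorem measurableSet_path_eq (R : Run σ M Λ μ) (t : ℕ) (p : Path X A H) :
    MeasurableSet {ω | R.path t ω = p} := R.𝓕.le _ _ (R.measurable_path t p)

theorem integrable_path_eq (R : Run σ M Λ μ) (t : ℕ) (p : Path X A H) :
    Integrable (Set.indicator {ω | R.path t ω = p} (fun _ => (1 : ℝ))) μ :=
  (integrable_const 1).indicator (R.measurableSet_path_eq t p)

theorem sum_indicator_path_eq (R : Run σ M Λ μ) (t : ℕ) (D : Finset (Path X A H)) (ω : Ω) :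
    ∑ p ∈ D, Set.indicator {ω | R.path t ω = p} (fun _ => (1 : ℝ)) ω =
      Set.indicator {ω | R.path t ω ∈ D} (fun _ => (1 : ℝ)) ω := by
  classical
  simp only [Set.indicator_apply, Set.mem_ofPred_eq]
  rw [Finset.sum_ite_eq]

theorem condExp_path_mem_finset (R : Run σ M Λ μ) (t : ℕ) (D : Finset (Path X A H)) :
    μ[Set.indicator {ω | R.path t ω ∈ D} (fun _ => (1 : ℝ)) | R.info t] =ᵐ[μ]
      fun ω => ∑ p ∈ D, M.pathProb (R.policy t ω) p := by
  have h1 : Set.indicator {ω | R.path t ω ∈ D} (fun _ => (1 : ℝ)) =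
      ∑ p ∈ D, Set.indicator {ω | R.path t ω = p} (fun _ => (1 : ℝ)) := by
    funext ω
    rw [Finset.sum_apply, sum_indicator_path_eq]
  rw [h1]
  refine (condExp_finsetSum (fun p _ => R.integrable_path_eq t p) _).trans ?_
  have h2 : ∀ᵐ ω ∂μ, ∀ p ∈ D, (μ[Set.indicator {ω | R.path t ω = p} (fun _ => (1 : ℝ)) |
      R.info t]) ω = M.pathProb (R.policy t ω) p :=
    (ae_ball_iff (Finset.countable_toSet D)).2 fun p _ => R.condExp_path_eq t p
  filter_upwards [h2] with ω h2
  rw [Finset.sum_apply]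
  exact Finset.sum_congr rfl h2

theorem measurableSet_path_mem (R : Run σ M Λ μ) (t : ℕ) (s : Set (Path X A H)) :
    MeasurableSet[R.𝓕 (t + 1)] {ω | R.path t ω ∈ s} :=
  R.measurableSet_of_paths fun ω ω' h => by rw [h t (Nat.lt_succ_self t)]

theorem ae_path_mem (R : Run σ M Λ μ) : ∀ᵐ ω ∂μ, ∀ t, R.path t ω ∈ M.paths := by
  rw [ae_all_iff]
  intro t
  have hm : MeasurableSet {ω | R.path t ω ∈ M.paths} :=
    R.𝓕.le _ _ (R.measurableSet_path_mem t (M.paths : Set (Path X A H)))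
  have h1 : μ.real {ω | R.path t ω ∈ M.paths} = 1 := by
    rw [← integral_indicator_one hm]
    calc ∫ ω, Set.indicator {ω | R.path t ω ∈ M.paths} 1 ω ∂μ
        = ∫ ω, (μ[Set.indicator {ω | R.path t ω ∈ M.paths} (fun _ => (1 : ℝ)) | R.info t]) ω ∂μ :=
          (integral_condExp (R.info_le t)).symm
      _ = ∫ ω, (1 : ℝ) ∂μ := by
          refine integral_congr_ae ((R.condExp_path_mem_finset t M.paths).trans ?_)
          exact Filter.Eventually.of_forall fun ω => M.sum_pathProb _
      _ = 1 := by simp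
  have h2 : μ {ω | R.path t ω ∈ M.paths} = 1 := by
    rw [← ENNReal.ofReal_one, ← h1, ofReal_measureReal]
  exact (mem_ae_iff_prob_eq_one hm).2 h2

open Classical in
/-- The law of the path of episode `t` given the information before its first step. -/
theorem measure_inter_path_mem (R : Run σ M Λ μ) (t : ℕ) (s : Set (Path X A H)) {B : Set Ω}
    (hB : MeasurableSet[R.info t] B) :
    μ (B ∩ {ω | R.path t ω ∈ s}) =
      ∫⁻ ω in B, ENNReal.ofReal (∑ p ∈ M.paths with p ∈ s, M.pathProb (R.policy t ω) p) ∂μ := by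
  have h1 : μ (B ∩ {ω | R.path t ω ∈ s}) =
      μ (B ∩ {ω | R.path t ω ∈ M.paths.filter (· ∈ s)}) := by
    refine measure_congr ?_
    filter_upwards [R.ae_path_mem] with ω hω
    refine propext ?_
    change (ω ∈ B ∧ R.path t ω ∈ s) ↔ (ω ∈ B ∧ R.path t ω ∈ M.paths.filter (· ∈ s))
    rw [Finset.mem_filter]
    have := hω t
    tauto
  rw [h1]
  exact measure_inter_eq_lintegral_of_condExp (R.info_le t)
    (R.𝓕.le _ _ (R.measurableSet_path_mem t (M.paths.filter (· ∈ s) : Finset _)))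
    (fun ω => Finset.sum_nonneg fun p _ => M.pathProb_nonneg _ _)
    (R.condExp_path_mem_finset t _) hB

open Classical in
-- The target set depends on a variable `c` that is known before the path is drawn and takes
-- countably many values, for instance the core. On each event `c ω = i` the target is fixed, and
-- conditional expectations localize.
theorem condExp_path_mem (R : Run σ M Λ μ) (t : ℕ) {ι : Type} [Countable ι] {c : Ω → ι}
    (hc : ∀ i, MeasurableSet[R.info t] {ω | c ω = i}) (s : ι → Set (Path X A H)) :
    μ[Set.indicator {ω | R.path t ω ∈ s (c ω)} (fun _ => (1 : ℝ)) | R.info t] =ᵐ[μ]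
      fun ω => ∑ p ∈ M.paths with p ∈ s (c ω), M.pathProb (R.policy t ω) p := by
  have hmeas : ∀ i, MeasurableSet {ω | R.path t ω ∈ s i} := fun i =>
    R.𝓕.le _ _ (R.measurableSet_path_mem t (s i))
  have hset : {ω | R.path t ω ∈ s (c ω)} = ⋃ i, ({ω | c ω = i} ∩ {ω | R.path t ω ∈ s i}) := by
    ext ω; simp
  have hVm : MeasurableSet {ω | R.path t ω ∈ s (c ω)} := by
    rw [hset]
    exact MeasurableSet.iUnion fun i => (R.info_le t _ (hc i)).inter (hmeas i)
  have hint : ∀ V : Set Ω, MeasurableSet V → Integrable (V.indicator (fun _ => (1 : ℝ))) μ :=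
    fun V hV => (integrable_const 1).indicator hV
  have hone : ∀ i, μ[Set.indicator {ω | R.path t ω ∈ s i} (fun _ => (1 : ℝ)) | R.info t] =ᵐ[μ]
      fun ω => ∑ p ∈ M.paths with p ∈ s i, M.pathProb (R.policy t ω) p := by
    intro i
    refine Filter.EventuallyEq.trans (condExp_congr_ae ?_)
      (R.condExp_path_mem_finset t (M.paths.filter (· ∈ s i)))
    filter_upwards [R.ae_path_mem] with ω hω
    simp only [Set.indicator_apply, Set.mem_ofPred_eq, Finset.mem_filter, hω t, true_and]
  have hloc : ∀ i, ∀ᵐ ω ∂μ, c ω = i →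
      (μ[Set.indicator {ω | R.path t ω ∈ s (c ω)} (fun _ => (1 : ℝ)) | R.info t]) ω =
      (μ[Set.indicator {ω | R.path t ω ∈ s i} (fun _ => (1 : ℝ)) | R.info t]) ω := by
    intro i
    have h1 := condExp_indicator (hint _ hVm) (hc i)
    have h2 := condExp_indicator (hint _ (hmeas i)) (hc i)
    have h3 : Set.indicator {ω | c ω = i}
        (Set.indicator {ω | R.path t ω ∈ s (c ω)} (fun _ => (1 : ℝ))) =
        Set.indicator {ω | c ω = i} (Set.indicator {ω | R.path t ω ∈ s i} (fun _ => (1 : ℝ))) := by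
      funext ω
      simp only [Set.indicator_apply, Set.mem_ofPred_eq]
      by_cases h : c ω = i
      · simp [h]
      · simp [h]
    rw [h3] at h1
    filter_upwards [h1, h2] with ω h1 h2 hω
    have hω' : ω ∈ {ω | c ω = i} := hω
    rw [h1, Set.indicator_of_mem hω', Set.indicator_of_mem hω'] at h2
    exact h2
  filter_upwards [ae_all_iff.2 hone, ae_all_iff.2 hloc] with ω h1 h2
  rw [h2 (c ω) rfl, h1 (c ω)]

theorem measure_inter_visit_le (R : Run σ M Λ μ) {Pol : PolicySet X A H}
    (hpol : ∀ t ω, R.policy t ω ∈ Pol.policies M.states) {ε : ℝ} {h : Fin H} {x : X}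
    (hx : ∀ π ∈ Pol.policies M.states, M.occupancy π h x ≤ ε) (t : ℕ) {B : Set Ω}
    (hB : MeasurableSet[R.𝓕 t] B) :
    μ (B ∩ {ω | (R.path t ω h).1 = x}) ≤ ENNReal.ofReal ε * μ B := by
  have h1 := R.measure_inter_path_mem t {p | (p h).1 = x} (R.filtration_le_info t _ hB)
  calc μ (B ∩ {ω | (R.path t ω h).1 = x})
      = ∫⁻ ω in B, ENNReal.ofReal (M.occupancy (R.policy t ω) h x) ∂μ := h1
    _ ≤ ∫⁻ _ω in B, ENNReal.ofReal ε ∂μ :=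
        lintegral_mono fun ω => ENNReal.ofReal_le_ofReal (hx _ (hpol t ω))
    _ = ENNReal.ofReal ε * μ B := setLIntegral_const _ _

end Run

/-- Labels outside the layer are covered too: their occupancy is zero, which is where `0 ≤ ε`
enters. -/
theorem occupancy_le_of_not_mem_reachable {X A : Type} [Fintype A] {H : ℕ} [NeZero H]
    {M : LayeredMDP X A H} {Pol : PolicySet X A H} {ε : ℝ} (hε : 0 ≤ ε) {h : Fin H} {x : X}
    (hx : (⟨h, x⟩ : Σ _ : Fin H, X) ∉ M.reachable Pol ε) :
    ∀ π ∈ Pol.policies M.states, M.occupancy π h x ≤ ε := by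
  classical
  intro π hπ
  by_cases hs : x ∈ M.states h
  · by_contra hlt
    refine hx ?_
    rw [LayeredMDP.reachable, Finset.mem_filter]
    exact ⟨by simpa using hs, π, hπ, not_le.1 hlt⟩
  · refine le_trans (le_of_eq ?_) hε
    refine Finset.sum_eq_zero fun p hp => ?_
    rw [Finset.mem_filter] at hp
    exact absurd (hp.2 ▸ LayeredMDP.mem_paths.1 hp.1 h) hs

/-! ### Rare visits to states of small occupancy -/

namespace Run

open scoped ENNReal

variable {X A : Type} [Countable X] [Fintype A] {H : ℕ} [NeZero H] {σ : Setting}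
  {M : LayeredMDP X A H} {Λ : Learner X A H} {Ω : Type} [mΩ : MeasurableSpace Ω] {μ : Measure Ω}
  [IsProbabilityMeasure μ] [Nonempty A]

theorem ae_mem_reachable (R : Run σ M Λ μ) {Pol : PolicySet X A H}
    (hpol : ∀ t ω, R.policy t ω ∈ Pol.policies M.states) :
    ∀ᵐ ω ∂μ, ∀ t h, (⟨h, (R.path t ω h).1⟩ : Σ _ : Fin H, X) ∈ M.reachable Pol 0 := by
  have : ∀ᵐ ω ∂μ, ∀ t h x, (⟨h, x⟩ : Σ _ : Fin H, X) ∉ M.reachable Pol 0 →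
      (R.path t ω h).1 ≠ x := by
    simp only [ae_all_iff]
    intro t h x hx
    have h1 := R.measure_inter_visit_le hpol (occupancy_le_of_not_mem_reachable le_rfl hx) t
      (MeasurableSet.univ (α := Ω))
    rw [ENNReal.ofReal_zero, zero_mul, Set.univ_inter, nonpos_iff_eq_zero] at h1
    rw [ae_iff]
    simpa using h1
  filter_upwards [this] with ω hω t h
  exact by_contra fun hn => hω t h _ hn rfl

open Classical in
/-- The number of visits to the state `(h, x)` in the `n` episodes that start with episode `a`. -/
def visits (R : Run σ M Λ μ) (h : Fin H) (x : X) (a n : ℕ) (ω : Ω) : ℕ :=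
  ((Finset.range n).filter fun i => (R.path (a + i) ω h).1 = x).card

/-- A state that is never visited with probability more than `ε` is visited rarely after any
visit. -/
theorem measure_visits_ge_le (R : Run σ M Λ μ) {Pol : PolicySet X A H}
    (hpol : ∀ t ω, R.policy t ω ∈ Pol.policies M.states) {ε : ℝ} (hε : 0 ≤ ε) {h : Fin H} {x : X}
    (hx : ∀ π ∈ Pol.policies M.states, M.occupancy π h x ≤ ε) (t N : ℕ) {c : ℝ} (hc : 0 < c) :
    μ {ω | (R.path t ω h).1 = x ∧ ∃ n ≤ N,
        c ≤ Real.exp (R.visits h x (t + 1) n ω - 2 * ε * n)} ≤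
      ENNReal.ofReal c⁻¹ * μ {ω | (R.path t ω h).1 = x} := by
  classical
  set F : Set Ω := {ω | (R.path t ω h).1 = x} with hF
  -- A supermartingale that starts from the indicator of the visit in episode `t`. Its initial mean
  -- `μ F` survives in the bound and makes the later union over states free of charge.
  set Z : ℕ → Ω → ℝ≥0∞ := fun n => F.indicator fun ω =>
    ENNReal.ofReal (Real.exp (R.visits h x (t + 1) n ω - 2 * ε * n)) with hZ
  have hFm : MeasurableSet F :=
    R.𝓕.le _ _ (R.measurableSet_path_mem t {p | (p h).1 = x})
  have hZm : ∀ n, Measurable[R.𝓕 (t + 1 + n)] (Z n) := by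
    intro n
    refine R.measurable_of_paths fun ω ω' hωω' => ?_
    have h1 : (ω ∈ F) = (ω' ∈ F) := by
      change ((R.path t ω h).1 = x) = ((R.path t ω' h).1 = x)
      rw [hωω' t (by omega)]
    have h2 : R.visits h x (t + 1) n ω = R.visits h x (t + 1) n ω' := by
      unfold visits
      congr 1
      refine Finset.filter_congr fun i hi => ?_
      rw [hωω' (t + 1 + i) (by have := Finset.mem_range.1 hi; omega)]
    simp only [hZ, Set.indicator_apply, h1, h2]
  have hsup : ∀ n B, MeasurableSet[R.𝓕 (t + 1 + n)] B →
      ∫⁻ ω in B, Z (n + 1) ω ∂μ ≤ ∫⁻ ω in B, Z n ω ∂μ := by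
    intro n B hB
    set V : Set Ω := {ω | (R.path (t + 1 + n) ω h).1 = x} with hV
    have hVm : MeasurableSet V :=
      R.𝓕.le _ _ (R.measurableSet_path_mem (t + 1 + n) {p | (p h).1 = x})
    have hBm : MeasurableSet B := R.𝓕.le _ _ hB
    have hZm' : Measurable (Z n) := (hZm n).mono (R.𝓕.le _) le_rfl
    have hstep : ∀ ω, Z (n + 1) ω = ENNReal.ofReal (Real.exp (-(2 * ε))) *
        (Z n ω + ENNReal.ofReal (Real.exp 1 - 1) * V.indicator (Z n) ω) := by
      intro ω
      have hvis : R.visits h x (t + 1) (n + 1) ω =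
          R.visits h x (t + 1) n ω + if ω ∈ V then 1 else 0 := by
        unfold visits
        rw [Finset.range_add_one, Finset.filter_insert]
        by_cases hω : (R.path (t + 1 + n) ω h).1 = x
        · rw [if_pos hω, if_pos (show ω ∈ V from hω), Finset.card_insert_of_notMem (by simp)]
        · rw [if_neg hω, if_neg (show ω ∉ V from hω), add_zero]
      by_cases hωF : ω ∈ F
      · simp only [hZ, Set.indicator_of_mem hωF, hvis]
        by_cases hωV : ω ∈ V
        · rw [Set.indicator_of_mem hωV, Set.indicator_of_mem hωF, if_pos hωV,
            ← ENNReal.ofReal_mul (by linarith [Real.add_one_le_exp (1 : ℝ)]),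
            ← ENNReal.ofReal_add (Real.exp_pos _).le (mul_nonneg
              (by linarith [Real.add_one_le_exp (1 : ℝ)]) (Real.exp_pos _).le),
            ← ENNReal.ofReal_mul (Real.exp_pos _).le]
          congr 1
          have : ((R.visits h x (t + 1) n ω + 1 : ℕ) : ℝ) - 2 * ε * ((n + 1 : ℕ) : ℝ) =
              -(2 * ε) + (1 + ((R.visits h x (t + 1) n ω : ℝ) - 2 * ε * n)) := by
            push_cast; ring
          rw [this, Real.exp_add, Real.exp_add]
          ring
        · rw [Set.indicator_of_notMem hωV, if_neg hωV, mul_zero, add_zero, add_zero,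
            ← ENNReal.ofReal_mul (Real.exp_pos _).le, ← Real.exp_add]
          congr 2
          push_cast; ring
      · simp [hZ, Set.indicator_of_notMem hωF, Set.indicator_apply]
    have hvis_le := setLIntegral_inter_le (μ := μ) (R.𝓕.le (t + 1 + n)) (V := V)
      (fun B hB => R.measure_inter_visit_le hpol hx (t + 1 + n) hB) (hZm n) hB
    -- A visit multiplies the exponential by e and has conditional probability at most `ε`, so the
    -- mean grows at most by 1 + (e − 1)ε ≤ exp(2ε), as e − 1 ≤ 2.
    have hconst : ENNReal.ofReal (Real.exp (-(2 * ε))) *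
        (1 + ENNReal.ofReal (Real.exp 1 - 1) * ENNReal.ofReal ε) ≤ 1 := by
      have he : 0 ≤ Real.exp 1 - 1 := by linarith [Real.add_one_le_exp (1 : ℝ)]
      rw [← ENNReal.ofReal_one, ← ENNReal.ofReal_mul he,
        ← ENNReal.ofReal_add zero_le_one (mul_nonneg he hε),
        ← ENNReal.ofReal_mul (Real.exp_pos _).le]
      refine ENNReal.ofReal_le_ofReal ?_
      have he2 : Real.exp 1 - 1 ≤ 2 := by linarith [Real.exp_one_lt_d9]
      calc Real.exp (-(2 * ε)) * (1 + (Real.exp 1 - 1) * ε)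
          ≤ Real.exp (-(2 * ε)) * Real.exp (2 * ε) := by
            gcongr
            nlinarith [Real.add_one_le_exp (2 * ε)]
        _ = 1 := by rw [← Real.exp_add]; simp
    simp_rw [hstep]
    have hm1 : Measurable fun ω => Z n ω + ENNReal.ofReal (Real.exp 1 - 1) * V.indicator (Z n) ω :=
      hZm'.add ((hZm'.indicator hVm).const_mul _)
    rw [lintegral_const_mul _ hm1,
      lintegral_add_left hZm', lintegral_const_mul _ (hZm'.indicator hVm),
      lintegral_indicator hVm, Measure.restrict_restrict hVm, Set.inter_comm V B]
    calc _ ≤ ENNReal.ofReal (Real.exp (-(2 * ε))) * (∫⁻ ω in B, Z n ω ∂μ +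
          ENNReal.ofReal (Real.exp 1 - 1) * (ENNReal.ofReal ε * ∫⁻ ω in B, Z n ω ∂μ)) := by gcongr
      _ = (ENNReal.ofReal (Real.exp (-(2 * ε))) *
        (1 + ENNReal.ofReal (Real.exp 1 - 1) * ENNReal.ofReal ε)) * ∫⁻ ω in B, Z n ω ∂μ := by ring
      _ ≤ 1 * ∫⁻ ω in B, Z n ω ∂μ := by gcongr
      _ = _ := one_mul _
  have hville := maximal_ineq_of_supermartingale (μ := μ) (fun n => R.𝓕.le (t + 1 + n))
    (fun a b hab => R.𝓕.mono (by omega)) hZm hsup (ENNReal.ofReal c) N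
  have hZ0 : ∫⁻ ω, Z 0 ω ∂μ = μ F := by
    rw [hZ, lintegral_indicator hFm]
    simp [visits]
  rw [hZ0] at hville
  have hsub : {ω | (R.path t ω h).1 = x ∧ ∃ n ≤ N,
      c ≤ Real.exp (R.visits h x (t + 1) n ω - 2 * ε * n)} ⊆
      {ω | ∃ n ≤ N, ENNReal.ofReal c ≤ Z n ω} := by
    rintro ω ⟨hωF, n, hn, hle⟩
    refine ⟨n, hn, ?_⟩
    simp only [hZ]
    rw [Set.indicator_of_mem (show ω ∈ F from hωF)]
    exact ENNReal.ofReal_le_ofReal hle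
  refine (measure_mono hsub).trans ?_
  rw [ENNReal.ofReal_inv_of_pos hc, ← ENNReal.div_eq_inv_mul,
    ENNReal.le_div_iff_mul_le (Or.inl (by simpa using hc)) (Or.inl ENNReal.ofReal_ne_top),
    mul_comm]
  exact hville

end Run

/-! ### The identified states along a run -/

theorem sum_inv_sq_le_two (n : ℕ) : ∑ i ∈ Finset.range n, 1 / ((i : ℝ) + 1) ^ 2 ≤ 2 := by
  have key : ∀ n : ℕ, ∑ i ∈ Finset.range (n + 1), 1 / ((i : ℝ) + 1) ^ 2 ≤ 2 - 1 / ((n : ℝ) + 1) := by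
    intro n
    induction n with
    | zero => norm_num
    | succ n ih =>
      rw [Finset.sum_range_succ]
      have hn : (0 : ℝ) ≤ n := Nat.cast_nonneg n
      have h1 : 1 / (((n + 1 : ℕ) : ℝ) + 1) ^ 2 ≤ 1 / ((n : ℝ) + 1) - 1 / (((n + 1 : ℕ) : ℝ) + 1) := by
        push_cast
        rw [div_sub_div _ _ (by positivity) (by positivity),
          div_le_div_iff₀ (by positivity) (by positivity)]
        nlinarith
      linarith
  cases n with
  | zero => simp
  | succ n =>
    have : (0 : ℝ) ≤ 1 / ((n : ℝ) + 1) := by positivity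
    linarith [key n]

namespace Run

open scoped ENNReal

variable {A : Type} [Fintype A] {H : ℕ} [NeZero H] {σ : Setting}
  {M : LayeredMDP ℕ A H} {Λ : Learner ℕ A H} {Ω : Type} [mΩ : MeasurableSpace Ω] {μ : Measure Ω}

/-- What the learner sees of episode `t`. -/
def episode (R : Run σ M Λ μ) (ω : Ω) (t : ℕ) : Seed × Feedback ℕ A H := (R.seed t ω, R.feedback t ω)

/-- The states that SF-RL has identified before episode `t`. -/
def core (R : Run σ M Λ μ) (abot : A) (δ ε : ℝ) (t : ℕ) (ω : Ω) : Fin H → Finset ℕ :=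
  (memSeq abot δ ε (R.episode ω) t).core

variable {abot : A} {δ ε : ℝ} [IsProbabilityMeasure μ]

theorem core_congr (R : Run σ M Λ μ) {t : ℕ} {ω ω' : Ω}
    (h : ∀ i < t, R.path i ω = R.path i ω') :
    R.core abot δ ε t ω = R.core abot δ ε t ω' :=
  memSeq_core_congr abot δ ε h

theorem measurableSet_core_eq (R : Run σ M Λ μ) (t : ℕ) (S : Fin H → Finset ℕ) :
    MeasurableSet[R.𝓕 t] {ω | R.core abot δ ε t ω = S} :=
  R.measurableSet_of_paths fun ω ω' h => by rw [R.core_congr h]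

theorem core_mono (R : Run σ M Λ μ) (ω : Ω) : Monotone fun t => R.core abot δ ε t ω :=
  memSeq_core_mono abot δ ε (R.episode ω)

/-- The first visit of an identified state is followed by many visits. -/
theorem exists_visits_of_mem_core (R : Run σ M Λ μ) (hδ : 0 < δ) (hε : 0 ≤ ε) {T : ℕ} {ω : Ω}
    {h : Fin H} {x : ℕ} (hx : x ∈ R.core abot δ ε T ω h) :
    ∃ t < T, (R.path t ω h).1 = x ∧ ∃ n ≤ T,
      2 * (H : ℝ) ^ 2 * ((t : ℝ) + 1) ^ 2 / δ ≤
        Real.exp (R.visits h x (t + 1) n ω - 2 * ε * n) := by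
  have hH : (1 : ℝ) ≤ H := by exact_mod_cast NeZero.one_le (n := H)
  classical
  have hex : ∃ t, x ∈ R.core abot δ ε t ω h := ⟨T, hx⟩
  have hle : Nat.find hex ≤ T := Nat.find_min' hex hx
  obtain ⟨s, hs⟩ : ∃ s, Nat.find hex = s + 1 := by
    refine Nat.exists_eq_succ_of_ne_zero fun h0 => ?_
    have := Nat.find_spec hex
    rw [h0] at this
    simp [core, memSeq, Memory.start] at this
  have hin : x ∈ R.core abot δ ε (s + 1) ω h := hs ▸ Nat.find_spec hex
  have hout : x ∉ R.core abot δ ε s ω h := Nat.find_min hex (by omega)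
  obtain ⟨hpos, hid⟩ := identified_of_mem_core abot δ ε (R.episode ω) hout hin
  rw [memSeq_count] at hpos hid
  change 0 < ((Finset.range (s + 1)).filter fun i => (R.path i ω h).1 = x).card at hpos
  change Identified H δ ε (s + 1)
    ((Finset.range (s + 1)).filter fun i => (R.path i ω h).1 = x).card at hid
  set F := (Finset.range (s + 1)).filter fun i => (R.path i ω h).1 = x with hF
  have hne : F.Nonempty := Finset.card_pos.1 hpos
  -- The first visit is not counted among the visits after `t`; the term −1/2 of the test
  -- compensates for it. Doubling the test gives count − 1 > 2ε(s + 1) + log, and both terms on the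
  -- right only decrease when `s + 1` is replaced by `s - t` and `t + 1` respectively.
  set t := F.min' hne with ht
  have htF : t ∈ F := Finset.min'_mem _ _
  rw [hF, Finset.mem_filter, Finset.mem_range] at htF
  refine ⟨t, by omega, htF.2, s - t, by omega, ?_⟩
  have hcard : F.card ≤ R.visits h x (t + 1) (s - t) ω + 1 := by
    have hsub : F ⊆ insert t (((Finset.range (s - t)).filter
        fun i => (R.path (t + 1 + i) ω h).1 = x).image fun i => t + 1 + i) := by
      intro i hi
      have hmin : t ≤ i := Finset.min'_le _ _ hi
      rw [hF, Finset.mem_filter, Finset.mem_range] at hi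
      rw [Finset.mem_insert, Finset.mem_image]
      rcases hmin.eq_or_lt with h | h
      · exact Or.inl h.symm
      · refine Or.inr ⟨i - (t + 1), ?_, by omega⟩
        rw [Finset.mem_filter, Finset.mem_range]
        refine ⟨by omega, ?_⟩
        rw [show t + 1 + (i - (t + 1)) = i by omega]
        exact hi.2
    calc F.card ≤ _ := Finset.card_le_card hsub
      _ ≤ _ := Finset.card_insert_le _ _
      _ ≤ R.visits h x (t + 1) (s - t) ω + 1 := by
        refine Nat.add_le_add_right (Finset.card_image_le.trans (le_of_eq ?_)) 1
        unfold visits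
        congr
  have hcard' : (F.card : ℝ) ≤ R.visits h x (t + 1) (s - t) ω + 1 := by exact_mod_cast hcard
  rw [← Real.log_le_iff_le_exp (by positivity)]
  unfold Identified at hid
  have hts : (t : ℝ) + 1 ≤ ((s + 1 : ℕ) : ℝ) := by exact_mod_cast (by omega : t + 1 ≤ s + 1)
  have hlog : Real.log (2 * (H : ℝ) ^ 2 * ((t : ℝ) + 1) ^ 2 / δ) ≤
      Real.log (2 * (H : ℝ) ^ 2 * ((s + 1 : ℕ) : ℝ) ^ 2 / δ) := by
    refine Real.log_le_log (by positivity) ?_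
    gcongr
  have hn : ε * ((s - t : ℕ) : ℝ) ≤ ε * ((s + 1 : ℕ) : ℝ) :=
    mul_le_mul_of_nonneg_left (by exact_mod_cast (by omega : s - t ≤ s + 1)) hε
  linarith

/-- With high probability, SF-RL identifies only states that some policy reaches with probability
more than `ε`. -/
theorem measure_core_not_subset_le (R : Run σ M Λ μ) [Nonempty A] {Pol : PolicySet ℕ A H}
    (hpol : ∀ t ω, R.policy t ω ∈ Pol.policies M.states) (hδ : 0 < δ) (hε : 0 ≤ ε) (T : ℕ) :
    μ {ω | ∃ h x, x ∈ R.core abot δ ε T ω h ∧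
      (⟨h, x⟩ : Σ _ : Fin H, ℕ) ∉ M.reachable Pol ε} ≤ ENNReal.ofReal δ := by
  classical
  have hH : (1 : ℝ) ≤ H := by exact_mod_cast NeZero.one_le (n := H)
  set c : ℕ → ℝ := fun t => 2 * (H : ℝ) ^ 2 * ((t : ℝ) + 1) ^ 2 / δ with hc
  have hcpos : ∀ t, 0 < c t := fun t => by simp only [hc]; positivity
  set E : ℕ → Fin H → ℕ → Set Ω := fun t h x =>
    if (⟨h, x⟩ : Σ _ : Fin H, ℕ) ∈ M.reachable Pol ε then ∅ else
    {ω | (R.path t ω h).1 = x ∧ ∃ n ≤ T,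
      c t ≤ Real.exp (R.visits h x (t + 1) n ω - 2 * ε * n)} with hE
  have hsub : {ω | ∃ h x, x ∈ R.core abot δ ε T ω h ∧
      (⟨h, x⟩ : Σ _ : Fin H, ℕ) ∉ M.reachable Pol ε} ⊆
      ⋃ t ∈ Finset.range T, ⋃ h ∈ (Finset.univ : Finset (Fin H)), ⋃ x, E t h x := by
    rintro ω ⟨h, x, hx, hr⟩
    obtain ⟨t, ht, hv⟩ := R.exists_visits_of_mem_core hδ hε hx
    simp only [Set.mem_iUnion, Finset.mem_range, Finset.mem_univ, exists_prop, true_and]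
    refine ⟨t, ht, h, x, ?_⟩
    simp only [hE]
    rw [if_neg hr]
    exact hv
  -- The union over the states of a layer costs nothing: the events that episode `t` visits `x` at
  -- step `h` are disjoint in `x`, so their probabilities add up to at most one.
  have hEle : ∀ t h, μ (⋃ x, E t h x) ≤ ENNReal.ofReal (c t)⁻¹ := by
    intro t h
    calc μ (⋃ x, E t h x) ≤ ∑' x, μ (E t h x) := measure_iUnion_le _
      _ ≤ ∑' x, ENNReal.ofReal (c t)⁻¹ * μ {ω | (R.path t ω h).1 = x} := by
          refine ENNReal.tsum_le_tsum fun x => ?_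
          simp only [hE]
          split_ifs with hr
          · simp
          · exact R.measure_visits_ge_le hpol hε (occupancy_le_of_not_mem_reachable hε hr) t T
              (hcpos t)
      _ = ENNReal.ofReal (c t)⁻¹ * μ (⋃ x, {ω | (R.path t ω h).1 = x}) := by
          rw [ENNReal.tsum_mul_left, measure_iUnion]
          · intro x y hxy
            refine Set.disjoint_left.2 fun ω h1 h2 => hxy ?_
            exact (show (R.path t ω h).1 = x from h1).symm.trans h2
          · exact fun x => R.𝓕.le _ _ (R.measurableSet_path_mem t {p | (p h).1 = x})
      _ ≤ ENNReal.ofReal (c t)⁻¹ * 1 := by gcongr; exact prob_le_one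
      _ = _ := mul_one _
  calc _ ≤ μ (⋃ t ∈ Finset.range T, ⋃ h ∈ (Finset.univ : Finset (Fin H)), ⋃ x, E t h x) :=
        measure_mono hsub
    _ ≤ ∑ t ∈ Finset.range T, μ (⋃ h ∈ (Finset.univ : Finset (Fin H)), ⋃ x, E t h x) :=
        measure_biUnion_finset_le _ _
    _ ≤ ∑ t ∈ Finset.range T, ∑ h : Fin H, ENNReal.ofReal (c t)⁻¹ :=
        Finset.sum_le_sum fun t _ => (measure_biUnion_finset_le _ _).trans
          (Finset.sum_le_sum fun h _ => hEle t h)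
    _ = ENNReal.ofReal (∑ t ∈ Finset.range T, ∑ h : Fin H, (c t)⁻¹) := by
        rw [ENNReal.ofReal_sum_of_nonneg
          fun t _ => Finset.sum_nonneg fun h _ => (inv_pos.2 (hcpos t)).le]
        refine Finset.sum_congr rfl fun t _ => ?_
        rw [ENNReal.ofReal_sum_of_nonneg fun h _ => (inv_pos.2 (hcpos t)).le]
    _ ≤ ENNReal.ofReal δ := by
        refine ENNReal.ofReal_le_ofReal ?_
        -- The sum over the layers is absorbed by `H ^ 2` in `c t`, and the inverse squares sum to
        -- at most two.
        have h1 : ∀ t ∈ Finset.range T, ∑ _h : Fin H, (c t)⁻¹ ≤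
            δ / 2 * (1 / ((t : ℝ) + 1) ^ 2) := by
          intro t _
          rw [Finset.sum_const, Finset.card_univ, Fintype.card_fin, nsmul_eq_mul]
          simp only [hc]
          rw [inv_div, mul_div_assoc', div_mul_div_comm, mul_one,
            div_le_div_iff₀ (by positivity) (by positivity)]
          have h2 : (H : ℝ) ≤ (H : ℝ) ^ 2 := by nlinarith
          have h3 : 0 ≤ δ * ((t : ℝ) + 1) ^ 2 := by positivity
          nlinarith
        calc _ ≤ ∑ t ∈ Finset.range T, δ / 2 * (1 / ((t : ℝ) + 1) ^ 2) := Finset.sum_le_sum h1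
          _ = δ / 2 * ∑ t ∈ Finset.range T, 1 / ((t : ℝ) + 1) ^ 2 := by rw [Finset.mul_sum]
          _ ≤ δ / 2 * 2 := mul_le_mul_of_nonneg_left (sum_inv_sq_le_two T) (by positivity)
          _ = δ := by ring

/-- The event that episode `t` leaves the states identified before it. -/
def leaves (R : Run σ M Λ μ) (abot : A) (δ ε : ℝ) (t : ℕ) : Set Ω :=
  {ω | ∃ h, (R.path t ω h).1 ∉ R.core abot δ ε t ω h}

theorem measurableSet_leaves (R : Run σ M Λ μ) (t : ℕ) :
    MeasurableSet[R.𝓕 (t + 1)] (R.leaves abot δ ε t) :=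
  R.measurableSet_of_paths fun ω ω' h => by
    rw [R.core_congr fun i hi => h i (by omega), h t (Nat.lt_succ_self t)]

/-- With high probability, the sum of the probabilities of leaving the identified states is
controlled by the number of times this happens. -/
theorem measure_sum_leaveProb_gt_le (R : Run σ M Λ μ) [Nonempty A] {δ' : ℝ} (hδ' : 0 < δ') (T : ℕ) :
    μ {ω | 2 * ∑ t ∈ Finset.range T, (R.leaves abot δ ε t).indicator (fun _ => (1 : ℝ)) ω +
        2 * Real.log (1 / δ') <
      ∑ t ∈ Finset.range T, leaveProb M (R.core abot δ ε t ω) (R.policy t ω)} ≤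
      ENNReal.ofReal δ' := by
  classical
  have hlaw : ∀ t, μ[(R.leaves abot δ ε t).indicator (fun _ => (1 : ℝ)) | R.info t] =ᵐ[μ]
      fun ω => leaveProb M (R.core abot δ ε t ω) (R.policy t ω) := by
    intro t
    have h := R.condExp_path_mem t (c := R.core abot δ ε t)
      (fun S => R.filtration_le_info t _ (R.measurableSet_core_eq t S))
      (fun S => {p | ∃ h, (p h).1 ∉ S h})
    refine h.trans (Filter.Eventually.of_forall fun ω => ?_)
    simp only [leaveProb, Set.mem_ofPred_eq]
  have hbd : ∀ t ω, leaveProb M (R.core abot δ ε t ω) (R.policy t ω) ∈ Set.Icc (0 : ℝ) 1 := by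
    intro t ω
    refine ⟨Finset.sum_nonneg fun p _ => M.pathProb_nonneg _ _, ?_⟩
    rw [← M.sum_pathProb (R.policy t ω)]
    exact Finset.sum_le_sum_of_subset_of_nonneg (Finset.filter_subset _ _)
      fun p _ _ => M.pathProb_nonneg _ _
  -- No measurability of the learner is at hand here, so `leaveProb` is replaced by the conditional
  -- expectation, truncated so that it lies in [0, 1] everywhere. The two agree almost surely.
  set P : ℕ → Ω → ℝ := fun t ω => max 0 (min 1
    ((μ[(R.leaves abot δ ε t).indicator (fun _ => (1 : ℝ)) | R.info t]) ω)) with hP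
  have hPeq : ∀ t, P t =ᵐ[μ] fun ω => leaveProb M (R.core abot δ ε t ω) (R.policy t ω) := by
    intro t
    filter_upwards [hlaw t] with ω hω
    simp only [hP]
    rw [hω, min_eq_right (hbd t ω).2, max_eq_right (hbd t ω).1]
  have hmain := measure_lt_sum_condProb_le (μ := μ) R.𝓕 R.filtration_le_info R.info_le_filtration
    (fun t => R.measurableSet_leaves (abot := abot) (δ := δ) (ε := ε) t) (P := P)
    (fun t => (((continuous_const.max (continuous_const.min continuous_id)) : Continuous
      fun x : ℝ => max 0 (min 1 x)).comp_stronglyMeasurable stronglyMeasurable_condExp))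
    (fun t ω => ⟨le_max_left _ _, max_le zero_le_one (min_le_left _ _)⟩)
    (fun t => (hlaw t).trans (hPeq t).symm) hδ' T
  refine le_trans (le_of_eq (measure_congr ?_)) hmain
  filter_upwards [ae_all_iff.2 hPeq] with ω hω
  refine propext ?_
  change _ < _ ↔ _ < _
  rw [Finset.sum_congr rfl fun t _ => hω t]

/-- The identified states are left rarely. -/
theorem ae_sum_leaves_le (R : Run σ M Λ μ) [Nonempty A] {Pol : PolicySet ℕ A H}
    (hpol : ∀ t ω, R.policy t ω ∈ Pol.policies M.states) (hδ : 0 < δ) (hε : 0 ≤ ε) {T : ℕ} {B : ℝ}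
    (hB : 2 * ε * T + Real.log (2 * (H : ℝ) ^ 2 * (T : ℝ) ^ 2 / δ) + 1 ≤ B) (hB0 : 0 ≤ B) :
    ∀ᵐ ω ∂μ, ∑ t ∈ Finset.range T, (R.leaves abot δ ε t).indicator (fun _ => (1 : ℝ)) ω ≤
      (M.reachable Pol 0).card * (B + 1) := by
  classical
  filter_upwards [R.ae_mem_reachable hpol] with ω hω
  calc ∑ t ∈ Finset.range T, (R.leaves abot δ ε t).indicator (fun _ => (1 : ℝ)) ω
      ≤ ∑ t ∈ Finset.range T, ∑ s ∈ M.reachable Pol 0,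
          if (R.path t ω s.1).1 = s.2 ∧ s.2 ∉ R.core abot δ ε t ω s.1 then (1 : ℝ) else 0 := by
        -- Each exit is charged to a state outside the core that the episode visits; almost surely
        -- it is among the reachable ones.
        refine Finset.sum_le_sum fun t _ => ?_
        by_cases hl : ω ∈ R.leaves abot δ ε t
        · rw [Set.indicator_of_mem hl]
          obtain ⟨h, hh⟩ := hl
          have h1 := Finset.single_le_sum (f := fun s : Σ _ : Fin H, ℕ =>
            if (R.path t ω s.1).1 = s.2 ∧ s.2 ∉ R.core abot δ ε t ω s.1 then (1 : ℝ) else 0)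
            (fun s _ => by split_ifs <;> norm_num) (hω t h)
          simpa [hh] using h1
        · rw [Set.indicator_of_notMem hl]
          exact Finset.sum_nonneg fun s _ => by split_ifs <;> norm_num
    _ = ∑ s ∈ M.reachable Pol 0, (((Finset.range T).filter fun t =>
          (R.path t ω s.1).1 = s.2 ∧ s.2 ∉ R.core abot δ ε t ω s.1).card : ℝ) := by
        rw [Finset.sum_comm]
        refine Finset.sum_congr rfl fun s _ => ?_
        rw [Finset.sum_ite, Finset.sum_const_zero, add_zero, Finset.sum_const, nsmul_eq_mul, mul_one]
    _ ≤ ∑ _s ∈ M.reachable Pol 0, (B + 1) := by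
        refine Finset.sum_le_sum fun s _ => ?_
        have := card_visits_not_mem_core_le (abot := abot) (e := R.episode ω)
          (NeZero.one_le (n := H)) hδ hε hB hB0 s.1 s.2
        refine le_trans (le_of_eq ?_) this
        congr 2
    _ = _ := by rw [Finset.sum_const, nsmul_eq_mul]

end Run

/-! ### Tools for extending a probability space -/

section Extension

open scoped ENNReal

theorem indep_prod {Ω Υ : Type} {m₁ m₂ : MeasurableSpace Ω} {n₁ n₂ : MeasurableSpace Υ}
    {mΩ : MeasurableSpace Ω} {mΥ : MeasurableSpace Υ} {μ : Measure Ω} {ν : Measure Υ}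
    [IsProbabilityMeasure μ] [IsProbabilityMeasure ν] (hm₁ : m₁ ≤ mΩ) (hm₂ : m₂ ≤ mΩ)
    (hn₁ : n₁ ≤ mΥ) (hn₂ : n₂ ≤ mΥ) (hm : Indep m₁ m₂ μ) (hn : Indep n₁ n₂ ν) :
    Indep (m₁.prod n₁) (m₂.prod n₂) (μ.prod ν) := by
  have hle : ∀ {m : MeasurableSpace Ω} {n : MeasurableSpace Υ}, m ≤ mΩ → n ≤ mΥ →
      m.prod n ≤ mΩ.prod mΥ := fun h1 h2 =>
    sup_le_sup (MeasurableSpace.comap_mono h1) (MeasurableSpace.comap_mono h2)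
  refine IndepSets.indep (hle hm₁ hn₁) (hle hm₂ hn₂) (@isPiSystem_prod _ _ m₁ n₁)
    (@isPiSystem_prod _ _ m₂ n₂) (@generateFrom_prod _ _ m₁ n₁).symm
    (@generateFrom_prod _ _ m₂ n₂).symm ?_
  rw [IndepSets_iff]
  rintro _ _ ⟨A₁, hA₁, C₁, hC₁, rfl⟩ ⟨A₂, hA₂, C₂, hC₂, rfl⟩
  rw [Set.prod_inter_prod, Measure.prod_prod, Measure.prod_prod, Measure.prod_prod,
    (Indep_iff _ _ _).1 hm A₁ A₂ hA₁ hA₂, (Indep_iff _ _ _).1 hn C₁ C₂ hC₁ hC₂]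
  ring

/-- Together with `indep_cond`: conditioning on the start of an epoch, an event of the past, neither
changes the law of what is independent of the past nor destroys that independence. -/
theorem cond_apply_of_indep {Ω : Type} {m₁ m₂ mΩ : MeasurableSpace Ω} {μ : Measure Ω}
    [IsProbabilityMeasure μ] (hm₂ : m₂ ≤ mΩ) (h : Indep m₁ m₂ μ)
    {E : Set Ω} (hE : MeasurableSet[m₂] E) (hE0 : μ E ≠ 0) {B : Set Ω} (hB : MeasurableSet[m₁] B) :
    μ[|E] B = μ B := by
  rw [cond_apply (hm₂ _ hE), Set.inter_comm, (Indep_iff _ _ _).1 h B E hB hE, mul_comm (μ B),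
    ← mul_assoc, ENNReal.inv_mul_cancel hE0 (measure_ne_top _ _), one_mul]

theorem indep_cond {Ω : Type} {m₁ m₂ mΩ : MeasurableSpace Ω} {μ : Measure Ω}
    [IsProbabilityMeasure μ] (hm₂ : m₂ ≤ mΩ)
    (h : Indep m₁ m₂ μ) {E : Set Ω} (hE : MeasurableSet[m₂] E) (hE0 : μ E ≠ 0) :
    Indep m₁ m₂ μ[|E] := by
  rw [Indep_iff]
  intro B C hB hC
  rw [cond_apply_of_indep hm₂ h hE hE0 hB, cond_apply (hm₂ _ hE), cond_apply (hm₂ _ hE),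
    Set.inter_left_comm, (Indep_iff _ _ _).1 h B (E ∩ C) hB (hE.inter hC)]
  ring

/-- Integrating out a uniform variable that is independent of `Y`. -/
theorem measure_preimage_inter_of_indepFun {Ω Ω₀ β : Type} [MeasurableSpace Ω] [MeasurableSpace Ω₀]
    [MeasurableSpace β] {μ : Measure Ω} [IsProbabilityMeasure μ] {Y : Ω → Ω₀} (hY : Measurable Y)
    {U : Ω → Seed} (hU : Measurable U) (hUmap : μ.map U = volume) (hind : IndepFun Y U μ)
    {g : Ω₀ → β} (hg : Measurable g) {D : Set (β × Seed)} (hD : MeasurableSet D) {B : Set Ω₀}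
    (hB : MeasurableSet B) :
    μ (Y ⁻¹' B ∩ {ω | (g (Y ω), U ω) ∈ D}) =
      ∫⁻ ω in Y ⁻¹' B, volume {u | (g (Y ω), u) ∈ D} ∂μ := by
  have hmap := (indepFun_iff_map_prod_eq_prod_map_map hY.aemeasurable hU.aemeasurable).1 hind
  rw [hUmap] at hmap
  have := Measure.isProbabilityMeasure_map (μ := μ) hY.aemeasurable
  set D' : Set (Ω₀ × Seed) := (Prod.fst ⁻¹' B) ∩ (fun z => (g z.1, z.2)) ⁻¹' D with hD'
  have hD'm : MeasurableSet D' :=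
    (measurable_fst hB).inter (((hg.comp measurable_fst).prodMk measurable_snd) hD)
  have hsec : Measurable fun y => volume {u : Seed | (g y, u) ∈ D} :=
    (measurable_measure_prodMk_left hD).comp hg
  have h2 : ∀ y, volume ((Prod.mk y) ⁻¹' D') =
      B.indicator (fun y => volume {u : Seed | (g y, u) ∈ D}) y := by
    intro y
    by_cases hy : y ∈ B
    · rw [Set.indicator_of_mem hy]
      congr 1
      ext u
      simp [hD', hy]
    · rw [Set.indicator_of_notMem hy]
      have : (Prod.mk y) ⁻¹' D' = ∅ := by
        ext u
        simp [hD', hy]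
      rw [this, measure_empty]
  have h1 : μ (Y ⁻¹' B ∩ {ω | (g (Y ω), U ω) ∈ D}) = μ.map (fun ω => (Y ω, U ω)) D' := by
    rw [Measure.map_apply (hY.prodMk hU) hD'm]
    rfl
  rw [h1, hmap, Measure.prod_apply hD'm]
  simp_rw [h2]
  rw [lintegral_indicator hB, setLIntegral_map hB hsec hY]

/-- Integrating out a uniform variable that is independent of `m`. -/
theorem measure_inter_preimage_of_indep {Ω β : Type} {m mΩ : MeasurableSpace Ω} {μ : Measure Ω}
    [IsProbabilityMeasure μ] [MeasurableSpace β] (hm : m ≤ mΩ)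
    {U : Ω → Seed} (hU : Measurable U) (hUmap : μ.map U = volume)
    (hind : Indep m (MeasurableSpace.comap U inferInstance) μ) {g : Ω → β} (hg : Measurable[m] g)
    {D : Set (β × Seed)} (hD : MeasurableSet D) {B : Set Ω} (hB : MeasurableSet[m] B) :
    μ (B ∩ {ω | (g ω, U ω) ∈ D}) = ∫⁻ ω in B, volume {u | (g ω, u) ∈ D} ∂μ :=
  -- The variable `Y` is the identity, with target Ω equipped with the smaller σ-algebra `m`.
  @measure_preimage_inter_of_indepFun Ω Ω β mΩ m _ μ _ id hm U hU hUmap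
    ((@IndepFun_iff_Indep Ω Ω Seed mΩ m _ id U μ).2 (by rwa [MeasurableSpace.comap_id])) g hg D hD
    B hB

end Extension

/-! ### Sampling of paths and measurability of policies -/

section Sampling

variable {X A : Type} [Countable X] [Fintype A] {H : ℕ} [NeZero H]

theorem measurable_pathProb (M : LayeredMDP X A H) (p : Path X A H) :
    Measurable fun π : Policy X A H => M.pathProb π p := by
  unfold LayeredMDP.pathProb
  refine Measurable.mul_const (Measurable.const_mul ?_ _) _
  refine Finset.measurable_fun_prod _ fun h _ => ?_
  have h1 : Measurable fun π : Policy X A H => ((π h (p h).1).1 : A → ℝ) :=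
    measurable_subtype_coe.comp ((measurable_pi_apply _).comp (measurable_pi_apply h))
  exact (measurable_pi_apply _).comp h1

/-- Paths can be sampled from a uniform seed, measurably in the policy. -/
theorem exists_path_sampler (M : LayeredMDP X A H) [Nonempty A] :
    ∃ f : Policy X A H → Seed → Path X A H,
      (∀ p, MeasurableSet {z : Policy X A H × Seed | f z.1 z.2 = p}) ∧
      ∀ π p, volume {u | f π u = p} = ENNReal.ofReal (M.pathProb π p) := by
  classical
  let _ : MeasurableSpace (Path X A H) := ⊤
  have : DiscreteMeasurableSpace (Path X A H) := ⟨fun _ => trivial⟩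
  have : Nonempty (Path X A H) := ⟨M.exists_mem_paths.choose⟩
  have hmeas : Measurable fun π : Policy X A H =>
      ∑ p ∈ M.paths, ENNReal.ofReal (M.pathProb π p) • Measure.dirac p := by
    refine Measure.measurable_of_measurable_coe _ fun s hs => ?_
    simp only [Measure.coe_finsetSum, Finset.sum_apply, Measure.smul_apply, smul_eq_mul]
    exact Finset.measurable_fun_sum _ fun p _ =>
      ((measurable_pathProb M p).ennreal_ofReal).mul_const _
  set κ : Kernel (Policy X A H) (Path X A H) := ⟨_, hmeas⟩ with hκ
  have hκs : ∀ π s, κ π s = ∑ p ∈ M.paths, ENNReal.ofReal (M.pathProb π p) *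
      Measure.dirac p s := by
    intro π s
    simp only [hκ, Kernel.coe_mk, Measure.coe_finsetSum, Finset.sum_apply, Measure.smul_apply,
      smul_eq_mul]
  have : IsMarkovKernel κ := ⟨fun π => ⟨by
    rw [hκs]
    simp only [measure_univ, mul_one]
    rw [← ENNReal.ofReal_sum_of_nonneg fun p _ => M.pathProb_nonneg _ _, M.sum_pathProb,
      ENNReal.ofReal_one]⟩⟩
  -- The path law is a Markov kernel into a countable discrete space, so it is the image of the
  -- uniform law under a map that is jointly measurable in the policy and the seed.
  obtain ⟨f, hf, hfκ⟩ := Kernel.exists_measurable_map_eq_unitInterval κ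
  refine ⟨f, fun p => hf (MeasurableSet.of_discrete (s := {p})), fun π p => ?_⟩
  have hfπ : Measurable (f π) := hf.comp measurable_prodMk_left
  have h1 : volume {u | f π u = p} = (volume.map (f π)) {p} := by
    rw [Measure.map_apply hfπ (MeasurableSet.of_discrete)]
    rfl
  rw [h1, hfκ, hκs]
  simp only [Measure.dirac_apply' _ (MeasurableSet.of_discrete (s := ({p} : Set (Path X A H)))),
    Set.indicator_apply, Set.mem_singleton_iff, Pi.one_apply, mul_ite, mul_one, mul_zero]
  rw [Finset.sum_ite_eq']
  split_ifs with hp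
  · rfl
  · rw [M.pathProb_eq_zero π hp, ENNReal.ofReal_zero]

/-- The policy of a measurable learner is a measurable function of the past. -/
theorem Learner.IsMeasurable.measurable_policy {Λ : Learner X A H} (hΛ : Λ.IsMeasurable)
    {Ω : Type} {m : MeasurableSpace Ω} {k : ℕ} {seed : ℕ → Ω → Seed} {path : ℕ → Ω → Path X A H}
    {loss : ℕ → Ω → LossFn X A H} (hseed : ∀ i ≤ k, Measurable (seed i))
    (hpath : ∀ i < k, ∀ p, MeasurableSet {ω | path i ω = p}) (hloss : ∀ i < k, Measurable (loss i)) :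
    Measurable fun ω => Λ (List.ofFn fun i : Fin k => (seed i ω, (path i ω, fun h =>
      loss i ω h (path i ω h).1 (path i ω h).2))) (seed k ω) := by
  refine measurable_pi_iff.2 fun h => measurable_pi_iff.2 fun x => ?_
  refine Measurable.subtype_mk (f := fun ω => ((Λ (List.ofFn fun i : Fin k => (seed i ω, (path i ω,
    fun h => loss i ω h (path i ω h).1 (path i ω h).2))) (seed k ω) h x : stdSimplex ℝ A) : A → ℝ))
    (measurable_pi_iff.2 fun a => ?_)
  -- Measurability of a learner is assumed for frozen paths only. The space is cut into the
  -- countably many events on which the past paths are a given `q`.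
  have hG : ∀ q : Fin k → Path X A H, Measurable fun ω => (Λ (List.ofFn fun i : Fin k =>
      (seed i ω, (q i, fun h => loss i ω h (q i h).1 (q i h).2))) (seed k ω) h x : A → ℝ) a := by
    intro q
    refine (hΛ k q h x a).comp (g := fun z : (Fin k → Seed × (Fin H → ℝ)) × Seed => _)
      (f := fun ω => (fun i : Fin k => (seed (i : ℕ) ω, fun h => loss i ω h (q i h).1 (q i h).2),
        seed k ω)) ?_
    refine Measurable.prodMk (measurable_pi_iff.2 fun i => ?_) (hseed k le_rfl)
    refine (hseed i i.2.le).prodMk (measurable_pi_iff.2 fun h => ?_)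
    exact (measurable_pi_apply (q i h).2).comp ((measurable_pi_apply (q i h).1).comp
      ((measurable_pi_apply h).comp (hloss i i.2)))
  intro s hs
  have : (fun ω => (Λ (List.ofFn fun i : Fin k => (seed i ω, (path i ω, fun h =>
      loss i ω h (path i ω h).1 (path i ω h).2))) (seed k ω) h x : A → ℝ) a) ⁻¹' s =
      ⋃ q : Fin k → Path X A H, (⋂ i : Fin k, {ω | path (i : ℕ) ω = q i}) ∩
        (fun ω => (Λ (List.ofFn fun i : Fin k =>
          (seed i ω, (q i, fun h => loss i ω h (q i h).1 (q i h).2))) (seed k ω) h x : A → ℝ) a) ⁻¹' s := by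
    ext ω
    simp only [Set.mem_preimage, Set.mem_iUnion, Set.mem_inter_iff, Set.mem_iInter,
      Set.mem_ofPred_eq]
    constructor
    · exact fun hω => ⟨fun i => path i ω, fun i => rfl, hω⟩
    · rintro ⟨q, hq, hω⟩
      simp only [hq]
      exact hω
  change MeasurableSet ((fun ω => (Λ (List.ofFn fun i : Fin k => (seed i ω, (path i ω, fun h =>
      loss i ω h (path i ω h).1 (path i ω h).2))) (seed k ω) h x : A → ℝ) a) ⁻¹' s)
  rw [this]
  exact MeasurableSet.iUnion fun q => (MeasurableSet.iInter fun i : Fin k => hpath i i.2 (q i)).inter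
    (hG q hs)

end Sampling

/-! ### Continuing one copy of the black-box algorithm beyond its restart -/

section Phantom

variable {X A : Type} [Fintype A] {H : ℕ} (Λ : Learner X A H)
  (f : Policy X A H → Seed → Path X A H) (seed : ℕ → Seed) (loss : ℕ → LossFn X A H)
  (real : ℕ → Option (Path X A H)) (u : ℕ → Seed)

/-- The path of episode `k`: the given one if there is one, and otherwise the one that the sampler
`f` draws for the policy of the learner. -/
def nextPath (k : ℕ) (hist : List (Seed × Feedback X A H)) : Path X A H :=
  (real k).getD (f (Λ hist (seed k)) (u k))

/-- The history of a learner whose paths are the given ones or are sampled. -/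
def phantomHist : ℕ → List (Seed × Feedback X A H)
  | 0 => []
  | k + 1 => phantomHist k ++ [(seed k, (nextPath Λ f seed real u k (phantomHist k), fun h =>
      loss k h (nextPath Λ f seed real u k (phantomHist k) h).1
        (nextPath Λ f seed real u k (phantomHist k) h).2))]

/-- The path of episode `k` in the history `phantomHist`. -/
def phantomPath (k : ℕ) : Path X A H :=
  nextPath Λ f seed real u k (phantomHist Λ f seed loss real u k)

theorem ofFn_phantomPath (k : ℕ) :
    (List.ofFn fun i : Fin k => (seed i, (phantomPath Λ f seed loss real u i, fun h =>
      loss i h (phantomPath Λ f seed loss real u i h).1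
        (phantomPath Λ f seed loss real u i h).2))) = phantomHist Λ f seed loss real u k := by
  induction k with
  | zero => rfl
  | succ k ih =>
    rw [List.ofFn_succ', List.concat_eq_append]
    simp only [Fin.val_castSucc, Fin.val_last]
    rw [ih]
    rfl

variable {real} in
theorem phantomPath_of_some {k : ℕ} {p : Path X A H} (h : real k = some p) :
    phantomPath Λ f seed loss real u k = p := by
  simp [phantomPath, nextPath, h]

variable {real} in
theorem phantomPath_of_none {k : ℕ} (h : real k = none) :
    phantomPath Λ f seed loss real u k =
      f (Λ (phantomHist Λ f seed loss real u k) (seed k)) (u k) := by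
  simp [phantomPath, nextPath, h]

end Phantom

/-- The information in the first `k` auxiliary seeds. -/
abbrev auxInfo (k : ℕ) : MeasurableSpace (ℕ → Seed) :=
  MeasurableSpace.comap (fun u (i : Fin k) => u i) inferInstance

theorem auxInfo_le (k : ℕ) : auxInfo k ≤ MeasurableSpace.pi :=
  Measurable.comap_le (measurable_pi_iff.2 fun _ => measurable_pi_apply _)

theorem auxInfo_mono : Monotone auxInfo := by
  intro k l hkl
  have hg : Measurable fun (v : Fin l → Seed) (i : Fin k) => v ⟨i, by omega⟩ :=
    measurable_pi_iff.2 fun _ => measurable_pi_apply _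
  change MeasurableSpace.comap ((fun (v : Fin l → Seed) (i : Fin k) => v ⟨i, by omega⟩) ∘
    fun (u : ℕ → Seed) (i : Fin l) => u i) _ ≤ _
  rw [← MeasurableSpace.comap_comp]
  exact MeasurableSpace.comap_mono hg.comap_le

theorem measurable_aux (k : ℕ) : Measurable[auxInfo (k + 1)] fun u : ℕ → Seed => u k := by
  have h1 : Measurable[auxInfo (k + 1)] fun (u : ℕ → Seed) (j : Fin (k + 1)) => u j :=
    comap_measurable _
  exact (measurable_pi_apply (Fin.last k)).comp h1

/-- The law of the auxiliary seeds. -/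
abbrev auxMeasure : Measure (ℕ → Seed) := Measure.infinitePi fun _ => (volume : Measure Seed)

theorem indep_aux (k : ℕ) : Indep (auxInfo k)
    (MeasurableSpace.comap (fun u : ℕ → Seed => u k) inferInstance) auxMeasure := by
  have h := iIndepFun_infinitePi (P := fun _ : ℕ => (volume : Measure Seed))
    (X := fun _ (x : Seed) => x) (fun _ => measurable_id)
  have h1 := h.indepFun_finset (Finset.range k) {k} (by simp) (fun i => measurable_pi_apply i)
  have h2 : IndepFun (fun (u : ℕ → Seed) (i : Fin k) => u i) (fun u : ℕ → Seed => u k) auxMeasure :=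
    h1.comp (φ := fun v (i : Fin k) => v ⟨i, Finset.mem_range.2 i.2⟩)
      (ψ := fun v => v ⟨k, Finset.mem_singleton_self k⟩)
      (measurable_pi_iff.2 fun i => measurable_pi_apply _) (measurable_pi_apply _)
  exact (IndepFun_iff_Indep _ _ _).1 h2

theorem map_aux (k : ℕ) : auxMeasure.map (fun u => u k) = (volume : Measure Seed) :=
  Measure.infinitePi_map_eval (fun _ : ℕ => (volume : Measure Seed)) k

/-! ### The run of the black-box algorithm in one epoch -/

namespace Run

open scoped ENNReal

variable {A : Type} [Fintype A] {H : ℕ} [NeZero H] {σ : Setting}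
  {M : LayeredMDP ℕ A H} {ALG : BlackBox (Option ℕ) A H} {Pol : PolicySet ℕ A H}
  {dflt : Policy ℕ A H} {abot : A} {δ ε : ℝ}
  {Ω : Type} [mΩ : MeasurableSpace Ω] {μ : Measure Ω}

section Epoch

variable (R : Run σ M (sfrl ALG Pol dflt abot δ ε) μ) (t₀ : ℕ) (S : Fin H → Finset ℕ)

/-- The copy of the black-box algorithm that runs while the identified states are `S`. -/
abbrev inner (ALG : BlackBox (Option ℕ) A H) (Pol : PolicySet ℕ A H) (abot : A) (δ : ℝ)
    (S : Fin H → Finset ℕ) : Learner (Option ℕ) A H :=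
  ALG (prunedStates S) (prunedPolicySet Pol abot) (innerConf δ S)

/-- The event that the epoch with identified states `S` starts with episode `t₀`. -/
def epochEvent (abot : A) (δ ε : ℝ) : Set Ω := {ω | EpochStart abot δ ε (R.episode ω) t₀ S}

theorem measurableSet_epochEvent [IsProbabilityMeasure μ] :
    MeasurableSet[R.𝓕 t₀] (R.epochEvent t₀ S abot δ ε) := by
  refine R.measurableSet_of_paths fun ω ω' h => ?_
  unfold EpochStart
  have h1 : ∀ t ≤ t₀, (memSeq abot δ ε (R.episode ω) t).core =
      (memSeq abot δ ε (R.episode ω') t).core := fun t ht =>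
    R.core_congr fun i hi => h i (by omega)
  rw [h1 t₀ le_rfl]
  refine and_congr_right fun _ => forall₂_congr fun t ht => ?_
  rw [h1 t ht.le]

/-- The pruned path of the `k`-th episode from `t₀` on, while the identified states are `S`. -/
def epochPath (k : ℕ) (ω : Ω) : Option (Path (Option ℕ) A H) := by
  classical
  exact if R.core abot δ ε (t₀ + k) ω = S then some (prunePath abot S (R.path (t₀ + k) ω)) else none

/-- The losses on the pruned space. -/
def extLoss (k : ℕ) (z : Ω × (ℕ → Seed)) : LossFn (Option ℕ) A H := pruneLoss (R.loss (t₀ + k) z.1)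

/-- The seeds of the extended run. -/
def extSeed (k : ℕ) (z : Ω × (ℕ → Seed)) : Seed := R.seed (t₀ + k) z.1

variable (f : Policy (Option ℕ) A H → Seed → Path (Option ℕ) A H)

/-- The paths of the extended run. -/
def extPath (k : ℕ) (z : Ω × (ℕ → Seed)) : Path (Option ℕ) A H :=
  phantomPath (inner ALG Pol abot δ S) f (fun k => R.extSeed t₀ k z) (fun k => R.extLoss t₀ k z)
    (fun k => R.epochPath t₀ S k z.1) z.2 k

/-- The policies of the extended run. -/
def extPolicy (k : ℕ) (z : Ω × (ℕ → Seed)) : Policy (Option ℕ) A H :=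
  inner ALG Pol abot δ S (List.ofFn fun i : Fin k => (R.extSeed t₀ i z,
    (R.extPath t₀ S f i z, fun h => R.extLoss t₀ i z h (R.extPath t₀ S f i z h).1
      (R.extPath t₀ S f i z h).2))) (R.extSeed t₀ k z)

/-- The information before the `k`-th episode of the extended run. -/
abbrev extInfo (k : ℕ) : MeasurableSpace (Ω × (ℕ → Seed)) := (R.𝓕 (t₀ + k)).prod (auxInfo k)

/-- The law of the extended run. -/
abbrev extMeasure (abot : A) (δ ε : ℝ) : Measure (Ω × (ℕ → Seed)) :=
  (μ[|R.epochEvent t₀ S abot δ ε]).prod auxMeasure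

theorem extPath_of_core_eq {k : ℕ} {z : Ω × (ℕ → Seed)} (h : R.core abot δ ε (t₀ + k) z.1 = S) :
    R.extPath t₀ S f k z = prunePath abot S (R.path (t₀ + k) z.1) :=
  phantomPath_of_some _ _ _ _ _ (by simp [epochPath, h])

theorem extPath_of_core_ne {k : ℕ} {z : Ω × (ℕ → Seed)} (h : R.core abot δ ε (t₀ + k) z.1 ≠ S) :
    R.extPath t₀ S f k z = f (R.extPolicy t₀ S f k z) (z.2 k) := by
  unfold extPath
  rw [phantomPath_of_none _ _ _ _ _ (by simp [epochPath, h]), ← ofFn_phantomPath]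
  rfl

/-- The policy of the black-box algorithm in episode `t`. -/
def algPolicy (t : ℕ) (ω : Ω) : Policy (Option ℕ) A H :=
  inner ALG Pol abot δ (R.core abot δ ε t ω) (memSeq abot δ ε (R.episode ω) t).hist (R.seed t ω)

/-- As long as the epoch lasts, the fictitious history is the one that SF-RL has recorded, because
the pruned feedback consists of the pruned path and the pruned loss along it. -/
theorem extPolicy_eq {k : ℕ} {z : Ω × (ℕ → Seed)} (hz : z.1 ∈ R.epochEvent t₀ S abot δ ε)
    (h : R.core abot δ ε (t₀ + k) z.1 = S) :
    R.extPolicy t₀ S f k z = R.algPolicy (t₀ + k) z.1 := by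
  unfold extPolicy algPolicy
  rw [h, EpochStart.hist_eq hz k h]
  congr 2
  funext i
  have hi : R.core abot δ ε (t₀ + i) z.1 = S := EpochStart.core_eq hz i.2.le h
  rw [R.extPath_of_core_eq t₀ S f hi]
  refine Prod.ext rfl ?_
  exact (pruneFeedback_eq abot S (R.path (t₀ + i) z.1) (R.loss (t₀ + i) z.1)).symm

theorem prunesTo_policy {reg : ℕ → ℕ → ℕ → ℝ → ℝ}
    (hALG : HasRegretGuarantee σ ALG (prunedPolicySet Pol abot) reg) (hδ : 0 < δ) (hδ1 : δ < 1)
    (t : ℕ) (ω : Ω) :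
    PrunesTo abot (R.core abot δ ε t ω) (R.policy t ω) (R.algPolicy t ω) :=
  prunesTo_sfrl hALG hδ hδ1 _ _ (foldl_ofFn_step abot δ ε (R.episode ω) t)

/-! #### Measurability -/

theorem measurable_pruneLoss : Measurable (pruneLoss : LossFn ℕ A H → LossFn (Option ℕ) A H) := by
  refine measurable_pi_iff.2 fun h => measurable_pi_iff.2 fun x => measurable_pi_iff.2 fun a => ?_
  cases x with
  | none => exact measurable_const
  | some n =>
    exact (measurable_pi_apply a).comp ((measurable_pi_apply n).comp (measurable_pi_apply h))

theorem extInfo_mono : Monotone (R.extInfo t₀) := fun _ _ h =>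
  sup_le_sup (MeasurableSpace.comap_mono (R.𝓕.mono (by omega)))
    (MeasurableSpace.comap_mono (auxInfo_mono h))

theorem measurable_comp_fst {Υ β : Type} [MeasurableSpace β] {m : MeasurableSpace Ω}
    {n : MeasurableSpace Υ} {g : Ω → β} (hg : Measurable[m] g) :
    Measurable[m.prod n] fun z : Ω × Υ => g z.1 :=
  hg.comp (@measurable_fst Ω Υ m n)

theorem measurable_extSeed (k : ℕ) : Measurable[R.extInfo t₀ (k + 1)] (R.extSeed t₀ k) :=
  measurable_comp_fst (R.measurable_seed (t₀ + k))

theorem measurable_extLoss (k : ℕ) : Measurable[R.extInfo t₀ (k + 1)] (R.extLoss t₀ k) :=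
  measurable_pruneLoss.comp (measurable_comp_fst (R.measurable_loss (t₀ + k)))

/-- The σ-algebra `m` is left free because three of them are needed: the next `extInfo`, the larger
`extPathInfo`, and the one on which `Run.path_law` conditions. -/
theorem measurable_extPolicy_of_le {k : ℕ} (hΛ : (inner ALG Pol abot δ S).IsMeasurable)
    {m : MeasurableSpace (Ω × (ℕ → Seed))} (hm : R.extInfo t₀ k ≤ m)
    (hseed : Measurable[m] (R.extSeed t₀ k))
    (hpath : ∀ i < k, ∀ p, MeasurableSet[R.extInfo t₀ (i + 1)] {z | R.extPath t₀ S f i z = p}) :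
    Measurable[m] (R.extPolicy t₀ S f k) := by
  refine hΛ.measurable_policy (fun i hi => ?_) (fun i hi p => ?_) fun i hi => ?_
  · rcases hi.eq_or_lt with rfl | hi
    · exact hseed
    · exact (R.measurable_extSeed t₀ i).mono ((R.extInfo_mono t₀ hi).trans hm) le_rfl
  · exact hm _ (R.extInfo_mono t₀ hi _ (hpath i hi p))
  · exact (R.measurable_extLoss t₀ i).mono ((R.extInfo_mono t₀ hi).trans hm) le_rfl

variable {f} in
-- Strong induction, since a sampled path depends on the policy and thereby on all earlier paths.
-- Whether the path is real or sampled is decided by the core before the episode, which is known.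
theorem measurableSet_extPath [IsProbabilityMeasure μ] (hΛ : (inner ALG Pol abot δ S).IsMeasurable)
    (hf : ∀ p, MeasurableSet {z : Policy (Option ℕ) A H × Seed | f z.1 z.2 = p}) (k : ℕ) :
    ∀ p, MeasurableSet[R.extInfo t₀ (k + 1)] {z | R.extPath t₀ S f k z = p} := by
  have : Nonempty A := ⟨abot⟩
  induction k using Nat.strong_induction_on with
  | _ k ih =>
  intro p
  have hpol := R.measurable_extPolicy_of_le t₀ S f hΛ (R.extInfo_mono t₀ (Nat.le_succ k))
    (R.measurable_extSeed t₀ k) ih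
  have hu : Measurable[R.extInfo t₀ (k + 1)] fun z : Ω × (ℕ → Seed) => z.2 k :=
    (measurable_aux k).comp (@measurable_snd Ω (ℕ → Seed) (R.𝓕 (t₀ + (k + 1))) (auxInfo (k + 1)))
  have hact : MeasurableSet[R.extInfo t₀ (k + 1)]
      {z : Ω × (ℕ → Seed) | R.core abot δ ε (t₀ + k) z.1 = S} :=
    (@measurable_fst Ω (ℕ → Seed) (R.𝓕 (t₀ + (k + 1))) (auxInfo (k + 1)))
      (R.𝓕.mono (by omega) _ (R.measurableSet_core_eq (t₀ + k) S))
  have hreal : MeasurableSet[R.extInfo t₀ (k + 1)]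
      {z : Ω × (ℕ → Seed) | prunePath abot S (R.path (t₀ + k) z.1) = p} :=
    (@measurable_fst Ω (ℕ → Seed) (R.𝓕 (t₀ + (k + 1))) (auxInfo (k + 1)))
      (R.measurableSet_path_mem (t₀ + k) {q | prunePath abot S q = p})
  have hsamp : MeasurableSet[R.extInfo t₀ (k + 1)]
      {z : Ω × (ℕ → Seed) | f (R.extPolicy t₀ S f k z) (z.2 k) = p} :=
    (Measurable.prodMk hpol hu) (hf p)
  have : {z | R.extPath t₀ S f k z = p} =
      ({z : Ω × (ℕ → Seed) | R.core abot δ ε (t₀ + k) z.1 = S} ∩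
        {z | prunePath abot S (R.path (t₀ + k) z.1) = p}) ∪
      ({z : Ω × (ℕ → Seed) | R.core abot δ ε (t₀ + k) z.1 = S}ᶜ ∩
        {z | f (R.extPolicy t₀ S f k z) (z.2 k) = p}) := by
    ext z
    by_cases hz : R.core abot δ ε (t₀ + k) z.1 = S
    · simp [hz, R.extPath_of_core_eq t₀ S f hz]
    · simp [hz, R.extPath_of_core_ne t₀ S f hz]
  rw [this]
  exact MeasurableSet.union (MeasurableSet.inter hact hreal)
    (MeasurableSet.inter (MeasurableSet.compl hact) hsamp)

end Epoch

end Run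

theorem LayeredMDP.pathProb_le_one {X A : Type} [Fintype A] {H : ℕ} [NeZero H] [Nonempty A]
    (M : LayeredMDP X A H) (π : Policy X A H) (p : Path X A H) : M.pathProb π p ≤ 1 := by
  by_cases hp : p ∈ M.paths
  · rw [← M.sum_pathProb π]
    exact Finset.single_le_sum (f := M.pathProb π) (fun q _ => M.pathProb_nonneg _ _) hp
  · rw [M.pathProb_eq_zero π hp]
    exact zero_le_one

namespace Run

open scoped ENNReal

variable {A : Type} [Fintype A] {H : ℕ} [NeZero H] {σ : Setting}
  {M : LayeredMDP ℕ A H} {ALG : BlackBox (Option ℕ) A H} {Pol : PolicySet ℕ A H}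
  {dflt : Policy ℕ A H} {abot : A} {δ ε : ℝ}
  {Ω : Type} [mΩ : MeasurableSpace Ω] {μ : Measure Ω}

/-! ### The law of the paths in the continued epoch -/

section Law

variable (R : Run σ M (sfrl ALG Pol dflt abot δ ε) μ) (t₀ : ℕ) (S : Fin H → Finset ℕ)

/-- An upper bound of the information on which a path of the extended run is conditioned. -/
abbrev extPathInfo (k : ℕ) : MeasurableSpace (Ω × (ℕ → Seed)) :=
  (R.info (t₀ + k)).prod (auxInfo k)

theorem extPathInfo_le (k : ℕ) : R.extPathInfo t₀ k ≤ mΩ.prod MeasurableSpace.pi :=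
  sup_le_sup (MeasurableSpace.comap_mono (R.info_le _)) (MeasurableSpace.comap_mono (auxInfo_le k))

theorem extInfo_le_extPathInfo (k : ℕ) : R.extInfo t₀ k ≤ R.extPathInfo t₀ k :=
  sup_le_sup (MeasurableSpace.comap_mono (R.filtration_le_info _)) le_rfl

theorem measurable_seed_info (t : ℕ) : Measurable[R.info t] (R.seed t) :=
  (comap_measurable (R.seed t)).mono le_sup_right le_rfl

theorem measurable_loss_info (t : ℕ) : Measurable[R.info t] (R.loss t) :=
  (comap_measurable (R.loss t)).mono (le_sup_right.trans le_sup_left) le_rfl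

variable {S} {f : Policy (Option ℕ) A H → Seed → Path (Option ℕ) A H} {reg : ℕ → ℕ → ℕ → ℝ → ℝ}

theorem measurable_extPolicy [IsProbabilityMeasure μ]
    (hΛ : (inner ALG Pol abot δ S).IsMeasurable)
    (hf : ∀ p, MeasurableSet {z : Policy (Option ℕ) A H × Seed | f z.1 z.2 = p}) (k : ℕ) :
    Measurable[R.extPathInfo t₀ k] (R.extPolicy t₀ S f k) :=
  R.measurable_extPolicy_of_le t₀ S f hΛ (R.extInfo_le_extPathInfo t₀ k)
    (measurable_comp_fst (R.measurable_seed_info (t₀ + k)))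
    fun i _ => R.measurableSet_extPath t₀ S hΛ hf i

/-- Real episodes: on `B` the epoch still lasts, so the policy is the one of the actual copy, and
pruning maps the path law of the environment to that of the pruned MDP. -/
theorem extMeasure_inter_prunePath [IsProbabilityMeasure μ] (hS : ∀ h, S h ⊆ M.states h)
    (hALG : HasRegretGuarantee σ ALG (prunedPolicySet Pol abot) reg) (hδ : 0 < δ) (hδ1 : δ < 1)
    (hf : ∀ p, MeasurableSet {z : Policy (Option ℕ) A H × Seed | f z.1 z.2 = p})
    (hE0 : μ (R.epochEvent t₀ S abot δ ε) ≠ 0) (k : ℕ) (p : Path (Option ℕ) A H)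
    {B : Set (Ω × (ℕ → Seed))} (hB : MeasurableSet[R.extPathInfo t₀ k] B)
    (hact : ∀ z ∈ B, R.core abot δ ε (t₀ + k) z.1 = S) :
    R.extMeasure t₀ S abot δ ε (B ∩ {z | prunePath abot S (R.path (t₀ + k) z.1) = p}) =
      ∫⁻ z in B, ENNReal.ofReal ((prunedMDP M S hS).pathProb (R.extPolicy t₀ S f k z) p)
        ∂(R.extMeasure t₀ S abot δ ε) := by
  classical
  have : Nonempty A := ⟨abot⟩
  set E := R.epochEvent t₀ S abot δ ε with hEdef
  have : IsProbabilityMeasure μ[|E] := cond_isProbabilityMeasure hE0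
  have hΛ : (inner ALG Pol abot δ S).IsMeasurable :=
    hALG.measurable _ _ (innerConf_pos hδ S) (innerConf_lt_one hδ1 S)
  have hEm' : MeasurableSet[R.𝓕 t₀] E := R.measurableSet_epochEvent t₀ S
  have hEm : MeasurableSet E := R.𝓕.le _ _ hEm'
  have hEi : MeasurableSet[R.info (t₀ + k)] E :=
    R.filtration_le_info _ _ (R.𝓕.mono (Nat.le_add_right _ _) _ hEm')
  have hBm : MeasurableSet B := R.extPathInfo_le t₀ k _ hB
  have hQm : MeasurableSet {ω | prunePath abot S (R.path (t₀ + k) ω) = p} :=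
    R.𝓕.le _ _ (R.measurableSet_path_mem (t₀ + k) {q | prunePath abot S q = p})
  set g : Ω × (ℕ → Seed) → ℝ≥0∞ := fun z =>
    ENNReal.ofReal ((prunedMDP M S hS).pathProb (R.extPolicy t₀ S f k z) p) with hg
  have hgm : Measurable g :=
    (((measurable_pathProb _ p).comp (R.measurable_extPolicy t₀ hΛ hf k)).mono
      (R.extPathInfo_le t₀ k) le_rfl).ennreal_ofReal
  -- The auxiliary seeds are frozen and integrated last, so that the path law of the original run
  -- applies to the sections of `B`. Conditioning on `E` only contributes the factor 1 / μ E.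
  have hinner : ∀ u : ℕ → Seed,
      μ[|E] ((fun ω => (ω, u)) ⁻¹' (B ∩ {z | prunePath abot S (R.path (t₀ + k) z.1) = p})) =
      ∫⁻ ω, B.indicator g (ω, u) ∂μ[|E] := by
    intro u
    set Bu : Set Ω := (fun ω => (ω, u)) ⁻¹' B with hBu
    have hBui : MeasurableSet[R.info (t₀ + k)] Bu :=
      (@measurable_prodMk_right Ω (ℕ → Seed) (R.info (t₀ + k)) (auxInfo k) u) hB
    have hBum : MeasurableSet Bu := R.info_le _ _ hBui
    have h1 : μ (E ∩ Bu ∩ {ω | prunePath abot S (R.path (t₀ + k) ω) = p}) =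
        ∫⁻ ω in E ∩ Bu, g (ω, u) ∂μ := by
      refine (R.measure_inter_path_mem (t₀ + k) {q | prunePath abot S q = p}
        (MeasurableSet.inter hEi hBui)).trans ?_
      refine setLIntegral_congr_fun (hEm.inter hBum) fun ω hω => ?_
      have hc : R.core abot δ ε (t₀ + k) ω = S := hact (ω, u) hω.2
      simp only [hg]
      congr 1
      rw [R.extPolicy_eq t₀ S f (z := (ω, u)) hω.1 hc]
      have hpr := R.prunesTo_policy hALG hδ hδ1 (t₀ + k) ω
      rw [hc] at hpr
      rw [← sum_pathProb_fiber_prunePath hS abot hpr p]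
      refine Finset.sum_congr ?_ fun _ _ => rfl
      ext q
      simp only [Finset.mem_filter, Set.mem_ofPred_eq]
    have h2 : ∫⁻ ω, B.indicator g (ω, u) ∂μ[|E] = (μ E)⁻¹ * ∫⁻ ω in E ∩ Bu, g (ω, u) ∂μ := by
      have h3 : (fun ω => B.indicator g (ω, u)) = Bu.indicator fun ω => g (ω, u) := by
        funext ω
        rfl
      rw [h3, lintegral_indicator hBum, ProbabilityTheory.cond, Measure.restrict_smul,
        Measure.restrict_restrict hBum, lintegral_smul_measure, Set.inter_comm, smul_eq_mul]
    rw [h2, ← h1, cond_apply hEm]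
    congr 2
    ext ω
    simp only [Set.mem_inter_iff, Set.mem_preimage, Set.mem_ofPred_eq, hBu, and_assoc]
  have hBQ : MeasurableSet
      (B ∩ {z : Ω × (ℕ → Seed) | prunePath abot S (R.path (t₀ + k) z.1) = p}) :=
    hBm.inter (measurable_fst hQm)
  change (μ[|E]).prod auxMeasure _ = ∫⁻ z in B, g z ∂((μ[|E]).prod auxMeasure)
  rw [Measure.prod_apply_symm hBQ, ← lintegral_indicator hBm,
    lintegral_prod_symm' _ (hgm.indicator hBm)]
  exact lintegral_congr hinner

/-- Fictitious episodes: the auxiliary seed of index `k` is uniform and independent of everything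
that determines the policy. -/
theorem extMeasure_inter_sample [IsProbabilityMeasure μ] (hS : ∀ h, S h ⊆ M.states h)
    (hΛ : (inner ALG Pol abot δ S).IsMeasurable)
    (hf : ∀ p, MeasurableSet {z : Policy (Option ℕ) A H × Seed | f z.1 z.2 = p})
    (hfv : ∀ π p, volume {u | f π u = p} = ENNReal.ofReal ((prunedMDP M S hS).pathProb π p))
    (hE0 : μ (R.epochEvent t₀ S abot δ ε) ≠ 0) (k : ℕ) (p : Path (Option ℕ) A H)
    {B : Set (Ω × (ℕ → Seed))} (hB : MeasurableSet[R.extPathInfo t₀ k] B) :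
    R.extMeasure t₀ S abot δ ε (B ∩ {z | f (R.extPolicy t₀ S f k z) (z.2 k) = p}) =
      ∫⁻ z in B, ENNReal.ofReal ((prunedMDP M S hS).pathProb (R.extPolicy t₀ S f k z) p)
        ∂(R.extMeasure t₀ S abot δ ε) := by
  have : IsProbabilityMeasure μ[|R.epochEvent t₀ S abot δ ε] := cond_isProbabilityMeasure hE0
  have hind : Indep (R.extPathInfo t₀ k)
      (MeasurableSpace.comap (fun z : Ω × (ℕ → Seed) => z.2 k) inferInstance)
      (R.extMeasure t₀ S abot δ ε) := by
    have h := indep_prod (R.info_le (t₀ + k)) (bot_le : ⊥ ≤ mΩ) (auxInfo_le k)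
      (measurable_pi_apply k).comap_le
      (indep_bot_right (R.info (t₀ + k)) (μ := μ[|R.epochEvent t₀ S abot δ ε])) (indep_aux k)
    refine indep_of_indep_of_le_right h ?_
    rw [show (fun z : Ω × (ℕ → Seed) => z.2 k) = (fun u : ℕ → Seed => u k) ∘ Prod.snd from rfl,
      ← MeasurableSpace.comap_comp]
    exact le_sup_right
  have hmap : (R.extMeasure t₀ S abot δ ε).map (fun z => z.2 k) = volume := by
    have h1 : (R.extMeasure t₀ S abot δ ε).map Prod.snd = auxMeasure := by
      rw [Measure.map_snd_prod, measure_univ, one_smul]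
    rw [show (fun z : Ω × (ℕ → Seed) => z.2 k) = (fun u : ℕ → Seed => u k) ∘ Prod.snd from rfl,
      ← Measure.map_map (measurable_pi_apply k) measurable_snd, h1, map_aux]
  have h := measure_inter_preimage_of_indep (R.extPathInfo_le t₀ k)
    ((measurable_pi_apply k).comp measurable_snd) hmap hind (R.measurable_extPolicy t₀ hΛ hf k)
    (hf p) hB
  refine Eq.trans h (lintegral_congr fun z => ?_)
  exact hfv _ _

/-- The law of the paths of the extended run. -/
theorem extMeasure_inter_extPath [IsProbabilityMeasure μ] (hS : ∀ h, S h ⊆ M.states h)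
    (hALG : HasRegretGuarantee σ ALG (prunedPolicySet Pol abot) reg) (hδ : 0 < δ) (hδ1 : δ < 1)
    (hf : ∀ p, MeasurableSet {z : Policy (Option ℕ) A H × Seed | f z.1 z.2 = p})
    (hfv : ∀ π p, volume {u | f π u = p} = ENNReal.ofReal ((prunedMDP M S hS).pathProb π p))
    (hE0 : μ (R.epochEvent t₀ S abot δ ε) ≠ 0) (k : ℕ) (p : Path (Option ℕ) A H)
    {B : Set (Ω × (ℕ → Seed))} (hB : MeasurableSet[R.extPathInfo t₀ k] B) :
    R.extMeasure t₀ S abot δ ε (B ∩ {z | R.extPath t₀ S f k z = p}) =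
      ∫⁻ z in B, ENNReal.ofReal ((prunedMDP M S hS).pathProb (R.extPolicy t₀ S f k z) p)
        ∂(R.extMeasure t₀ S abot δ ε) := by
  have hΛ : (inner ALG Pol abot δ S).IsMeasurable :=
    hALG.measurable _ _ (innerConf_pos hδ S) (innerConf_lt_one hδ1 S)
  set D : Set (Ω × (ℕ → Seed)) := {z | R.core abot δ ε (t₀ + k) z.1 = S} with hD
  have hDi : MeasurableSet[R.extPathInfo t₀ k] D :=
    (@measurable_fst Ω (ℕ → Seed) (R.info (t₀ + k)) (auxInfo k))
      (R.filtration_le_info _ _ (R.measurableSet_core_eq (t₀ + k) S))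
  have hDm : MeasurableSet D := R.extPathInfo_le t₀ k _ hDi
  -- The event `B` is split according to whether the epoch still lasts; the real and the fictitious
  -- part have the same path law.
  rw [← measure_inter_add_sdiff (B ∩ {z | R.extPath t₀ S f k z = p}) hDm,
    ← lintegral_inter_add_sdiff _ B hDm,
    ← R.extMeasure_inter_prunePath t₀ hS hALG hδ hδ1 hf hE0 k p (MeasurableSet.inter hB hDi)
      (fun z hz => hz.2),
    ← R.extMeasure_inter_sample t₀ hS hΛ hf hfv hE0 k p (MeasurableSet.diff hB hDi)]
  congr 2
  · ext z
    simp only [Set.mem_inter_iff, Set.mem_ofPred_eq, hD]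
    constructor
    · rintro ⟨⟨h1, h2⟩, h3⟩
      rw [R.extPath_of_core_eq t₀ S f h3] at h2
      exact ⟨⟨h1, h3⟩, h2⟩
    · rintro ⟨⟨h1, h3⟩, h2⟩
      rw [R.extPath_of_core_eq t₀ S f h3]
      exact ⟨⟨h1, h2⟩, h3⟩
  · ext z
    simp only [Set.mem_inter_iff, Set.mem_sdiff, Set.mem_ofPred_eq, hD]
    constructor
    · rintro ⟨⟨h1, h2⟩, h3⟩
      rw [R.extPath_of_core_ne t₀ S f h3] at h2
      exact ⟨⟨h1, h3⟩, h2⟩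
    · rintro ⟨⟨h1, h3⟩, h2⟩
      rw [R.extPath_of_core_ne t₀ S f h3]
      exact ⟨⟨h1, h2⟩, h3⟩

end Law

end Run

/-- In the extended run, what was independent of the past stays independent of the past enlarged by
the auxiliary seeds, also after conditioning on a past event. -/
theorem indep_cond_prod_auxMeasure {Ω : Type} {m n mΩ : MeasurableSpace Ω} {μ : Measure Ω}
    [IsProbabilityMeasure μ] (hm : m ≤ mΩ) (hn : n ≤ mΩ) (hind : Indep m n μ) {E : Set Ω}
    (hE : MeasurableSet[n] E) (hE0 : μ E ≠ 0) (k : ℕ) :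
    Indep (m.comap Prod.fst) (n.prod (auxInfo k)) ((μ[|E]).prod auxMeasure) := by
  have : IsProbabilityMeasure μ[|E] := cond_isProbabilityMeasure hE0
  have h2 := indep_prod hm hn bot_le (auxInfo_le k) (indep_cond hn hind hE hE0)
    (indep_bot_left (auxInfo k) (μ := auxMeasure))
  exact indep_of_indep_of_le_left h2 le_sup_left

/-- A converse of `measure_inter_eq_lintegral_of_condExp`, for measurable `g`: it turns the
integrated path law back into a conditional law. -/
theorem condExp_indicator_ae_eq {Ω : Type} {m mΩ : MeasurableSpace Ω} {μ : Measure Ω}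
    [IsFiniteMeasure μ] (hm : m ≤ mΩ) {V : Set Ω} (hV : MeasurableSet V) {g : Ω → ℝ}
    (hg : Measurable[m] g) (hg0 : ∀ ω, 0 ≤ g ω) (hg1 : ∀ ω, g ω ≤ 1)
    (h : ∀ B, MeasurableSet[m] B → μ (B ∩ V) = ∫⁻ ω in B, ENNReal.ofReal (g ω) ∂μ) :
    μ[V.indicator (fun _ => (1 : ℝ)) | m] =ᵐ[μ] g := by
  have hgi : Integrable g μ :=
    Integrable.of_bound (hg.mono hm le_rfl).aestronglyMeasurable 1
      (Filter.Eventually.of_forall fun z => by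
        rw [Real.norm_eq_abs, abs_of_nonneg (hg0 z)]
        exact hg1 z)
  refine (ae_eq_condExp_of_forall_setIntegral_eq hm ((integrable_const (1 : ℝ)).indicator hV)
    (fun s _ _ => hgi.integrableOn) (fun B hB _ => ?_)
    hg.stronglyMeasurable.aestronglyMeasurable).symm
  rw [setIntegral_indicator hV, setIntegral_const, smul_eq_mul, mul_one, Measure.real, h B hB,
    integral_eq_lintegral_of_nonneg_ae (Filter.Eventually.of_forall hg0)
      (hg.mono hm le_rfl).aestronglyMeasurable]

namespace Run

open scoped ENNReal

variable {A : Type} [Fintype A] {H : ℕ} [NeZero H] {σ : Setting}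
  {M : LayeredMDP ℕ A H} {ALG : BlackBox (Option ℕ) A H} {Pol : PolicySet ℕ A H}
  {dflt : Policy ℕ A H} {abot : A} {δ ε : ℝ}
  {Ω : Type} [mΩ : MeasurableSpace Ω] {μ : Measure Ω}

section EpochRun

variable (R : Run σ M (sfrl ALG Pol dflt abot δ ε) μ) (t₀ : ℕ) {S : Fin H → Finset ℕ}
  {f : Policy (Option ℕ) A H → Seed → Path (Option ℕ) A H} {reg : ℕ → ℕ → ℕ → ℝ → ℝ}

theorem map_fst_extMeasure [IsProbabilityMeasure μ] :
    (R.extMeasure t₀ S abot δ ε).map Prod.fst = μ[|R.epochEvent t₀ S abot δ ε] := by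
  rw [Measure.map_fst_prod, measure_univ, one_smul]

/-- The uniform law of the seeds and, in the stochastic setting, the law of the losses pass to the
extended run in this way. -/
theorem map_extMeasure [IsProbabilityMeasure μ] (hE0 : μ (R.epochEvent t₀ S abot δ ε) ≠ 0)
    {β : Type} [MeasurableSpace β] {g : Ω → β} (hg : Measurable g) {k : ℕ}
    (hind : Indep (MeasurableSpace.comap g inferInstance) (R.𝓕 (t₀ + k)) μ) :
    (R.extMeasure t₀ S abot δ ε).map (fun z => g z.1) = μ.map g := by
  rw [show (fun z : Ω × (ℕ → Seed) => g z.1) = g ∘ Prod.fst from rfl,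
    ← Measure.map_map hg measurable_fst, map_fst_extMeasure]
  refine Measure.ext fun s hs => ?_
  rw [Measure.map_apply hg hs, Measure.map_apply hg hs]
  exact cond_apply_of_indep (R.𝓕.le _) hind
    (R.𝓕.mono (Nat.le_add_right t₀ k) _ (R.measurableSet_epochEvent t₀ S)) hE0 ⟨s, hs, rfl⟩

theorem comap_extSeed_le (k : ℕ) : MeasurableSpace.comap (R.extSeed t₀ k) inferInstance ≤
    MeasurableSpace.comap Prod.fst (MeasurableSpace.comap (R.seed (t₀ + k)) inferInstance) := by
  rw [MeasurableSpace.comap_comp]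
  exact le_rfl

theorem comap_extLoss_le (k : ℕ) : MeasurableSpace.comap (R.extLoss t₀ k) inferInstance ≤
    MeasurableSpace.comap Prod.fst (MeasurableSpace.comap (R.loss (t₀ + k)) inferInstance) := by
  rw [MeasurableSpace.comap_comp]
  change MeasurableSpace.comap (pruneLoss ∘ (R.loss (t₀ + k) ∘ Prod.fst)) _ ≤ _
  rw [← MeasurableSpace.comap_comp]
  exact MeasurableSpace.comap_mono measurable_pruneLoss.comap_le

/-- The run of the black-box algorithm in the pruned MDP that coincides with the actual interaction
during the epoch. -/
def extRun [IsProbabilityMeasure μ] (hS : ∀ h, S h ⊆ M.states h)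
    (hALG : HasRegretGuarantee σ ALG (prunedPolicySet Pol abot) reg) (hδ : 0 < δ) (hδ1 : δ < 1)
    (hf : ∀ p, MeasurableSet {z : Policy (Option ℕ) A H × Seed | f z.1 z.2 = p})
    (hfv : ∀ π p, volume {u | f π u = p} = ENNReal.ofReal ((prunedMDP M S hS).pathProb π p))
    (hE0 : μ (R.epochEvent t₀ S abot δ ε) ≠ 0) :
    Run σ (prunedMDP M S hS) (inner ALG Pol abot δ S) (R.extMeasure t₀ S abot δ ε) where
  𝓕 :=
    { seq := R.extInfo t₀
      mono' := R.extInfo_mono t₀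
      le' := fun k => (R.extInfo_le_extPathInfo t₀ k).trans (R.extPathInfo_le t₀ k) }
  loss := R.extLoss t₀
  seed := R.extSeed t₀
  path := R.extPath t₀ S f
  loss_mem k z h x a := pruneLoss_mem (R.loss_mem (t₀ + k) z.1) h x a
  measurable_loss k := R.measurable_extLoss t₀ k
  measurable_seed k := R.measurable_extSeed t₀ k
  measurable_path k p := R.measurableSet_extPath t₀ S
    (hALG.measurable _ _ (innerConf_pos hδ S) (innerConf_lt_one hδ1 S)) hf k p
  loss_adversarial hσ k :=
    measurable_pruneLoss.comp (measurable_comp_fst (R.loss_adversarial hσ (t₀ + k)))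
  loss_stochastic hσ k := by
    have hlm : ∀ t, Measurable (R.loss t) := fun t => (R.measurable_loss t).mono (R.𝓕.le _) le_rfl
    have hmap : ∀ k, (R.extMeasure t₀ S abot δ ε).map (R.extLoss t₀ k) =
        (μ.map (R.loss 0)).map pruneLoss := by
      intro k
      have hl : Measurable fun z : Ω × (ℕ → Seed) => R.loss (t₀ + k) z.1 :=
        (hlm (t₀ + k)).comp measurable_fst
      rw [show R.extLoss t₀ k = pruneLoss ∘ fun z : Ω × (ℕ → Seed) => R.loss (t₀ + k) z.1 from rfl,
        ← Measure.map_map measurable_pruneLoss hl,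
        R.map_extMeasure t₀ hE0 (hlm (t₀ + k)) (R.loss_stochastic hσ (t₀ + k)).2,
        (R.loss_stochastic hσ (t₀ + k)).1]
    refine ⟨(hmap k).trans (hmap 0).symm, ?_⟩
    exact indep_of_indep_of_le_left (indep_cond_prod_auxMeasure (hlm (t₀ + k)).comap_le
      (R.𝓕.le _) (R.loss_stochastic hσ (t₀ + k)).2
      (R.𝓕.mono (Nat.le_add_right t₀ k) _ (R.measurableSet_epochEvent t₀ S)) hE0 k)
      (R.comap_extLoss_le t₀ k)
  seed_uniform k := by
    have hsm : Measurable (R.seed (t₀ + k)) :=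
      (R.measurable_seed (t₀ + k)).mono (R.𝓕.le _) le_rfl
    rw [← R.seed_uniform (t₀ + k)]
    exact R.map_extMeasure t₀ hE0 hsm
      (indep_of_indep_of_le_right (R.seed_indep (t₀ + k)) le_sup_left)
  seed_indep k := by
    have hsm : Measurable (R.seed (t₀ + k)) :=
      (R.measurable_seed (t₀ + k)).mono (R.𝓕.le _) le_rfl
    have h := indep_cond_prod_auxMeasure hsm.comap_le (le_sup_left.trans (R.info_le (t₀ + k)))
      (R.seed_indep (t₀ + k)) ((le_sup_left : R.𝓕 (t₀ + k) ≤ _) _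
        (R.𝓕.mono (Nat.le_add_right t₀ k) _ (R.measurableSet_epochEvent t₀ S))) hE0 k
    refine indep_of_indep_of_le_right (indep_of_indep_of_le_left h (R.comap_extSeed_le t₀ k)) ?_
    refine sup_le (sup_le_sup (MeasurableSpace.comap_mono le_sup_left) le_rfl) ?_
    exact (R.comap_extLoss_le t₀ k).trans
      ((MeasurableSpace.comap_mono le_sup_right).trans le_sup_left)
  path_law k p := by
    have : Nonempty A := ⟨abot⟩
    have : IsProbabilityMeasure μ[|R.epochEvent t₀ S abot δ ε] := cond_isProbabilityMeasure hE0
    have hΛ : (inner ALG Pol abot δ S).IsMeasurable :=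
      hALG.measurable _ _ (innerConf_pos hδ S) (innerConf_lt_one hδ1 S)
    -- The extended run observes only the pruned losses, hence less than `extPathInfo`. The
    -- integrated path law holds for the larger σ-algebra, and the policy is already measurable for
    -- the smaller one.
    have hmle : R.extInfo t₀ k ⊔ MeasurableSpace.comap (R.extLoss t₀ k) inferInstance ⊔
        MeasurableSpace.comap (R.extSeed t₀ k) inferInstance ≤ R.extPathInfo t₀ k := by
      refine sup_le (sup_le (R.extInfo_le_extPathInfo t₀ k) ?_) ?_
      · exact (measurable_pruneLoss.comp
          (measurable_comp_fst (R.measurable_loss_info (t₀ + k)))).comap_le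
      · exact (measurable_comp_fst (R.measurable_seed_info (t₀ + k))).comap_le
    have hpol : Measurable[R.extInfo t₀ k ⊔ MeasurableSpace.comap (R.extLoss t₀ k) inferInstance ⊔
        MeasurableSpace.comap (R.extSeed t₀ k) inferInstance] (R.extPolicy t₀ S f k) :=
      R.measurable_extPolicy_of_le t₀ S f hΛ (le_sup_left.trans le_sup_left)
        ((comap_measurable (R.extSeed t₀ k)).mono le_sup_right le_rfl)
        fun i _ => R.measurableSet_extPath t₀ S hΛ hf i
    have hVm : MeasurableSet {z | R.extPath t₀ S f k z = p} :=
      ((R.extInfo_le_extPathInfo t₀ (k + 1)).trans (R.extPathInfo_le t₀ (k + 1))) _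
        (R.measurableSet_extPath t₀ S hΛ hf k p)
    exact condExp_indicator_ae_eq (hmle.trans (R.extPathInfo_le t₀ k)) hVm
      ((measurable_pathProb (prunedMDP M S hS) p).comp hpol)
      (fun z => LayeredMDP.pathProb_nonneg _ _ _) (fun z => LayeredMDP.pathProb_le_one _ _ _)
      fun B hB => R.extMeasure_inter_extPath t₀ hS hALG hδ hδ1 hf hfv hE0 k p (hmle _ hB)

/-- The regret of the black-box algorithm in the first `K` episodes from `t₀` on. -/
def epochRegret (hS : ∀ h, S h ⊆ M.states h) (K : ℕ) (ω : Ω) : ℝ :=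
  ∑ k ∈ Finset.range K, (prunedMDP M S hS).value (R.algPolicy (t₀ + k) ω)
      (pruneLoss (R.loss (t₀ + k) ω)) -
    ⨅ π : (prunedPolicySet Pol abot).policies (prunedStates S),
      ∑ k ∈ Finset.range K, (prunedMDP M S hS).value π.1 (pruneLoss (R.loss (t₀ + k) ω))

/-- The regret bound of the black-box algorithm after `K` episodes with identified states `S`. -/
def epochBound (A : Type) [Fintype A] (reg : ℕ → ℕ → ℕ → ℝ → ℝ) (δ : ℝ) (S : Fin H → Finset ℕ)
    (K : ℕ) : ℝ :=
  reg (stateCount (prunedStates S)) (Fintype.card A) H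
    (Real.log (H * stateCount (prunedStates S) * Fintype.card A * K / innerConf δ S)) * √(K : ℝ)

/-- Conditionally on the start of an epoch, the guarantee of the black-box algorithm holds. -/
theorem measure_epochRegret_gt_le [IsProbabilityMeasure μ] (hS : ∀ h, S h ⊆ M.states h)
    (hALG : HasRegretGuarantee σ ALG (prunedPolicySet Pol abot) reg) (hδ : 0 < δ) (hδ1 : δ < 1) :
    μ {ω | ω ∈ R.epochEvent t₀ S abot δ ε ∧ ∃ K : ℕ,
        R.core abot δ ε (t₀ + K) ω = S ∧
          epochBound A reg δ S (K + 1) < R.epochRegret t₀ hS (K + 1) ω} ≤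
      ENNReal.ofReal (innerConf δ S) * μ (R.epochEvent t₀ S abot δ ε) := by
  have : Nonempty A := ⟨abot⟩
  set E := R.epochEvent t₀ S abot δ ε with hE
  set V := {ω | ω ∈ E ∧ ∃ K : ℕ, R.core abot δ ε (t₀ + K) ω = S ∧
    epochBound A reg δ S (K + 1) < R.epochRegret t₀ hS (K + 1) ω} with hV
  -- On a null epoch one cannot condition, but there is nothing to prove.
  by_cases hE0 : μ E = 0
  · refine le_trans (measure_mono (t := E) fun ω hω => hω.1) ?_
    rw [hE0]
    exact bot_le
  obtain ⟨f, hf, hfv⟩ := exists_path_sampler (prunedMDP M S hS)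
  have : IsProbabilityMeasure μ[|E] := cond_isProbabilityMeasure hE0
  set R' := R.extRun t₀ hS hALG hδ hδ1 hf hfv hE0 with hR'
  have hguar := hALG.regret_le (prunedMDP M S hS) (innerConf δ S) (innerConf_pos hδ S)
    (innerConf_lt_one hδ1 S) (Ω × (ℕ → Seed)) (R.extMeasure t₀ S abot δ ε) R'
  -- If the core is still `S` before episode `t₀ + K`, then the first `K + 1` policies of the
  -- extended run are the actual ones. The random `K` is harmless because the guarantee is uniform
  -- in `K`.
  have hsub : V ×ˢ (Set.univ : Set (ℕ → Seed)) ⊆ {z | ∃ K : ℕ, 0 < K ∧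
      reg (stateCount (prunedMDP M S hS).states) (Fintype.card A) H
        (Real.log (H * stateCount (prunedMDP M S hS).states * Fintype.card A * K /
          innerConf δ S)) * √(K : ℝ) < R'.regret (prunedPolicySet Pol abot) K z} := by
    rintro ⟨ω, u⟩ ⟨⟨hωE, K, hK, hlt⟩, -⟩
    refine ⟨K + 1, Nat.succ_pos K, lt_of_lt_of_eq hlt ?_⟩
    unfold epochRegret regret
    congr 1
    refine Finset.sum_congr rfl fun k hk => ?_
    have hkK : k ≤ K := by have := Finset.mem_range.1 hk; omega
    have hck : R.core abot δ ε (t₀ + k) ω = S := EpochStart.core_eq hωE hkK hK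
    have hp : R'.policy k (ω, u) = R.algPolicy (t₀ + k) ω :=
      R.extPolicy_eq t₀ S f (z := (ω, u)) hωE hck
    rw [hp]
    rfl
  have h1 : μ[|E] V ≤ ENNReal.ofReal (innerConf δ S) := by
    refine le_trans (le_of_eq ?_) ((measure_mono hsub).trans hguar)
    rw [Measure.prod_prod, measure_univ, mul_one]
  have hEm : MeasurableSet E := R.𝓕.le _ _ (R.measurableSet_epochEvent t₀ S)
  have h2 : μ V = μ[|E] V * μ E := by
    rw [cond_mul_eq_inter hEm, Set.inter_eq_self_of_subset_right fun ω hω => hω.1]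
  rw [h2]
  gcongr

end EpochRun

end Run

/-! ### The regret of all epochs -/

theorem eq_of_le_of_stateCount_eq {X : Type} {H : ℕ} {S S' : Fin H → Finset X} (h : S ≤ S')
    (hc : stateCount S = stateCount S') : S = S' := by
  have h1 := (Finset.sum_eq_sum_iff_of_le fun i (_ : i ∈ Finset.univ) =>
    Finset.card_le_card (h i)).1 hc
  exact funext fun i => Finset.eq_of_subset_of_card_le (h i) (h1 i (Finset.mem_univ i)).ge

theorem stateCount_mono {X : Type} {H : ℕ} {S S' : Fin H → Finset X} (h : S ≤ S') :
    stateCount S ≤ stateCount S' :=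
  Finset.sum_le_sum fun i _ => Finset.card_le_card (h i)

namespace Run

open scoped ENNReal

variable {A : Type} [Fintype A] {H : ℕ} [NeZero H] {σ : Setting}
  {M : LayeredMDP ℕ A H} {ALG : BlackBox (Option ℕ) A H} {Pol : PolicySet ℕ A H}
  {dflt : Policy ℕ A H} {abot : A} {δ ε : ℝ}
  {Ω : Type} [mΩ : MeasurableSpace Ω] {μ : Measure Ω} {reg : ℕ → ℕ → ℕ → ℝ → ℝ}

/-- The cores of a run form a chain, so the size determines the core, and the first time of a core
is unique. Epoch events with cores of equal size are therefore disjoint. -/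
theorem epochEvent_unique (R : Run σ M (sfrl ALG Pol dflt abot δ ε) μ) {t t' : ℕ}
    {S S' : Fin H → Finset ℕ} (hc : stateCount S = stateCount S') {ω : Ω}
    (h : ω ∈ R.epochEvent t S abot δ ε) (h' : ω ∈ R.epochEvent t' S' abot δ ε) :
    t = t' ∧ S = S' := by
  have hS : S = S' := by
    rcases le_total t t' with htt | htt
    · refine eq_of_le_of_stateCount_eq ?_ hc
      rw [← h.1, ← h'.1]
      exact memSeq_core_mono abot δ ε (R.episode ω) htt
    · refine (eq_of_le_of_stateCount_eq ?_ hc.symm).symm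
      rw [← h.1, ← h'.1]
      exact memSeq_core_mono abot δ ε (R.episode ω) htt
  subst hS
  refine ⟨?_, rfl⟩
  by_contra hne
  rcases lt_or_gt_of_ne hne with hlt | hlt
  · exact h'.2 t hlt h.1
  · exact h.2 t' hlt h'.1

theorem sum_measure_epochEvent_le [IsProbabilityMeasure μ]
    (R : Run σ M (sfrl ALG Pol dflt abot δ ε) μ) (I : Finset (ℕ × (Fin H → Finset ℕ))) (c : ℕ)
    (hI : ∀ i ∈ I, stateCount i.2 = c) :
    ∑ i ∈ I, μ (R.epochEvent i.1 i.2 abot δ ε) ≤ 1 := by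
  rw [← measure_biUnion_finset]
  · exact prob_le_one
  · intro i hi j hj hij
    refine Set.disjoint_left.2 fun ω hω hω' => hij ?_
    obtain ⟨h1, h2⟩ := R.epochEvent_unique ((hI i hi).trans (hI j hj).symm) hω hω'
    exact Prod.ext h1 h2
  · exact fun i _ => R.𝓕.le _ _ (R.measurableSet_epochEvent i.1 i.2)

/-- With high probability, the guarantee of the black-box algorithm holds in all epochs. -/
theorem measure_exists_epochRegret_gt_le [IsProbabilityMeasure μ]
    (R : Run σ M (sfrl ALG Pol dflt abot δ ε) μ)
    (hALG : HasRegretGuarantee σ ALG (prunedPolicySet Pol abot) reg) (hδ : 0 < δ) (hδ1 : δ < 1)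
    (T : ℕ) :
    μ {ω | ∃ t₀ < T, ∃ (S : Fin H → Finset ℕ) (hS : ∀ h, S h ⊆ M.states h),
        ω ∈ R.epochEvent t₀ S abot δ ε ∧ ∃ K : ℕ, R.core abot δ ε (t₀ + K) ω = S ∧
          epochBound A reg δ S (K + 1) < R.epochRegret t₀ hS (K + 1) ω} ≤ ENNReal.ofReal δ := by
  classical
  set J : Finset (Fin H → Finset ℕ) := Fintype.piFinset fun h => (M.states h).powerset with hJ
  set I := Finset.range T ×ˢ J with hI
  set V : ℕ × (Fin H → Finset ℕ) → Set Ω := fun i =>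
    {ω | ω ∈ R.epochEvent i.1 i.2 abot δ ε ∧ ∃ (hS : ∀ h, i.2 h ⊆ M.states h) (K : ℕ),
      R.core abot δ ε (i.1 + K) ω = i.2 ∧
        epochBound A reg δ i.2 (K + 1) < R.epochRegret i.1 hS (K + 1) ω} with hV
  have hJS : ∀ S, S ∈ J ↔ ∀ h, S h ⊆ M.states h := by simp [hJ]
  have hsub : {ω | ∃ t₀ < T, ∃ (S : Fin H → Finset ℕ) (hS : ∀ h, S h ⊆ M.states h),
        ω ∈ R.epochEvent t₀ S abot δ ε ∧ ∃ K : ℕ, R.core abot δ ε (t₀ + K) ω = S ∧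
          epochBound A reg δ S (K + 1) < R.epochRegret t₀ hS (K + 1) ω} ⊆ ⋃ i ∈ I, V i := by
    rintro ω ⟨t₀, ht₀, S, hS, hE, K, hK, hlt⟩
    exact Set.mem_biUnion (x := (t₀, S))
      (Finset.mem_product.2 ⟨Finset.mem_range.2 ht₀, (hJS S).2 hS⟩) ⟨hE, hS, K, hK, hlt⟩
  have hVle : ∀ i ∈ I, μ (V i) ≤ ENNReal.ofReal (δ / 2 * (1 / ((stateCount i.2 : ℝ) + 1) ^ 2)) *
      μ (R.epochEvent i.1 i.2 abot δ ε) := by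
    intro i hi
    have hS := (hJS i.2).1 (Finset.mem_product.1 hi).2
    refine (measure_mono ?_).trans
      ((R.measure_epochRegret_gt_le i.1 hS hALG hδ hδ1).trans ?_)
    · rintro ω ⟨hE, _, K, hK⟩
      exact ⟨hE, K, hK⟩
    · gcongr
      unfold innerConf
      -- There are `H ≥ 1` auxiliary states, so the pruned space has at least one state more than
      -- the core.
      rw [stateCount_pruned, div_mul_div_comm, mul_one]
      have hH : (1 : ℝ) ≤ H := by exact_mod_cast NeZero.one_le (n := H)
      push_cast
      gcongr
  have hNle : ∀ i ∈ I, stateCount i.2 ∈ Finset.range (stateCount M.states + 1) := fun i hi =>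
    Finset.mem_range.2 (Nat.lt_succ_of_le
      (stateCount_mono ((hJS i.2).1 (Finset.mem_product.1 hi).2)))
  calc _ ≤ ∑ i ∈ I, μ (V i) := (measure_mono hsub).trans (measure_biUnion_finset_le _ _)
    _ ≤ ∑ i ∈ I, ENNReal.ofReal (δ / 2 * (1 / ((stateCount i.2 : ℝ) + 1) ^ 2)) *
          μ (R.epochEvent i.1 i.2 abot δ ε) := Finset.sum_le_sum hVle
    _ = ∑ c ∈ Finset.range (stateCount M.states + 1), ∑ i ∈ I with stateCount i.2 = c,
          ENNReal.ofReal (δ / 2 * (1 / ((stateCount i.2 : ℝ) + 1) ^ 2)) *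
            μ (R.epochEvent i.1 i.2 abot δ ε) := (Finset.sum_fiberwise_of_maps_to hNle _).symm
    -- Among the pairs with a core of size `c` the epoch events are disjoint, so their total
    -- probability is at most one.
    _ ≤ ∑ c ∈ Finset.range (stateCount M.states + 1),
          ENNReal.ofReal (δ / 2 * (1 / ((c : ℝ) + 1) ^ 2)) := by
        refine Finset.sum_le_sum fun c _ => ?_
        have h1 : ∑ i ∈ I with stateCount i.2 = c,
            ENNReal.ofReal (δ / 2 * (1 / ((stateCount i.2 : ℝ) + 1) ^ 2)) *
              μ (R.epochEvent i.1 i.2 abot δ ε) =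
            ENNReal.ofReal (δ / 2 * (1 / ((c : ℝ) + 1) ^ 2)) * ∑ i ∈ I with stateCount i.2 = c,
              μ (R.epochEvent i.1 i.2 abot δ ε) := by
          rw [Finset.mul_sum]
          exact Finset.sum_congr rfl fun i hi => by rw [(Finset.mem_filter.1 hi).2]
        rw [h1]
        exact mul_le_of_le_one_right' (R.sum_measure_epochEvent_le _ c
          fun i hi => (Finset.mem_filter.1 hi).2)
    _ = ENNReal.ofReal (δ / 2 * ∑ c ∈ Finset.range (stateCount M.states + 1),
          1 / ((c : ℝ) + 1) ^ 2) := by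
        rw [Finset.mul_sum, ENNReal.ofReal_sum_of_nonneg fun c _ => by positivity]
    _ ≤ ENNReal.ofReal δ := by
        refine ENNReal.ofReal_le_ofReal ?_
        have := sum_inv_sq_le_two (stateCount M.states + 1)
        nlinarith

/-! #### Decomposition of the regret -/

/-- The expected loss of an episode before it leaves the identified states. -/
def coreValue (M : LayeredMDP ℕ A H) (abot : A) (S : Fin H → Finset ℕ) (π : Policy ℕ A H)
    (ℓ : LossFn ℕ A H) : ℝ :=
  ∑ q ∈ M.paths, M.pathProb π q * ∑ h, pruneLoss ℓ h (prunePath abot S q h).1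
    (prunePath abot S q h).2

/-- Episodes before the first identification cost the black box nothing. Hence only nonempty cores
count, and the main term may vanish when no state can be identified. -/
theorem coreValue_empty (M : LayeredMDP ℕ A H) (abot : A) {S : Fin H → Finset ℕ}
    (hS : stateCount S = 0) (π : Policy ℕ A H) (ℓ : LossFn ℕ A H) : coreValue M abot S π ℓ = 0 := by
  refine Finset.sum_eq_zero fun q _ => ?_
  rw [Finset.sum_eq_zero, mul_zero]
  intro h _
  have hh : S h = ∅ := Finset.card_eq_zero.1 (Finset.sum_eq_zero_iff.1 hS h (Finset.mem_univ h))
  rw [prunePath_of_not_mem abot (h := h) (k := h) le_rfl (by rw [hh]; exact Finset.notMem_empty _)]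
  rfl

/-- The two pruning inequalities are used in opposite directions, so only the exits of the learner
are paid for and never those of the comparator. -/
theorem value_sub_value_le {S : Fin H → Finset ℕ} (hS : ∀ h, S h ⊆ M.states h) (abot : A)
    {ℓ : LossFn ℕ A H} (hℓ : ∀ h x a, ℓ h x a ∈ Set.Icc (0 : ℝ) 1) (π π' : Policy ℕ A H) :
    M.value π ℓ - M.value π' ℓ ≤ coreValue M abot S π ℓ - coreValue M abot S π' ℓ +
      H * leaveProb M S π := by
  have h1 := value_le_value_pruned_add hS abot (prunesTo_prunePolicy abot π) hℓ
  have h2 := value_pruned_le hS abot (prunesTo_prunePolicy abot π') hℓ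
  rw [value_pruned_eq hS abot (prunesTo_prunePolicy abot _)] at h1 h2
  unfold coreValue
  linarith

theorem sum_coreValue_sub_le_epochRegret (R : Run σ M (sfrl ALG Pol dflt abot δ ε) μ)
    (hALG : HasRegretGuarantee σ ALG (prunedPolicySet Pol abot) reg) (hδ : 0 < δ) (hδ1 : δ < 1)
    {t₀ K : ℕ} {S : Fin H → Finset ℕ} (hS : ∀ h, S h ⊆ M.states h) {ω : Ω}
    (hK : ∀ k < K, R.core abot δ ε (t₀ + k) ω = S) {π : Policy ℕ A H}
    (hπ : π ∈ Pol.policies M.states) :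
    ∑ k ∈ Finset.range K, (coreValue M abot S (R.policy (t₀ + k) ω) (R.loss (t₀ + k) ω) -
      coreValue M abot S π (R.loss (t₀ + k) ω)) ≤ R.epochRegret t₀ hS K ω := by
  rw [Finset.sum_sub_distrib]
  unfold epochRegret
  refine sub_le_sub (le_of_eq (Finset.sum_congr rfl fun k hk => ?_)) ?_
  · have hp := R.prunesTo_policy hALG hδ hδ1 (t₀ + k) ω
    rw [hK k (Finset.mem_range.1 hk)] at hp
    exact (value_pruned_eq hS abot hp _).symm
  · refine (ciInf_le ⟨0, ?_⟩ ⟨prunePolicy abot π, prunePolicy_mem abot hS hπ⟩).trans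
      (le_of_eq (Finset.sum_congr rfl fun k _ => ?_))
    · rintro _ ⟨π', rfl⟩
      exact Finset.sum_nonneg fun k _ => value_nonneg _ _
        fun h x a => (pruneLoss_mem (R.loss_mem (t₀ + k) ω) h x a).1
    · exact value_pruned_eq hS abot (prunesTo_prunePolicy abot π) _

/-- The episodes with identified states `S` form an interval. -/
theorem exists_epoch (R : Run σ M (sfrl ALG Pol dflt abot δ ε) μ) {T : ℕ}
    {S : Fin H → Finset ℕ} {ω : Ω} (hS : ∃ t < T, R.core abot δ ε t ω = S) :
    ∃ t₀ < T, ∃ K : ℕ, ω ∈ R.epochEvent t₀ S abot δ ε ∧ R.core abot δ ε (t₀ + K) ω = S ∧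
      {t ∈ Finset.range T | R.core abot δ ε t ω = S} =
        (Finset.range (K + 1)).map (addLeftEmbedding t₀) := by
  classical
  have hmono : Monotone fun t => R.core abot δ ε t ω := memSeq_core_mono abot δ ε (R.episode ω)
  have hex : ∃ t, R.core abot δ ε t ω = S := hS.imp fun _ h => h.2
  obtain ⟨s, hsT, hs⟩ := hS
  set F := {t ∈ Finset.range T | R.core abot δ ε t ω = S} with hF
  have hsF : s ∈ F := by simp [hF, hsT, hs]
  set t₁ := F.max' ⟨s, hsF⟩ with ht₁
  have ht₁F : t₁ ∈ F := F.max'_mem _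
  obtain ⟨ht₁T, ht₁S⟩ := Finset.mem_filter.1 ht₁F
  have ht₁T := Finset.mem_range.1 ht₁T
  have hle : Nat.find hex ≤ t₁ := Nat.find_min' hex ht₁S
  have hst : Nat.find hex + (t₁ - Nat.find hex) = t₁ := by omega
  refine ⟨Nat.find hex, hle.trans_lt ht₁T, t₁ - Nat.find hex,
    ⟨Nat.find_spec hex, fun t ht => Nat.find_min hex ht⟩, by rw [hst]; exact ht₁S, ?_⟩
  ext t
  simp only [Finset.mem_map, Finset.mem_range, addLeftEmbedding_apply]
  constructor
  · intro ht
    have h1 : t ≤ t₁ := F.le_max' t ht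
    have h2 : Nat.find hex ≤ t := Nat.find_min' hex (Finset.mem_filter.1 ht).2
    exact ⟨t - Nat.find hex, by omega, by omega⟩
  · rintro ⟨k, hk, rfl⟩
    refine Finset.mem_filter.2 ⟨Finset.mem_range.2 (by omega), le_antisymm ?_ ?_⟩
    · exact (hmono (by omega : Nat.find hex + k ≤ t₁)).trans ht₁S.le
    · exact (Nat.find_spec hex).ge.trans (hmono (Nat.le_add_right _ k))

open Classical in
/-- The values that the identified states take in the first `T` episodes. -/
def cores (R : Run σ M (sfrl ALG Pol dflt abot δ ε) μ) (T : ℕ) (ω : Ω) :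
    Finset (Fin H → Finset ℕ) :=
  ((Finset.range T).image fun t => R.core abot δ ε t ω).filter fun S => stateCount S ≠ 0

open Classical in
/-- The number of episodes, among the first `T`, with identified states `S`. -/
def epochLength (R : Run σ M (sfrl ALG Pol dflt abot δ ε) μ) (T : ℕ) (S : Fin H → Finset ℕ)
    (ω : Ω) : ℕ :=
  ((Finset.range T).filter fun t => R.core abot δ ε t ω = S).card

theorem sum_coreValue_sub_le (R : Run σ M (sfrl ALG Pol dflt abot δ ε) μ)
    (hALG : HasRegretGuarantee σ ALG (prunedPolicySet Pol abot) reg) (hδ : 0 < δ) (hδ1 : δ < 1)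
    {T : ℕ} {ω : Ω} (hcore : ∀ t < T, ∀ h, R.core abot δ ε t ω h ⊆ M.states h)
    (hreg : ¬ ∃ t₀ < T, ∃ (S : Fin H → Finset ℕ) (hS : ∀ h, S h ⊆ M.states h),
        ω ∈ R.epochEvent t₀ S abot δ ε ∧ ∃ K : ℕ, R.core abot δ ε (t₀ + K) ω = S ∧
          epochBound A reg δ S (K + 1) < R.epochRegret t₀ hS (K + 1) ω)
    {π : Policy ℕ A H} (hπ : π ∈ Pol.policies M.states) :
    ∑ t ∈ Finset.range T, (coreValue M abot (R.core abot δ ε t ω) (R.policy t ω) (R.loss t ω) -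
      coreValue M abot (R.core abot δ ε t ω) π (R.loss t ω)) ≤
      ∑ S ∈ R.cores T ω, epochBound A reg δ S (R.epochLength T S ω) := by
  classical
  have hmaps : ∀ t ∈ Finset.range T, R.core abot δ ε t ω ∈
      (Finset.range T).image fun t => R.core abot δ ε t ω := fun t ht =>
    Finset.mem_image_of_mem _ ht
  rw [← Finset.sum_fiberwise_of_maps_to hmaps, cores, Finset.sum_filter]
  refine Finset.sum_le_sum fun S hS => ?_
  obtain ⟨t, ht, htS⟩ := Finset.mem_image.1 hS
  split_ifs with h0
  · obtain ⟨t₀, ht₀, K, hE, hK, hF⟩ := R.exists_epoch ⟨t, Finset.mem_range.1 ht, htS⟩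
    have hSM : ∀ h, S h ⊆ M.states h := by
      rw [← htS]
      exact hcore t (Finset.mem_range.1 ht)
    have hlen : R.epochLength T S ω = K + 1 := by
      unfold epochLength
      have : (Finset.range T).filter (fun t => R.core abot δ ε t ω = S) =
        (Finset.range (K + 1)).map (addLeftEmbedding t₀) := by rw [← hF]
      rw [this, Finset.card_map, Finset.card_range]
    have hin : ∀ k < K + 1, R.core abot δ ε (t₀ + k) ω = S := fun k hk =>
      EpochStart.core_eq hE (Nat.le_of_lt_succ hk) hK
    rw [hlen]
    refine le_trans ?_ (not_lt.1 fun hlt => hreg ⟨t₀, ht₀, S, hSM, hE, K, hK, hlt⟩)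
    refine le_trans (le_of_eq ?_) (R.sum_coreValue_sub_le_epochRegret hALG hδ hδ1 hSM hin hπ)
    have : (Finset.range T).filter (fun t => R.core abot δ ε t ω = S) =
      (Finset.range (K + 1)).map (addLeftEmbedding t₀) := by rw [← hF]
    rw [this, Finset.sum_map]
    refine Finset.sum_congr rfl fun k hk => ?_
    simp only [addLeftEmbedding_apply]
    rw [hin k (Finset.mem_range.1 hk)]
  · refine le_of_eq (Finset.sum_eq_zero fun t ht => ?_)
    rw [(Finset.mem_filter.1 ht).2, coreValue_empty M abot (not_not.1 h0),
      coreValue_empty M abot (not_not.1 h0), sub_zero]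

/-- The regret is at most the regret of the copies of the black-box algorithm plus the loss incurred
outside the identified states. -/
theorem regret_le_sum_epochBound (R : Run σ M (sfrl ALG Pol dflt abot δ ε) μ)
    (hALG : HasRegretGuarantee σ ALG (prunedPolicySet Pol abot) reg)
    (hdflt : ∀ h n, dflt h n ∈ Pol h n) (hδ : 0 < δ) (hδ1 : δ < 1)
    {T : ℕ} {ω : Ω} (hcore : ∀ t < T, ∀ h, R.core abot δ ε t ω h ⊆ M.states h)
    (hreg : ¬ ∃ t₀ < T, ∃ (S : Fin H → Finset ℕ) (hS : ∀ h, S h ⊆ M.states h),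
        ω ∈ R.epochEvent t₀ S abot δ ε ∧ ∃ K : ℕ, R.core abot δ ε (t₀ + K) ω = S ∧
          epochBound A reg δ S (K + 1) < R.epochRegret t₀ hS (K + 1) ω) :
    R.regret Pol T ω ≤ ∑ S ∈ R.cores T ω, epochBound A reg δ S (R.epochLength T S ω) +
      H * ∑ t ∈ Finset.range T, leaveProb M (R.core abot δ ε t ω) (R.policy t ω) := by
  have : Nonempty (Pol.policies M.states) := ⟨⟨dflt, fun h x _ => hdflt h x⟩⟩
  unfold regret
  -- The infimum over policies need not be attained, so the bound is proved against each comparator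
  -- separately.
  rw [sub_le_comm]
  refine le_ciInf fun π => ?_
  rw [sub_le_comm, ← Finset.sum_sub_distrib]
  refine le_trans (Finset.sum_le_sum fun t ht => value_sub_value_le
    (hcore t (Finset.mem_range.1 ht)) abot (R.loss_mem t ω) _ _) ?_
  rw [Finset.sum_add_distrib, ← Finset.mul_sum]
  gcongr
  exact R.sum_coreValue_sub_le hALG hδ hδ1 hcore hreg π.2

end Run

/-! ### The regret bound -/

theorem stateCount_le_card {X : Type} {H : ℕ} {S : Fin H → Finset X}
    {N : Finset (Σ _ : Fin H, X)} (h : ∀ i, ∀ x ∈ S i, (⟨i, x⟩ : Σ _ : Fin H, X) ∈ N) :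
    stateCount S ≤ N.card := by
  unfold stateCount
  rw [← Finset.card_sigma]
  refine Finset.card_le_card fun s hs => ?_
  exact h s.1 s.2 (Finset.mem_sigma.1 hs).2

theorem LayeredMDP.value_le {X A : Type} [Fintype A] [Nonempty A] {H : ℕ} [NeZero H]
    (M : LayeredMDP X A H) (π : Policy X A H) {ℓ : LossFn X A H}
    (hℓ : ∀ h x a, ℓ h x a ∈ Set.Icc (0 : ℝ) 1) : M.value π ℓ ≤ H := by
  have h1 : ∀ p ∈ M.paths, M.pathProb π p * ∑ h, ℓ h (p h).1 (p h).2 ≤ M.pathProb π p * H := by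
    intro p _
    refine mul_le_mul_of_nonneg_left ?_ (M.pathProb_nonneg _ _)
    calc ∑ h, ℓ h (p h).1 (p h).2 ≤ ∑ _h : Fin H, (1 : ℝ) :=
          Finset.sum_le_sum fun h _ => (hℓ _ _ _).2
      _ = H := by simp
  calc M.value π ℓ ≤ ∑ p ∈ M.paths, M.pathProb π p * H := Finset.sum_le_sum h1
    _ = H := by rw [← Finset.sum_mul, M.sum_pathProb, one_mul]

theorem LayeredMDP.card_reachable_zero_pos {X A : Type} [Fintype A] [Nonempty A] {H : ℕ} [NeZero H]
    (M : LayeredMDP X A H) {Pol : PolicySet X A H} {π : Policy X A H}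
    (hπ : π ∈ Pol.policies M.states) : 0 < (M.reachable Pol 0).card := by
  classical
  have hone : M.occupancy π 0 M.init = 1 := by
    rw [← M.sum_pathProb π, occupancy]
    refine Finset.sum_subset (Finset.filter_subset _ _) fun p hp hp' => ?_
    have : (p 0).1 ≠ M.init := fun h => hp' (Finset.mem_filter.2 ⟨hp, h⟩)
    simp [pathProb, this]
  refine Finset.card_pos.2 ⟨⟨0, M.init⟩, Finset.mem_filter.2 ⟨?_, π, hπ, ?_⟩⟩
  · exact Finset.mem_sigma.2 ⟨Finset.mem_univ _, M.init_mem⟩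
  · simp only
    rw [hone]
    exact one_pos

/-- The logarithmic factor of a copy of the black-box algorithm is comparable to the one of the
bound. -/
theorem log_epoch_le {n s H a K T : ℕ} {δ : ℝ} (hδ : 0 < δ) (hδ1 : δ < 1) (hn : 1 ≤ n) (hs : s ≤ n)
    (hH : 1 ≤ H) (ha : 1 ≤ a) (hK : 1 ≤ K) (hKT : K ≤ T) (hT : 2 ≤ T) :
    0 ≤ Real.log (H * ((s + H : ℕ) : ℝ) * a * K / (δ / 3 / (2 * ((s + H : ℕ) : ℝ) ^ 2))) ∧
    Real.log (H * ((s + H : ℕ) : ℝ) * a * K / (δ / 3 / (2 * ((s + H : ℕ) : ℝ) ^ 2))) ≤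
      10 * Real.log (H * n * a * T / δ) := by
  set m : ℝ := ((s + H : ℕ) : ℝ) with hm
  have hn' : (1 : ℝ) ≤ n := by exact_mod_cast hn
  have hH' : (1 : ℝ) ≤ H := by exact_mod_cast hH
  have ha' : (1 : ℝ) ≤ a := by exact_mod_cast ha
  have hK' : (1 : ℝ) ≤ K := by exact_mod_cast hK
  have hKT' : (K : ℝ) ≤ T := by exact_mod_cast hKT
  have hT' : (2 : ℝ) ≤ T := by exact_mod_cast hT
  have hm1 : 1 ≤ m := by rw [hm]; exact_mod_cast (by omega : 1 ≤ s + H)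
  have hmle : m ≤ 2 * (n * H) := by
    have hs' : (s : ℝ) ≤ n := by exact_mod_cast hs
    rw [hm]
    push_cast
    nlinarith
  -- With `m ≤ 2nH` this is at most 48 x⁴ for x = HnaT/δ. As `T ≥ 2` gives x ≥ 2, the constant is
  -- absorbed by x⁶, and the exponent 10 becomes the factor of the logarithm.
  have harg : H * m * a * K / (δ / 3 / (2 * m ^ 2)) = 6 * (H * m ^ 3 * a * K / δ) := by
    field_simp
    ring
  have hone : 1 ≤ H * m ^ 3 * a * K / δ := by
    rw [le_div_iff₀ hδ]
    have : 1 ≤ H * m ^ 3 * a * K := by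
      have h3 : 1 ≤ m ^ 3 := one_le_pow₀ hm1
      exact one_le_mul_of_one_le_of_one_le (one_le_mul_of_one_le_of_one_le
        (one_le_mul_of_one_le_of_one_le hH' h3) ha') hK'
    linarith
  rw [harg]
  refine ⟨Real.log_nonneg (by linarith), ?_⟩
  set x : ℝ := H * n * a * T / δ with hx
  have hY : (1 : ℝ) ≤ H * n := one_le_mul_of_one_le_of_one_le hH' hn'
  have hYa : (H : ℝ) * n ≤ H * n * a := le_mul_of_one_le_right (by positivity) ha'
  have hYT : (H : ℝ) * n * a ≤ H * n * a * T := le_mul_of_one_le_right (by positivity) (by linarith)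
  have hYx : (H : ℝ) * n * a * T ≤ x := by
    rw [hx, le_div_iff₀ hδ]
    exact mul_le_of_le_one_right (by positivity) hδ1.le
  have hx2 : 2 ≤ x := by
    refine le_trans ?_ hYx
    calc (2 : ℝ) ≤ T := hT'
      _ ≤ H * n * a * T := le_mul_of_one_le_left (by positivity) (by linarith)
  have hYx' : (H : ℝ) * n ≤ x := by linarith
  have hx0 : 0 < x := by linarith
  have hHx : H * m ^ 3 * a * K / δ ≤ 8 * x ^ 4 := by
    calc H * m ^ 3 * a * K / δ ≤ H * (2 * (n * H)) ^ 3 * a * T / δ := by gcongr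
      _ = 8 * ((H * n) ^ 3 * (H * a * T / δ)) := by ring
      _ ≤ 8 * (x ^ 3 * x) := by
          gcongr
          rw [hx]
          gcongr
          exact le_mul_of_one_le_right (by positivity) hn'
      _ = 8 * x ^ 4 := by ring
  have h64 : (64 : ℝ) ≤ x ^ 6 := by
    calc (64 : ℝ) = 2 ^ 6 := by norm_num
      _ ≤ x ^ 6 := by gcongr
  have hle : 6 * (H * m ^ 3 * a * K / δ) ≤ x ^ 10 := by
    calc 6 * (H * m ^ 3 * a * K / δ) ≤ 64 * x ^ 4 := by nlinarith [pow_pos hx0 4]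
      _ ≤ x ^ 6 * x ^ 4 := by gcongr
      _ = x ^ 10 := by ring
  calc Real.log (6 * (H * m ^ 3 * a * K / δ)) ≤ Real.log (x ^ 10) :=
        Real.log_le_log (by linarith) hle
    _ = 10 * Real.log x := by rw [Real.log_pow]; norm_num

theorem mainTerm_nonneg {A : Type} [Fintype A] [Nonempty A] {H : ℕ} [NeZero H] {d : ℕ}
    {reg : ℕ → ℕ → ℕ → ℝ → ℝ} (hreg : IsRegretCoefficient d reg) (M : LayeredMDP ℕ A H)
    (Pol : PolicySet ℕ A H) {δ : ℝ} (hδ : 0 < δ) (hδ1 : δ < 1) (ε : ℝ) {T : ℕ} (hT : 1 ≤ T) :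
    0 ≤ mainTerm reg M Pol δ ε T := by
  refine mul_nonneg (hreg.nonneg _ _ _ _ ?_) (Real.sqrt_nonneg _)
  -- Without reachable states the logarithm is `Real.log 0 = 0`, which is still an admissible
  -- argument of `reg`.
  rcases Nat.eq_zero_or_pos (M.reachable Pol ε).card with h0 | h0
  · simp [h0]
  · refine Real.log_nonneg ?_
    rw [le_div_iff₀ hδ, one_mul]
    have h1 : (1 : ℝ) ≤ H * (M.reachable Pol ε).card * Fintype.card A * T := by
      have := NeZero.one_le (n := H)
      have := Fintype.card_pos (α := A)
      exact_mod_cast Nat.one_le_iff_ne_zero.2 (by positivity)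
    linarith

/-- A positive lower bound that allows the logarithm of the burn-in term to absorb additive
constants. -/
theorem log_burnIn_ge {H T : ℕ} (hH : 1 ≤ H) (hT : 1 ≤ T) {δ : ℝ} (hδ : 0 < δ) (hδ1 : δ < 1) :
    Real.log 2 ≤ Real.log (2 * (H : ℝ) ^ 2 * (T : ℝ) ^ 2 / δ) := by
  refine Real.log_le_log two_pos ?_
  have hH' : (1 : ℝ) ≤ (H : ℝ) ^ 2 := one_le_pow₀ (by exact_mod_cast hH)
  have hT' : (1 : ℝ) ≤ (T : ℝ) ^ 2 := one_le_pow₀ (by exact_mod_cast hT)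
  rw [le_div_iff₀ hδ]
  have := one_le_mul_of_one_le_of_one_le hH' hT'
  nlinarith

/-- The losses outside the identified states contribute lower-order terms. -/
theorem leave_bound {H T N : ℕ} (hH : 1 ≤ H) (hT : 1 ≤ T) (hN : 1 ≤ N) {δ ε : ℝ} (hδ : 0 < δ)
    (hδ1 : δ < 1) (hε : 0 ≤ ε) :
    (H : ℝ) * (2 * (N * (2 * ε * T + Real.log (2 * (H : ℝ) ^ 2 * (T : ℝ) ^ 2 / (δ / 3)) + 1 + 1)) +
      2 * Real.log (1 / (δ / 3))) ≤
    18 * (ε * H * N * T + (H : ℝ) ^ 2 * N * Real.log (2 * (H : ℝ) ^ 2 * (T : ℝ) ^ 2 / δ)) := by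
  have hL := log_burnIn_ge hH hT hδ hδ1
  set L := Real.log (2 * (H : ℝ) ^ 2 * (T : ℝ) ^ 2 / δ) with hLdef
  have hl2 := Real.log_two_gt_d9
  have hH' : (1 : ℝ) ≤ H := by exact_mod_cast hH
  have hT' : (1 : ℝ) ≤ T := by exact_mod_cast hT
  have hN' : (1 : ℝ) ≤ N := by exact_mod_cast hN
  have h3 : Real.log 3 ≤ 2 * Real.log 2 := by
    rw [show 2 * Real.log 2 = Real.log (2 ^ 2) by rw [Real.log_pow]; norm_num]
    exact Real.log_le_log (by norm_num) (by norm_num)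
  have h1 : Real.log (2 * (H : ℝ) ^ 2 * (T : ℝ) ^ 2 / (δ / 3)) = Real.log 3 + L := by
    rw [hLdef, ← Real.log_mul (by norm_num) (by positivity)]
    congr 1
    field_simp
  have h2 : Real.log (1 / (δ / 3)) ≤ Real.log 3 + L := by
    rw [← h1]
    refine Real.log_le_log (by positivity) ?_
    gcongr
    have hHH : (1 : ℝ) ≤ (H : ℝ) ^ 2 := one_le_pow₀ hH'
    have hTT : (1 : ℝ) ≤ (T : ℝ) ^ 2 := one_le_pow₀ hT'
    have := one_le_mul_of_one_le_of_one_le hHH hTT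
    nlinarith
  rw [h1]
  have hL0 : 0 ≤ L := by linarith
  have hNL : L ≤ N * L := le_mul_of_one_le_left hL0 hN'
  have hHNL : (H : ℝ) * (N * L) ≤ (H : ℝ) ^ 2 * N * L := by
    have : (H : ℝ) * (N * L) ≤ H * (H * (N * L)) := by
      refine mul_le_mul_of_nonneg_left (le_mul_of_one_le_left (by positivity) hH') (by positivity)
    linarith
  have hin : 2 * (N * (2 * ε * T + (Real.log 3 + L) + 1 + 1)) + 2 * Real.log (1 / (δ / 3)) ≤
      4 * (ε * N * T) + 18 * (N * L) := by
    -- From log 3 ≤ 2 log 2 ≤ 2L and 2 ≤ 3 log 2 ≤ 3L. Twice this, plus 2(log 3 + L) ≤ 6L, gives the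
    -- 18.
    have h5 : (N : ℝ) * (Real.log 3 + L + 2) ≤ N * (6 * L) :=
      mul_le_mul_of_nonneg_left (by linarith) (by positivity)
    nlinarith
  have heps : 0 ≤ ε * N * T := by positivity
  calc _ ≤ (H : ℝ) * (4 * (ε * N * T) + 18 * (N * L)) := by gcongr
    _ = 4 * (ε * H * N * T) + 18 * (H * (N * L)) := by ring
    _ ≤ 18 * (ε * H * N * T) + 18 * ((H : ℝ) ^ 2 * N * L) := by
        have : 0 ≤ ε * H * N * T := by positivity
        linarith
    _ = _ := by ring

/-! ### Summation over the epochs and the final probability estimate -/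

namespace Run

variable {A : Type} [Fintype A] {H : ℕ} [NeZero H] {σ : Setting}
  {M : LayeredMDP ℕ A H} {ALG : BlackBox (Option ℕ) A H} {Pol : PolicySet ℕ A H}
  {dflt : Policy ℕ A H} {abot : A} {δ ε : ℝ}
  {Ω : Type} [mΩ : MeasurableSpace Ω] {μ : Measure Ω} {reg : ℕ → ℕ → ℕ → ℝ → ℝ}

/-- The nonempty cores form a chain, so their sizes are distinct numbers between 1 and `n`. -/
theorem card_cores_le (R : Run σ M (sfrl ALG Pol dflt abot δ ε) μ) {T n : ℕ} {ω : Ω}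
    (hn : ∀ S ∈ R.cores T ω, stateCount S ≤ n) : (R.cores T ω).card ≤ n := by
  classical
  have hmono : Monotone fun t => R.core abot δ ε t ω := memSeq_core_mono abot δ ε (R.episode ω)
  have hinj : Set.InjOn stateCount (R.cores T ω : Set (Fin H → Finset ℕ)) := by
    intro S hS S' hS' hc
    obtain ⟨t, -, rfl⟩ := Finset.mem_image.1 (Finset.mem_filter.1 hS).1
    obtain ⟨t', -, rfl⟩ := Finset.mem_image.1 (Finset.mem_filter.1 hS').1
    rcases le_total t t' with h | h
    · exact eq_of_le_of_stateCount_eq (hmono h) hc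
    · exact (eq_of_le_of_stateCount_eq (hmono h) hc.symm).symm
  have := Finset.card_le_card_of_injOn (t := Finset.Icc 1 n) stateCount
    (fun S hS => Finset.mem_Icc.2 ⟨Nat.one_le_iff_ne_zero.2 (Finset.mem_filter.1 hS).2, hn S hS⟩)
    hinj
  rwa [Nat.card_Icc, Nat.add_sub_cancel] at this

theorem sum_epochLength_le (R : Run σ M (sfrl ALG Pol dflt abot δ ε) μ) (T : ℕ) (ω : Ω) :
    ∑ S ∈ R.cores T ω, R.epochLength T S ω ≤ T := by
  classical
  calc ∑ S ∈ R.cores T ω, R.epochLength T S ω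
      ≤ ∑ S ∈ (Finset.range T).image fun t => R.core abot δ ε t ω, R.epochLength T S ω :=
        Finset.sum_le_sum_of_subset (Finset.filter_subset _ _)
    _ = (Finset.range T).card := by
        rw [Finset.card_eq_sum_card_fiberwise (f := fun t => R.core abot δ ε t ω)
          (t := (Finset.range T).image fun t => R.core abot δ ε t ω)
          (fun t ht => Finset.mem_image_of_mem (fun t => R.core abot δ ε t ω) ht)]
        rfl
    _ = T := Finset.card_range T

theorem epochLength_pos (R : Run σ M (sfrl ALG Pol dflt abot δ ε) μ) {T : ℕ} {ω : Ω}
    {S : Fin H → Finset ℕ} (hS : S ∈ R.cores T ω) : 1 ≤ R.epochLength T S ω := by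
  classical
  obtain ⟨t, ht, htS⟩ := Finset.mem_image.1 (Finset.mem_filter.1 hS).1
  exact Finset.card_pos.2 ⟨t, Finset.mem_filter.2 ⟨ht, htS⟩⟩

/-- All copies have a coefficient of at most `10 ^ d * G`, and by the Cauchy–Schwarz inequality at
most `n` epochs of total length at most `T` satisfy ∑ √length ≤ √(nT). -/
theorem sum_epochBound_le [Nonempty A] {d : ℕ} (hreg : IsRegretCoefficient d reg) (hδ : 0 < δ)
    (hδ1 : δ < 1) (R : Run σ M (sfrl ALG Pol dflt abot (δ / 3) ε) μ) {T : ℕ} (hT : 2 ≤ T) {ω : Ω}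
    (hcore : ∀ t < T, ∀ h, ∀ x ∈ R.core abot (δ / 3) ε t ω h,
      (⟨h, x⟩ : Σ _ : Fin H, ℕ) ∈ M.reachable Pol ε) :
    ∑ S ∈ R.cores T ω, epochBound A reg (δ / 3) S (R.epochLength T S ω) ≤
      10 ^ d * mainTerm reg M Pol δ ε T := by
  set n := (M.reachable Pol ε).card with hn
  have hH : 1 ≤ H := NeZero.one_le
  have hA : 1 ≤ Fintype.card A := Fintype.card_pos
  have hSn : ∀ S ∈ R.cores T ω, stateCount S ≤ n := by
    intro S hS
    obtain ⟨t, ht, rfl⟩ := Finset.mem_image.1 (Finset.mem_filter.1 hS).1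
    exact stateCount_le_card (hcore t (Finset.mem_range.1 ht))
  have hcard := R.card_cores_le hSn
  have hsum := R.sum_epochLength_le T ω
  set L := Real.log (H * n * Fintype.card A * T / δ) with hL
  set G := reg (n + H) (Fintype.card A) H L with hG
  have hle : ∀ S ∈ R.cores T ω, epochBound A reg (δ / 3) S (R.epochLength T S ω) ≤
      10 ^ d * G * √(R.epochLength T S ω : ℝ) := by
    intro S hS
    have hs0 : stateCount S ≠ 0 := (Finset.mem_filter.1 hS).2
    have hlT : R.epochLength T S ω ≤ T :=
      (Finset.single_le_sum (f := fun S => R.epochLength T S ω) (fun _ _ => Nat.zero_le _) hS).trans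
        hsum
    obtain ⟨h0, h10⟩ := log_epoch_le (a := Fintype.card A) hδ hδ1
      (by have := hSn S hS; omega : 1 ≤ n) (hSn S hS) hH hA (R.epochLength_pos hS) hlT hT
    unfold epochBound innerConf
    rw [stateCount_pruned]
    gcongr
    have hL0 : 0 ≤ L := by linarith
    calc _ ≤ reg (n + H) (Fintype.card A) H (10 * L) :=
          hreg.mono _ _ _ _ _ _ _ _ (by have := hSn S hS; omega) le_rfl le_rfl h0 h10
      _ ≤ 10 ^ d * G := hreg.poly _ _ _ _ _ hL0 (by norm_num)
  rcases Finset.eq_empty_or_nonempty (R.cores T ω) with he | hne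
  · rw [he, Finset.sum_empty]
    exact mul_nonneg (by positivity) (mainTerm_nonneg hreg M Pol hδ hδ1 ε (by omega))
  have hn1 : 1 ≤ n := (Finset.card_pos.2 hne).trans_le hcard
  have hG0 : 0 ≤ G := by
    refine hreg.nonneg _ _ _ _ ?_
    obtain ⟨h0, h10⟩ := log_epoch_le (a := Fintype.card A) hδ hδ1 hn1 (le_refl n) hH hA le_rfl
      (by omega : 1 ≤ T) hT
    linarith
  calc _ ≤ ∑ S ∈ R.cores T ω, 10 ^ d * G * √(R.epochLength T S ω : ℝ) := Finset.sum_le_sum hle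
    _ = 10 ^ d * G * ∑ S ∈ R.cores T ω, √(R.epochLength T S ω : ℝ) := by rw [Finset.mul_sum]
    _ ≤ 10 ^ d * G * √(n * T) := by
        gcongr
        refine Real.le_sqrt_of_sq_le ?_
        refine sq_sum_le_card_mul_sum_sq.trans ?_
        have h1 : ∑ S ∈ R.cores T ω, √(R.epochLength T S ω : ℝ) ^ 2 ≤ T := by
          calc _ = ∑ S ∈ R.cores T ω, (R.epochLength T S ω : ℝ) :=
                Finset.sum_congr rfl fun S _ => Real.sq_sqrt (Nat.cast_nonneg _)
            _ ≤ T := by exact_mod_cast hsum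
        gcongr
    _ = 10 ^ d * mainTerm reg M Pol δ ε T := by
        rw [mainTerm, mul_assoc]

theorem regret_le_mul [Nonempty A] {Λ : Learner ℕ A H} (R : Run σ M Λ μ) (T : ℕ) (ω : Ω) :
    R.regret Pol T ω ≤ H * T := by
  unfold regret
  have h1 : ∑ t ∈ Finset.range T, M.value (R.policy t ω) (R.loss t ω) ≤ H * T := by
    calc _ ≤ ∑ t ∈ Finset.range T, (H : ℝ) :=
          Finset.sum_le_sum fun t _ => M.value_le _ (R.loss_mem t ω)
      _ = H * T := by simp [mul_comm]
  have h2 : 0 ≤ ⨅ π : Pol.policies M.states, ∑ t ∈ Finset.range T, M.value π.1 (R.loss t ω) :=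
    Real.iInf_nonneg fun π => Finset.sum_nonneg fun t _ =>
      value_nonneg _ _ fun h x a => (R.loss_mem t ω h x a).1
  linarith

/-- The regret bound of SF-RL. -/
theorem measure_regret_gt_le [IsProbabilityMeasure μ] {d : ℕ} (hreg : IsRegretCoefficient d reg)
    (hdflt : ∀ h n, dflt h n ∈ Pol h n)
    (hALG : HasRegretGuarantee σ ALG (prunedPolicySet Pol abot) reg)
    (hδ : 0 < δ) (hδ1 : δ < 1) (hε : 0 ≤ ε)
    (R : Run σ M (sfrl ALG Pol dflt abot (δ / 3) ε) μ) {T : ℕ} (hT : 1 ≤ T) :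
    μ {ω | (10 ^ d + 18) * (mainTerm reg M Pol δ ε T + epsTerm M Pol ε T + burnIn M Pol δ T) <
      R.regret Pol T ω} ≤ ENNReal.ofReal δ := by
  classical
  have : Nonempty A := ⟨abot⟩
  have hH : 1 ≤ H := NeZero.one_le
  have hN : 1 ≤ (M.reachable Pol 0).card :=
    M.card_reachable_zero_pos (π := dflt) fun h x _ => hdflt h x
  have hδ0 : 0 < δ / 3 := by linarith
  have hδ01 : δ / 3 < 1 := by linarith
  have hmain := mainTerm_nonneg hreg M Pol hδ hδ1 ε hT
  have heps : 0 ≤ epsTerm M Pol ε T := by unfold epsTerm; positivity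
  have hLb := log_burnIn_ge hH hT hδ hδ1
  have hl2 := Real.log_two_gt_d9
  have hburn : 0 ≤ burnIn M Pol δ T := mul_nonneg (by positivity) (by linarith)
  have h10 : (0 : ℝ) < 10 ^ d := by positivity
  -- For `T = 1` the logarithm of the main term can be arbitrarily close to zero and does not
  -- dominate those of the copies. The trivial regret bound `H` is then covered by the burn-in term,
  -- since log 2 ≥ 1/2.
  rcases hT.eq_or_lt with rfl | hT2
  · refine le_trans (measure_mono (t := ∅) fun ω hω => ?_) (by simp)
    rw [Set.mem_ofPred_eq] at hω
    refine absurd hω (not_lt.2 ?_)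
    refine (R.regret_le_mul 1 ω).trans ?_
    have hH' : (1 : ℝ) ≤ H := by exact_mod_cast hH
    have hN' : (1 : ℝ) ≤ (M.reachable Pol 0).card := by exact_mod_cast hN
    have hb : (H : ℝ) * (1 / 2) ≤ burnIn M Pol δ 1 := by
      unfold burnIn
      have : (H : ℝ) ≤ (H : ℝ) ^ 2 * (M.reachable Pol 0).card := by nlinarith
      exact mul_le_mul this (by linarith) (by norm_num) (by positivity)
    push_cast
    nlinarith
  have hpol : ∀ t ω, R.policy t ω ∈ Pol.policies M.states := fun t ω =>
    sfrl_mem_policies hALG hdflt hδ0 hδ01 _ _ _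
  set B : ℝ := 2 * ε * T + Real.log (2 * (H : ℝ) ^ 2 * (T : ℝ) ^ 2 / (δ / 3)) + 1 with hB
  have hB0 : 0 ≤ B := by
    have := log_burnIn_ge hH hT hδ0 hδ01
    have : 0 ≤ 2 * ε * T := by positivity
    rw [hB]
    linarith
  have hE1 := R.measure_exists_epochRegret_gt_le hALG hδ0 hδ01 T
  have hE2 := R.measure_core_not_subset_le (abot := abot) hpol hδ0 hε T
  have hE3 := R.measure_sum_leaveProb_gt_le (abot := abot) (δ := δ / 3) (ε := ε) hδ0 T
  have hae := R.ae_sum_leaves_le (abot := abot) hpol hδ0 hε (T := T) hB.ge hB0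
  set E1 := {ω | ∃ t₀ < T, ∃ (S : Fin H → Finset ℕ) (hS : ∀ h, S h ⊆ M.states h),
    ω ∈ R.epochEvent t₀ S abot (δ / 3) ε ∧ ∃ K : ℕ, R.core abot (δ / 3) ε (t₀ + K) ω = S ∧
      epochBound A reg (δ / 3) S (K + 1) < R.epochRegret t₀ hS (K + 1) ω}
  set E2 := {ω | ∃ h x, x ∈ R.core abot (δ / 3) ε T ω h ∧
    (⟨h, x⟩ : Σ _ : Fin H, ℕ) ∉ M.reachable Pol ε}
  set E3 := {ω | 2 * ∑ t ∈ Finset.range T,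
      (R.leaves abot (δ / 3) ε t).indicator (fun _ => (1 : ℝ)) ω + 2 * Real.log (1 / (δ / 3)) <
    ∑ t ∈ Finset.range T, leaveProb M (R.core abot (δ / 3) ε t ω) (R.policy t ω)}
  have hsub : {ω | (10 ^ d + 18) * (mainTerm reg M Pol δ ε T + epsTerm M Pol ε T +
      burnIn M Pol δ T) < R.regret Pol T ω} ≤ᵐ[μ] (E1 ∪ (E2 ∪ E3) : Set Ω) := by
    -- The inclusion holds only almost surely, because unreachable states are avoided only almost
    -- surely.
    filter_upwards [hae] with ω hω hlt
    by_contra hgood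
    have h1 : ω ∉ E1 := fun h => hgood (Or.inl h)
    have h2 : ω ∉ E2 := fun h => hgood (Or.inr (Or.inl h))
    have h3 : ω ∉ E3 := fun h => hgood (Or.inr (Or.inr h))
    have hreach : ∀ t < T, ∀ h, ∀ x ∈ R.core abot (δ / 3) ε t ω h,
        (⟨h, x⟩ : Σ _ : Fin H, ℕ) ∈ M.reachable Pol ε := by
      intro t ht h x hx
      by_contra hnot
      exact h2 ⟨h, x, R.core_mono ω ht.le h hx, hnot⟩
    have hstates : ∀ t < T, ∀ h, R.core abot (δ / 3) ε t ω h ⊆ M.states h := by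
      intro t ht h x hx
      exact (Finset.mem_sigma.1 (Finset.mem_filter.1 (hreach t ht h x hx)).1).2
    have hr := R.regret_le_sum_epochBound hALG hdflt hδ0 hδ01 hstates h1
    have hb := R.sum_epochBound_le hreg hδ hδ1 hT2 hreach
    have hl : (H : ℝ) * ∑ t ∈ Finset.range T,
        leaveProb M (R.core abot (δ / 3) ε t ω) (R.policy t ω) ≤
        18 * (epsTerm M Pol ε T + burnIn M Pol δ T) := by
      refine le_trans ?_ (leave_bound hH hT hN hδ hδ1 hε)
      refine mul_le_mul_of_nonneg_left ((not_lt.1 h3).trans ?_) (Nat.cast_nonneg H)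
      rw [← hB]
      linarith
    have hlt' : (10 ^ d + 18) * (mainTerm reg M Pol δ ε T + epsTerm M Pol ε T +
      burnIn M Pol δ T) < R.regret Pol T ω := hlt
    have hp1 := mul_nonneg h10.le heps
    have hp2 := mul_nonneg h10.le hburn
    nlinarith
  calc _ ≤ μ (E1 ∪ (E2 ∪ E3)) := measure_mono_ae hsub
    _ ≤ μ E1 + (μ E2 + μ E3) :=
        (measure_union_le _ _).trans (add_le_add le_rfl (measure_union_le _ _))
    _ ≤ ENNReal.ofReal (δ / 3) + (ENNReal.ofReal (δ / 3) + ENNReal.ofReal (δ / 3)) :=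
        add_le_add hE1 (add_le_add hE2 hE3)
    _ = ENNReal.ofReal δ := by
        rw [← ENNReal.ofReal_add hδ0.le hδ0.le, ← ENNReal.ofReal_add hδ0.le (by linarith)]
        congr 1
        ring

end Run

end StateFreeRL

end

open MeasureTheory StateFreeRL in
theorem theorem1 (d : ℕ) :
    ∃ C : ℝ, 0 < C ∧
      ∀ (σ : Setting) (A : Type) [Fintype A] (H : ℕ) [NeZero H]
        (reg : ℕ → ℕ → ℕ → ℝ → ℝ) (_ : IsRegretCoefficient d reg)
        (Pol : PolicySet ℕ A H) (dflt : Policy ℕ A H) (_ : ∀ h n, dflt h n ∈ Pol h n) (abot : A)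
        (ALG : BlackBox (Option ℕ) A H)
        (_ : HasRegretGuarantee σ ALG (prunedPolicySet Pol abot) reg)
        (δ ε : ℝ) (_ : 0 < δ) (_ : δ < 1) (_ : 0 ≤ ε)
        (M : LayeredMDP ℕ A H)
        (Ω : Type) [MeasurableSpace Ω] (μ : Measure Ω) [IsProbabilityMeasure μ]
        (R : Run σ M (sfrl ALG Pol dflt abot (δ / 3) ε) μ)
        (T : ℕ) (_ : 1 ≤ T),
        μ {ω | C * (mainTerm reg M Pol δ ε T + epsTerm M Pol ε T + burnIn M Pol δ T)
            < R.regret Pol T ω} ≤ ENNReal.ofReal δ ∧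
        (burnIn M Pol δ T ≤ mainTerm reg M Pol δ ε T + epsTerm M Pol ε T →
          μ {ω | C * (mainTerm reg M Pol δ ε T + epsTerm M Pol ε T)
            < R.regret Pol T ω} ≤ ENNReal.ofReal δ) := by
  have h10 : (0 : ℝ) < 10 ^ d + 18 := by positivity
  -- The factor 2 serves the second claim, where the burn-in term is at most the sum of the other
  -- two.
  refine ⟨2 * (10 ^ d + 18), by positivity, ?_⟩
  intro σ A _ H _ reg hreg Pol dflt hdflt abot ALG hALG δ ε hδ hδ1 hε M Ω _ μ _ R T hT
  have : Nonempty A := ⟨abot⟩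
  have hbound := R.measure_regret_gt_le hreg hdflt hALG hδ hδ1 hε hT
  have hmain := mainTerm_nonneg hreg M Pol hδ hδ1 ε hT
  have heps : 0 ≤ epsTerm M Pol ε T := by unfold epsTerm; positivity
  have hburn : 0 ≤ burnIn M Pol δ T :=
    mul_nonneg (by positivity) ((Real.log_nonneg one_le_two).trans
      (log_burnIn_ge NeZero.one_le hT hδ hδ1))
  refine ⟨(measure_mono fun ω hω => ?_).trans hbound,
    fun hle => (measure_mono fun ω hω => ?_).trans hbound⟩
  · rw [Set.mem_ofPred_eq] at hω ⊢
    refine lt_of_le_of_lt ?_ hω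
    nlinarith
  · rw [Set.mem_ofPred_eq] at hω ⊢
    refine lt_of_le_of_lt ?_ hω
    nlinarith
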